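/- Let $d, K \ge 1$ and $D$ be integers with $d < D-K$, let $B\in\mathbb R^{D\times d}$ have full column rank with column space $\mathcal U$, let $\Pi_{\mathcal U}$ be the orthogonal projection onto $\mathcal U$, let $\Sigma_Z$ be a positive definite $d\times d$ matrix, $\sigma_\epsilon\ge 0$, and let $X = BZ+\epsilon$ with independent $Z\sim\mathcal N(0,\Sigma_Z)$ and $\epsilon\sim\mathcal N(0,\sigma_\epsilon^2 I_D)$. Put $\Sigma_X = B\Sigma_Z B^\top+\sigma_\epsilon^2 I_D$. Let $\beta>0$ and let $V:\mathbb R\to\mathbb R$ be either the hinge loss $V(t)=(1-t)_+$, with $\sigma_\epsilon^2<4$ and $\beta<1$, or the logistic loss $V(t)=\log(1+e^{-t})$, with $\sigma_\epsilon^2<-4+2\sqrt6$ and $\beta<\frac12-\frac{\sigma_\epsilon^2}{8}$. For $w=(w_1,\dots,w_K)\in(\mathbb R^D)^K$ and $m$ uniform on $\{\pm1\}^K$, independent of $X$, define $$\ell_w(x)=\mathbb E_m\sum_{k=1}^K V\Big(m_k\Big\langle w_k,\,x+\sum_{j=1}^K m_jw_j\Big\rangle\Big),\qquad \mathcal L(w)=\mathbb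 E\,\ell_w(X)+\beta\sum_{k=1}^K\|w_k\|^2,$$ and, for $n\ge1$ and points $x_1,\dots,x_n\in\mathbb R^D$, $$\mathcal L_n(w)=\frac1n\sum_{i=1}^n\ell_w(x_i)+\beta\sum_{k=1}^K\|w_k\|^2 .$$ Let $R^2=K(V(0)-\inf V)/\beta$ and $\mathcal W=\{w:\sum_{k}\|w_k\|^2\le R^2\}$. 1. For every $n\ge 1$ and all $x_1,\dots,x_n$, $\mathcal L_n$ has at least one minimizer in $(\mathbb R^D)^K$, and every minimizer lies in $\mathcal W$. 2. The function $h(r)=\mathbb E\,V(r+\sigma_\epsilon\sqrt r\,G)+\beta r$, $r\ge0$, $G\sim\mathcal N(0,1)$, has a unique minimizer $r_\star$, and $r_\star>0$. There are constants $\tau>0$ and $C>0$, not depending on $n$, on $x_1,\dots,x_n$, on $\varepsilon$ or on $\delta$ below, such that whenever $\varepsilon\le\tau$ and $\sup_{w\in\mathcal W}|\mathcal L_n(w)-\mathcal L(w)|\le\varepsilon$, every minimizer $w$ of $\mathcal L_n$ satisfies (i) $\min_k\|w_k\|^2\ge r_\star/2$; (ii) $\max_k\big|\|w_k\|^2-r_\star\big|\le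 C\sqrt\varepsilon$; (iii) $\max_k\|\Pi_{\mathcal U}w_k\|\le C\sqrt\varepsilon$; (iv) if $V$ is logistic, or $V$ is hinge and $\sigma_\epsilon>0$, then $\max_{k\ne j}|\langle w_k,w_j\rangle|\le C(\varepsilon^{1/4}+\varepsilon^{1/2}+\varepsilon)$; if $V$ is hinge and $\sigma_\epsilon=0$, then $\max_{k\ne j}|\langle w_k,w_j\rangle|\le C(\sqrt\varepsilon+\varepsilon)$. 3. Let $L>0$ be a Lipschitz constant of $V$, let $n\ge1$ and $\delta\in(0,1)$, and put $$\varepsilon_n(\delta)=LR\sqrt{K\,\mathrm{tr}(\Sigma_X)}\left(\frac{4+\frac{25}{3}\sqrt{\log(4/\delta)}}{\sqrt n}+\frac{75\log(2e)}{2\log2}\,\frac{\log(4n/\delta)\log(4/\delta)}{n}\right).$$ If $x_1,\dots,x_n$ are i.i.d. copies of $X$, then $\sup_{w\in\mathcal W}|\mathcal L_n(w)-\mathcal L(w)|\le\varepsilon_n(\delta)$ with probability at least $1-\delta$. Consequently, if $\varepsilon_n(\delta)\le\tau$, then with probability at least $1-\delta$ every minimizer of $\mathcal L_n$ satisfies (i)-(iv)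 with $\varepsilon$ replaced by $\varepsilon_n(\delta)$. -/

import Mathlib

open MeasureTheory ProbabilityTheory Set
open scoped BigOperators RealInnerProductSpace

noncomputable section

namespace Watermark

/-- The hinge loss `(1 - t)₊`. -/
def hinge (t : ℝ) : ℝ := max (1 - t) 0

/-- The logistic loss `log (1 + exp (-t))`. -/
def logistic (t : ℝ) : ℝ := Real.log (1 + Real.exp (-t))

/-- Hinge or logistic loss, with the noise variance `σ ^ 2` and the penalty `β` small. -/
def LossCondition (V : ℝ → ℝ) (σ β : ℝ) : Prop :=
  (V = hinge ∧ σ ^ 2 < 4 ∧ β < 1) ∨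
  (V = logistic ∧ σ ^ 2 < -4 + 2 * √6 ∧ β < 1 / 2 - σ ^ 2 / 8)

/-- The law of an image `X = B Z + e`, where `Z ∼ N(0, SZ)` and `e ∼ N(0, σ² I)` are
independent. -/
def imageLaw {D d : ℕ} (B : Matrix (Fin D) (Fin d) ℝ) (SZ : Matrix (Fin d) (Fin d) ℝ)
    (σ : ℝ) : Measure (EuclideanSpace ℝ (Fin D)) :=
  ((multivariateGaussian (0 : EuclideanSpace ℝ (Fin d)) SZ).prod
    (multivariateGaussian (0 : EuclideanSpace ℝ (Fin D))
      (σ ^ 2 • (1 : Matrix (Fin D) (Fin D) ℝ)))).map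
    (fun p => Matrix.toEuclideanLin B p.1 + p.2)

/-- The covariance matrix of an image, `B SZ Bᵀ + σ² I`. -/
def imageCov {D d : ℕ} (B : Matrix (Fin D) (Fin d) ℝ) (SZ : Matrix (Fin d) (Fin d) ℝ)
    (σ : ℝ) : Matrix (Fin D) (Fin D) ℝ :=
  B * SZ * B.transpose + σ ^ 2 • (1 : Matrix (Fin D) (Fin D) ℝ)

/-- The image subspace: the column space of `B`. -/
def imageSubspace {D d : ℕ} (B : Matrix (Fin D) (Fin d) ℝ) :
    Submodule ℝ (EuclideanSpace ℝ (Fin D)) :=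
  LinearMap.range (Matrix.toEuclideanLin B)

/-- The `k`-th bit of a message, as a real number `1` or `-1`. A message is an element of
`Fin K → ℤˣ`, since the units of `ℤ` are `1` and `-1`. -/
def bit {K : ℕ} (m : Fin K → ℤˣ) (k : Fin K) : ℝ := ((m k : ℤ) : ℝ)

/-- The image `x` watermarked with the message `m`: `x + ∑ j, m j • w j`. -/
def embed {D K : ℕ} (w : Fin K → EuclideanSpace ℝ (Fin D)) (m : Fin K → ℤˣ)
    (x : EuclideanSpace ℝ (Fin D)) : EuclideanSpace ℝ (Fin D) :=
  x + ∑ j, bit m j • w j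

/-- The decoding loss of `w` at the image `x`, averaged over a uniform message. -/
def decodingLoss {D K : ℕ} (V : ℝ → ℝ) (w : Fin K → EuclideanSpace ℝ (Fin D))
    (x : EuclideanSpace ℝ (Fin D)) : ℝ :=
  𝔼 m : Fin K → ℤˣ, ∑ k, V (bit m k * ⟪w k, embed w m x⟫)

/-- The population objective. -/
def popLoss {D d K : ℕ} (V : ℝ → ℝ) (β : ℝ) (B : Matrix (Fin D) (Fin d) ℝ)
    (SZ : Matrix (Fin d) (Fin d) ℝ) (σ : ℝ) (w : Fin K → EuclideanSpace ℝ (Fin D)) : ℝ :=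
  (∫ x, decodingLoss V w x ∂(imageLaw B SZ σ)) + β * ∑ k, ‖w k‖ ^ 2

/-- The finite-sample objective for the training images `x 0, …, x (n - 1)`. -/
def empLoss {D K n : ℕ} (V : ℝ → ℝ) (β : ℝ) (x : Fin n → EuclideanSpace ℝ (Fin D))
    (w : Fin K → EuclideanSpace ℝ (Fin D)) : ℝ :=
  1 / (n : ℝ) * (∑ i, decodingLoss V w (x i)) + β * ∑ k, ‖w k‖ ^ 2

/-- The one-dimensional population loss `h(r) = E V(r + σ √r Z) + β r`, with `Z ∼ N(0, 1)`. -/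
def hpop (V : ℝ → ℝ) (σ β r : ℝ) : ℝ :=
  (∫ z, V (r + σ * √r * z) ∂(gaussianReal 0 1)) + β * r

/-- The squared radius `R² = K (V 0 - inf V) / β`. -/
def radiusSq (V : ℝ → ℝ) (β : ℝ) (K : ℕ) : ℝ := K * (V 0 - ⨅ t, V t) / β

/-- The ball of watermarks with `∑ k, ‖w k‖² ≤ R²`. -/
def ball (V : ℝ → ℝ) (β : ℝ) (D K : ℕ) : Set (Fin K → EuclideanSpace ℝ (Fin D)) :=
  {w | ∑ k, ‖w k‖ ^ 2 ≤ radiusSq V β K}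

/-- `sup |L_n - L| ≤ ε` over the ball. -/
def UniformlyClose {D d K n : ℕ} (V : ℝ → ℝ) (β : ℝ) (B : Matrix (Fin D) (Fin d) ℝ)
    (SZ : Matrix (Fin d) (Fin d) ℝ) (σ : ℝ) (x : Fin n → EuclideanSpace ℝ (Fin D))
    (ε : ℝ) : Prop :=
  ∀ w ∈ ball V β D K, |empLoss V β x w - popLoss V β B SZ σ w| ≤ ε

/-- The geometric bounds on a watermark `w` at deviation level `ε`, with the constant `C`:
nontriviality, radius concentration, near-orthogonality to the image subspace, and mutual
near-orthogonality in its two cases. -/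
structure GeometricBounds {D d K : ℕ} (V : ℝ → ℝ) (σ : ℝ) (B : Matrix (Fin D) (Fin d) ℝ)
    (rstar C ε : ℝ) (w : Fin K → EuclideanSpace ℝ (Fin D)) : Prop where
  nontrivial : ∀ k, rstar / 2 ≤ ‖w k‖ ^ 2
  radius : ∀ k, |‖w k‖ ^ 2 - rstar| ≤ C * √ε
  image_subspace : ∀ k, ‖(imageSubspace B).starProjection (w k)‖ ≤ C * √ε
  orthogonal : (V = logistic ∨ (V = hinge ∧ 0 < σ)) → ∀ k j, k ≠ j →
    |⟪w k, w j⟫| ≤ C * (ε ^ (1 / 4 : ℝ) + ε ^ (1 / 2 : ℝ) + ε)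
  orthogonal_hinge : (V = hinge ∧ σ = 0) → ∀ k j, k ≠ j → |⟪w k, w j⟫| ≤ C * (√ε + ε)

/-- The uniform deviation level `ε_n(δ)`, for a loss with Lipschitz constant `L`. -/
def deviation {D d : ℕ} (V : ℝ → ℝ) (β : ℝ) (K : ℕ) (B : Matrix (Fin D) (Fin d) ℝ)
    (SZ : Matrix (Fin d) (Fin d) ℝ) (σ L : ℝ) (n : ℕ) (δ : ℝ) : ℝ :=
  L * √(radiusSq V β K) * √(K * (imageCov B SZ σ).trace) *
    ((4 + 25 / 3 * √(Real.log (4 / δ))) / √n +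
      75 * Real.log (2 * Real.exp 1) / (2 * Real.log 2) *
        (Real.log (4 * n / δ) * Real.log (4 / δ) / n))

end Watermark

end

/-! Population side. Given the message, the argument of the loss for the `k`-th bit is `∑ j, m k * m
j * ⟪w k, w j⟫` plus a centered Gaussian variable, the projection of the image on `w k`, which
splits into a signal part of deviation `signalStd` and a noise part of deviation `σ ‖w k‖`. Jensen's
inequality over the other bits and then over the signal bounds the `k`-th term below by `h (‖w k‖²)
≥ h rstar` (`IsLoss.hpop_le_popTerm`). Both inequalities are equalities for orthogonal watermarks of
squared length `rstar` in the orthogonal complement of the image subspace, where there is room for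
`K` of them (`IsLoss.exists_popLoss_eq`). So the minimum of the population loss is `K h(rstar)`, and
uniform closeness puts an empirical minimizer within `2 ε` of it.

Since every term is at least `h rstar`, each single term has excess at most `2 ε`. That excess
controls three gaps at once (`IsLoss.gap_le`): the growth of `h` at `‖w k‖²`, the Jensen gap of the
signal, and the second difference of the smoothed loss at step `⟪w k, w j⟫`. Quadratic growth of `h`
turns the first into the radius bound. Quantitative convexity of the noise-smoothed loss
(`exists_gaussAvg_gap`, `exists_mul_sq_le_gaussAvg_sub`) turns the other two into bounds of order
`√ε`. The hinge without noise has no curvature, but its kink sits exactly at `rstar = 1` and gives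
gaps linear in the displacement.

The conditions on `σ` make `h` strictly convex. Along `N(r, σ² r)` an average of `f` has derivative
the average of `f' + σ² / 2 f''`; for the logistic loss two applications of this operator leave a
positive function, and for the hinge a closed formula reduces the question to `(1 + r)² > σ² r`. The
conditions on `β` make `h` decrease somewhere below `h 0`, so that its minimizer is positive.

Sampling side. The logistic loss is a mixture of hinges of total mass one
(`integral_max_mul_logitVar`), so both losses reduce to positive parts of affine functions, and, up
to a linear part, to `(⟪u, x⟫ - b)₊` with `b ≥ 0` and `‖u‖ ≤ 1`. Such a threshold may be clipped at
`‖x‖`. After symmetrization, contraction removes the positive part and leaves `‖∑ m i x i‖` and the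
truncated sums `∑ m i min b ‖x i‖`; a maximal inequality controls the latter uniformly in `b`. All
exponential moments are compared with those of one Gaussian variable whose variance is the trace of
the covariance, without any dimension factor, and Chernoff's bound ends the argument. -/

namespace Watermark

/-! ### The two losses -/

lemma hinge_nonneg (t : ℝ) : 0 ≤ hinge t := le_max_right _ _

lemma hinge_abs_sub_le (a b : ℝ) : |hinge a - hinge b| ≤ |a - b| := by
  have := abs_max_sub_max_le_abs (1 - a) (1 - b) 0
  rw [show (1 - a) - (1 - b) = -(a - b) by ring, abs_neg] at this
  exact this

lemma convexOn_hinge : ConvexOn ℝ univ hinge :=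
  ((convexOn_const (1 : ℝ) convex_univ).sub (concaveOn_id convex_univ)).sup
    (convexOn_const (0 : ℝ) convex_univ)

/-- The hinge is affine away from its kink at `1`, so a second difference only sees how far the step
reaches beyond the kink. -/
lemma hinge_add_hinge_sub (y s : ℝ) :
    hinge (y + s) + hinge (y - s) - 2 * hinge y = max (|s| - |1 - y|) 0 := by
  unfold hinge
  rcases le_total 0 s with hs | hs <;> rcases le_total 0 (1 - y) with hy | hy <;>
    simp only [abs_of_nonneg, abs_of_nonpos, hs, hy] <;>
    rcases le_total 0 (1 - (y + s)) with h1 | h1 <;>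
    rcases le_total 0 (1 - (y - s)) with h2 | h2 <;>
    simp only [max_eq_left, max_eq_right, h1, h2, hy] <;>
    first
    | (rw [max_eq_left] <;> linarith)
    | (rw [max_eq_right] <;> linarith)

/-- The logistic function `1 / (1 + exp t)`. -/
noncomputable def logit (t : ℝ) : ℝ := 1 / (1 + Real.exp t)

lemma logit_pos (t : ℝ) : 0 < logit t := by unfold logit; positivity

lemma logit_lt_one (t : ℝ) : logit t < 1 := by
  unfold logit
  rw [div_lt_one (by positivity)]
  linarith [Real.exp_pos t]

lemma hasDerivAt_logit (t : ℝ) : HasDerivAt logit (-(logit t * (1 - logit t))) t := by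
  have h := ((Real.hasDerivAt_exp t).const_add 1).inv (by positivity)
  have he : logit = (fun t => 1 + Real.exp t)⁻¹ := funext fun t => one_div _
  rw [he]
  refine h.congr_deriv ?_
  simp only [Pi.inv_apply]
  have : (1 + Real.exp t) ≠ 0 := by positivity
  field_simp
  ring

lemma continuous_logit : Continuous logit :=
  continuous_iff_continuousAt.2 fun t => (hasDerivAt_logit t).continuousAt

lemma hasDerivAt_logistic (t : ℝ) : HasDerivAt logistic (-logit t) t := by
  unfold logistic logit
  have h := (((hasDerivAt_neg t).exp).const_add 1).log (by positivity)
  convert h using 1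
  rw [Real.exp_neg]
  field_simp
  ring

lemma logistic_nonneg (t : ℝ) : 0 ≤ logistic t :=
  Real.log_nonneg (by linarith [Real.exp_pos (-t)])

lemma logistic_abs_sub_le (a b : ℝ) : |logistic a - logistic b| ≤ |a - b| := by
  have h := Convex.norm_image_sub_le_of_norm_hasDerivWithin_le (f := logistic)
    (f' := fun t => -logit t) (s := univ) (C := 1) (x := b) (y := a)
    (fun t _ => (hasDerivAt_logistic t).hasDerivWithinAt) (fun t _ => by
      rw [Real.norm_eq_abs, abs_neg, abs_of_pos (logit_pos t)]; exact (logit_lt_one t).le)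
    convex_univ (mem_univ _) (mem_univ _)
  simpa using h

lemma hasDerivAt_logistic_sub_sq (c t : ℝ) :
    HasDerivAt (fun t => logistic t - c / 2 * t ^ 2) (-logit t - c * t) t := by
  have := (hasDerivAt_logistic t).sub ((hasDerivAt_pow 2 t).const_mul (c / 2))
  refine this.congr_deriv ?_
  norm_num
  ring

lemma hasDerivAt_deriv_logistic_sub_sq (c t : ℝ) :
    HasDerivAt (fun t => -logit t - c * t) (logit t * (1 - logit t) - c) t := by
  have := (hasDerivAt_logit t).neg.sub ((hasDerivAt_id t).const_mul c)
  refine this.congr_deriv ?_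
  ring

lemma convexOn_logistic_sub_sq {c : ℝ} {s : Set ℝ} (hs : Convex ℝ s)
    (h : ∀ t ∈ s, c ≤ logit t * (1 - logit t)) :
    ConvexOn ℝ s (fun t => logistic t - c / 2 * t ^ 2) := by
  have hd : deriv (fun t => logistic t - c / 2 * t ^ 2) = fun t => -logit t - c * t :=
    funext fun t => (hasDerivAt_logistic_sub_sq c t).deriv
  refine convexOn_of_deriv2_nonneg hs
    (fun t _ => (hasDerivAt_logistic_sub_sq c t).continuousAt.continuousWithinAt)
    (fun t _ => (hasDerivAt_logistic_sub_sq c t).differentiableAt.differentiableWithinAt) ?_ ?_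
  · rw [hd]
    exact fun t _ => (hasDerivAt_deriv_logistic_sub_sq c t).differentiableAt.differentiableWithinAt
  · intro t ht
    rw [show deriv^[2] (fun t => logistic t - c / 2 * t ^ 2)
      = deriv (deriv (fun t => logistic t - c / 2 * t ^ 2)) from rfl, hd,
      (hasDerivAt_deriv_logistic_sub_sq c t).deriv]
    linarith [h t (interior_subset ht)]

lemma convexOn_logistic : ConvexOn ℝ univ logistic := by
  have := convexOn_logistic_sub_sq (c := 0) convex_univ fun t _ =>
    mul_nonneg (logit_pos t).le (by linarith [logit_lt_one t])
  simpa using this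

/-- The product is `exp t / (1 + exp t)²`, an even function of `t` that decays like `exp (-|t|)`.
This is the strong convexity of the logistic loss on bounded sets. -/
lemma exp_neg_le_logit_mul {Y t : ℝ} (ht : |t| ≤ Y) :
    Real.exp (-Y) / 4 ≤ logit t * (1 - logit t) := by
  have h0 : logit t * (1 - logit t) = Real.exp t / (1 + Real.exp t) ^ 2 := by
    unfold logit
    field_simp
    ring
  have h1 : Real.exp (-|t|) / 4 ≤ Real.exp t / (1 + Real.exp t) ^ 2 := by
    rw [div_le_div_iff₀ (by norm_num) (by positivity)]
    rcases le_total 0 t with h | h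
    · rw [abs_of_nonneg h, Real.exp_neg]
      have h2 : 1 ≤ Real.exp t := Real.one_le_exp h
      rw [inv_mul_le_iff₀ (by positivity)]
      nlinarith
    · rw [abs_of_nonpos h, neg_neg]
      have h2 : Real.exp t ≤ 1 := Real.exp_le_one_iff.2 h
      have h3 := Real.exp_pos t
      have : (1 + Real.exp t) ^ 2 ≤ 4 := by nlinarith
      exact mul_le_mul_of_nonneg_left this h3.le
  rw [h0]
  have : Real.exp (-Y) ≤ Real.exp (-|t|) := Real.exp_le_exp.2 (by linarith)
  linarith

/-- The second derivative is at most `1 / 4`, its value at `0`, so the second Taylor polynomial at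
`0` lies above the loss. -/
lemma logistic_le (t : ℝ) : logistic t ≤ Real.log 2 - t / 2 + t ^ 2 / 8 := by
  have hd (t : ℝ) : HasDerivAt (fun t => t ^ 2 / 8 - t / 2 - logistic t)
      (t / 4 - 1 / 2 + logit t) t := by
    have := (((hasDerivAt_pow 2 t).div_const 8).sub ((hasDerivAt_id t).div_const 2)).sub
      (hasDerivAt_logistic t)
    refine this.congr_deriv ?_
    norm_num
    ring
  have hd2 (t : ℝ) : HasDerivAt (fun t => t / 4 - 1 / 2 + logit t)
      (1 / 4 - logit t * (1 - logit t)) t := by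
    have := (((hasDerivAt_id t).div_const 4).sub_const (1 / 2)).add (hasDerivAt_logit t)
    refine this.congr_deriv ?_
    ring
  have hd' : deriv (fun t => t ^ 2 / 8 - t / 2 - logistic t) = fun t => t / 4 - 1 / 2 + logit t :=
    funext fun t => (hd t).deriv
  have hc : ConvexOn ℝ univ (fun t => t ^ 2 / 8 - t / 2 - logistic t) := by
    refine convexOn_of_deriv2_nonneg convex_univ
      (fun t _ => (hd t).continuousAt.continuousWithinAt)
      (fun t _ => (hd t).differentiableAt.differentiableWithinAt) ?_ ?_
    · rw [hd']
      exact fun t _ => (hd2 t).differentiableAt.differentiableWithinAt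
    · intro t _
      rw [show deriv^[2] (fun t => t ^ 2 / 8 - t / 2 - logistic t)
        = deriv (deriv (fun t => t ^ 2 / 8 - t / 2 - logistic t)) from rfl, hd', (hd2 t).deriv]
      nlinarith [sq_nonneg (logit t - 1 / 2)]
  have h0 : deriv (fun t => t ^ 2 / 8 - t / 2 - logistic t) 0 = 0 := by
    rw [(hd 0).deriv]; simp [logit]; norm_num
  have hmin : IsMinOn (fun t => t ^ 2 / 8 - t / 2 - logistic t) univ 0 := by
    refine hc.isMinOn_of_rightDeriv_eq_zero (by simp) ?_
    rw [(hd 0).hasDerivWithinAt.derivWithin (uniqueDiffWithinAt_Ioi 0), ← (hd 0).deriv]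
    exact h0
  have := hmin (mem_univ t)
  simp only [mem_ofPred_eq] at this
  have h2 : logistic 0 = Real.log 2 := by simp [logistic]; norm_num
  rw [h2] at this
  linarith

/-- The properties shared by the two losses. -/
structure IsLoss (V : ℝ → ℝ) : Prop where
  nonneg : ∀ t, 0 ≤ V t
  convexOn : ConvexOn ℝ univ V
  abs_sub_le : ∀ a b, |V a - V b| ≤ |a - b|

lemma LossCondition.isLoss {V : ℝ → ℝ} {σ β : ℝ} (h : LossCondition V σ β) : IsLoss V := by
  rcases h with ⟨rfl, -⟩ | ⟨rfl, -⟩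
  · exact ⟨hinge_nonneg, convexOn_hinge, hinge_abs_sub_le⟩
  · exact ⟨logistic_nonneg, convexOn_logistic, logistic_abs_sub_le⟩

namespace IsLoss
variable {V : ℝ → ℝ}

lemma lipschitzWith (h : IsLoss V) : LipschitzWith 1 V :=
  LipschitzWith.of_dist_le_mul fun a b => by simpa [Real.dist_eq] using h.abs_sub_le a b

lemma continuous (h : IsLoss V) : Continuous V := h.lipschitzWith.continuous

lemma le_add_abs (h : IsLoss V) (t : ℝ) : V t ≤ V 0 + |t| := by
  have := (abs_le.1 (h.abs_sub_le t 0)).2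
  simp only [sub_zero] at this
  linarith

lemma bddBelow (h : IsLoss V) : BddBelow (range V) :=
  ⟨0, by rintro _ ⟨t, rfl⟩; exact h.nonneg t⟩

lemma iInf_le (h : IsLoss V) (t : ℝ) : ⨅ t, V t ≤ V t := ciInf_le h.bddBelow t

lemma integrable_comp {α : Type*} [MeasurableSpace α] {μ : Measure α} [IsFiniteMeasure μ]
    (h : IsLoss V) {g : α → ℝ} (hg : Integrable g μ) : Integrable (fun x => V (g x)) μ := by
  refine Integrable.mono' ((integrable_const (V 0)).add hg.abs)
    (h.continuous.comp_aestronglyMeasurable hg.aestronglyMeasurable) (.of_forall fun x => ?_)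
  rw [Real.norm_eq_abs, abs_of_nonneg (h.nonneg _)]
  exact h.le_add_abs _

lemma two_mul_le (h : IsLoss V) (x s : ℝ) : 2 * V x ≤ V (x + s) + V (x - s) := by
  have := h.convexOn.2 (mem_univ (x + s)) (mem_univ (x - s)) (show (0 : ℝ) ≤ 1 / 2 by norm_num)
    (show (0 : ℝ) ≤ 1 / 2 by norm_num) (by norm_num)
  simp only [smul_eq_mul] at this
  rw [show 1 / 2 * (x + s) + 1 / 2 * (x - s) = x by ring] at this
  linarith

end IsLoss

/-! ### Quadratic growth of a strictly convex function at its minimizer -/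

/-- `r₀` is a minimizer of `h` on the half-line, near which `h` grows quadratically, and away from
which `h` is bounded away from its minimum. -/
def QuadraticGrowth (h : ℝ → ℝ) (r₀ : ℝ) : Prop :=
  ∃ c > 0, ∃ η > 0, ∀ r, 0 ≤ r → h r - h r₀ ≤ η →
    r₀ / 2 ≤ r ∧ r ≤ 2 * r₀ ∧ c * (r - r₀) ^ 2 ≤ h r - h r₀

lemma QuadraticGrowth.eq_of_isMinOn {h : ℝ → ℝ} {r₀ r : ℝ} (hg : QuadraticGrowth h r₀)
    (hr₀ : 0 ≤ r₀) (hr : 0 ≤ r) (hmin : IsMinOn h (Ici 0) r) : r = r₀ := by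
  obtain ⟨c, hc, η, hη, H⟩ := hg
  have h1 : h r ≤ h r₀ := hmin hr₀
  have h2 := (H r hr (by linarith)).2.2
  have h3 : (r - r₀) ^ 2 ≤ 0 := by
    by_contra! h4
    nlinarith [mul_pos hc h4]
  nlinarith [pow_eq_zero_iff (two_ne_zero) |>.1 (le_antisymm h3 (sq_nonneg _))]

lemma convexOn_of_hasDerivAt2_nonneg {D : Set ℝ} (hD : Convex ℝ D) {f f₁ f₂ : ℝ → ℝ}
    (hf : ContinuousOn f D) (h1 : ∀ x ∈ interior D, HasDerivAt f (f₁ x) x)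
    (h2 : ∀ x ∈ interior D, HasDerivAt f₁ (f₂ x) x) (h3 : ∀ x ∈ interior D, 0 ≤ f₂ x) :
    ConvexOn ℝ D f := by
  have hd : ∀ x ∈ interior D, deriv f =ᶠ[nhds x] f₁ := fun x hx =>
    Filter.eventually_of_mem (isOpen_interior.mem_nhds hx) fun y hy => (h1 y hy).deriv
  refine convexOn_of_deriv2_nonneg hD hf
    (fun x hx => (h1 x hx).differentiableAt.differentiableWithinAt)
    (fun x hx => ((h2 x hx).congr_of_eventuallyEq (hd x hx)).differentiableAt.differentiableWithinAt)
    fun x hx => ?_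
  rw [show deriv^[2] f x = deriv (deriv f) x from rfl,
    ((h2 x hx).congr_of_eventuallyEq (hd x hx)).deriv]
  exact h3 x hx

/-- Coercivity gives a minimizer, the decrease below `h 0` makes it an interior critical point, and
the second derivative is bounded below on a compact neighbourhood. Farther away convexity keeps `h`
above its values at the ends of that neighbourhood. -/
lemma exists_quadraticGrowth {h h₁ h₂ : ℝ → ℝ} {β : ℝ} (hβ : 0 < β)
    (hcont : ContinuousOn h (Ici 0)) (hd1 : ∀ r, 0 < r → HasDerivAt h (h₁ r) r)
    (hd2 : ∀ r, 0 < r → HasDerivAt h₁ (h₂ r) r) (hpos : ∀ r, 0 < r → 0 < h₂ r)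
    (hcont2 : ContinuousOn h₂ (Ioi 0)) (hdec : ∃ r, 0 < r ∧ h r < h 0)
    (hcoer : ∀ r, 0 ≤ r → β * r ≤ h r) :
    ∃ r₀, 0 < r₀ ∧ IsMinOn h (Ici 0) r₀ ∧ QuadraticGrowth h r₀ := by
  obtain ⟨r₁, hr₁, hr₁0⟩ := hdec
  have hh0 : 0 ≤ h 0 := by simpa using hcoer 0 le_rfl
  obtain ⟨r₀, hr₀, hmin⟩ := isCompact_Icc.exists_isMinOn (s := Icc 0 (h 0 / β))
    ⟨0, le_rfl, by positivity⟩ (hcont.mono Icc_subset_Ici_self)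
  have hmin' : IsMinOn h (Ici 0) r₀ := by
    intro r hr
    by_cases hr' : r ≤ h 0 / β
    · exact hmin ⟨hr, hr'⟩
    · have h1 : h r₀ ≤ h 0 := hmin ⟨le_rfl, by positivity⟩
      have h2 : h 0 < β * r := by
        rw [not_le, div_lt_iff₀ hβ] at hr'
        linarith
      have h3 := hcoer r hr
      show h r₀ ≤ h r
      linarith
  have hr₀pos : 0 < r₀ := by
    rcases hr₀.1.eq_or_lt with h0 | h0
    · have : h r₀ ≤ h r₁ := hmin' hr₁.le
      rw [← h0] at this
      linarith
    · exact h0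
  refine ⟨r₀, hr₀pos, hmin', ?_⟩
  have hcrit : h₁ r₀ = 0 :=
    (IsLocalMin.hasDerivAt_eq_zero (hmin'.isLocalMin (Ici_mem_nhds hr₀pos)) (hd1 r₀ hr₀pos))
  have hsub : Icc (r₀ / 2) (2 * r₀) ⊆ Ioi 0 := fun r hr => lt_of_lt_of_le (by positivity) hr.1
  obtain ⟨r₂, hr₂, hmin2⟩ := isCompact_Icc.exists_isMinOn (s := Icc (r₀ / 2) (2 * r₀))
    ⟨r₀, by linarith, by linarith⟩ (hcont2.mono hsub)
  -- Half the least second derivative on the interval, so that subtracting `c * (r - r₀) ^ 2`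
  -- preserves convexity.
  set c := h₂ r₂ / 2 with hc
  have hcpos : 0 < c := by have := hpos r₂ (hsub hr₂); positivity
  have hgd1 (r : ℝ) (hr : 0 < r) :
      HasDerivAt (fun r => h r - c * (r - r₀) ^ 2) (h₁ r - 2 * c * (r - r₀)) r := by
    have := (hd1 r hr).sub ((((hasDerivAt_id r).sub_const r₀).pow 2).const_mul c)
    refine this.congr_deriv ?_
    simp only [id]
    norm_num
    ring
  have hgd2 (r : ℝ) (hr : 0 < r) :
      HasDerivAt (fun r => h₁ r - 2 * c * (r - r₀)) (h₂ r - 2 * c) r := by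
    have := (hd2 r hr).sub (((hasDerivAt_id r).sub_const r₀).const_mul (2 * c))
    refine this.congr_deriv ?_
    ring
  have hgconv : ConvexOn ℝ (Icc (r₀ / 2) (2 * r₀)) (fun r => h r - c * (r - r₀) ^ 2) := by
    refine convexOn_of_hasDerivAt2_nonneg (convex_Icc _ _)
      (fun r hr => (hgd1 r (hsub hr)).continuousAt.continuousWithinAt)
      (fun r hr => hgd1 r (hsub (interior_subset hr)))
      (fun r hr => hgd2 r (hsub (interior_subset hr))) fun r hr => ?_
    have : h₂ r₂ ≤ h₂ r := hmin2 (interior_subset hr)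
    rw [hc]
    linarith
  have hgmin : IsMinOn (fun r => h r - c * (r - r₀) ^ 2) (Icc (r₀ / 2) (2 * r₀)) r₀ := by
    refine hgconv.isMinOn_of_rightDeriv_eq_zero ?_ ?_
    · rw [interior_Icc]; constructor <;> linarith
    · rw [(hgd1 r₀ hr₀pos).hasDerivWithinAt.derivWithin (uniqueDiffWithinAt_Ioi r₀), hcrit]
      simp
  have hquad (r : ℝ) (hr : r ∈ Icc (r₀ / 2) (2 * r₀)) : c * (r - r₀) ^ 2 ≤ h r - h r₀ := by
    have : h r₀ - c * (r₀ - r₀) ^ 2 ≤ h r - c * (r - r₀) ^ 2 := hgmin hr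
    simp only [sub_self] at this
    linarith
  have hconv : ConvexOn ℝ (Ici 0) h := by
    refine convexOn_of_hasDerivAt2_nonneg (f₁ := h₁) (f₂ := h₂) (convex_Ici 0) hcont ?_ ?_ ?_ <;>
      rw [interior_Ici]
    · exact hd1
    · exact hd2
    · exact fun r hr => (hpos r hr).le
  have hmem : r₀ ∈ Ici (0 : ℝ) := hr₀pos.le
  -- The excess is at least `c r₀² / 4` at `r₀ / 2` and `c r₀²` at `2 r₀`, hence also beyond these
  -- points; an excess below `c r₀² / 8` excludes both sides.
  refine ⟨c, hcpos, c * r₀ ^ 2 / 8, by positivity, fun r hr hle => ?_⟩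
  have hmr : h r₀ ≤ h r := hmin' hr
  have hl : r₀ / 2 ≤ r := by
    by_contra! hlt
    have h1 := hconv.le_max_of_mem_Icc (x := r) (y := r₀) (z := r₀ / 2) hr hmem
      ⟨hlt.le, by linarith⟩
    rw [max_eq_left hmr] at h1
    have h2 := hquad (r₀ / 2) ⟨le_rfl, by linarith⟩
    have h3 : c * (r₀ / 2 - r₀) ^ 2 = c * r₀ ^ 2 / 4 := by ring
    have h4 : 0 < c * r₀ ^ 2 := by positivity
    linarith
  have hu : r ≤ 2 * r₀ := by
    by_contra! hlt
    have h1 := hconv.le_max_of_mem_Icc (x := r₀) (y := r) (z := 2 * r₀) hmem hr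
      ⟨by linarith, hlt.le⟩
    rw [max_eq_right hmr] at h1
    have h2 := hquad (2 * r₀) ⟨by linarith, le_rfl⟩
    have h3 : c * (2 * r₀ - r₀) ^ 2 = c * r₀ ^ 2 := by ring
    have h4 : 0 < c * r₀ ^ 2 := by positivity
    linarith
  exact ⟨hl, hu, hquad r ⟨hl, hu⟩⟩

/-! ### The standard normal density -/

lemma hasDerivAt_gaussianPDFReal (x : ℝ) :
    HasDerivAt (gaussianPDFReal 0 1) (-x * gaussianPDFReal 0 1 x) x := by
  unfold gaussianPDFReal
  have h := ((((((hasDerivAt_id x).sub_const 0).pow 2).neg).div_const (2 * ((1 : NNReal) : ℝ))).exp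
    ).const_mul (√(2 * Real.pi * ((1 : NNReal) : ℝ)))⁻¹
  refine h.congr_deriv ?_
  simp
  ring

lemma continuous_gaussianPDFReal : Continuous (gaussianPDFReal 0 1) :=
  continuous_iff_continuousAt.2 fun x => (hasDerivAt_gaussianPDFReal x).continuousAt

lemma integrable_id_gaussianReal : Integrable (fun z : ℝ => z) (gaussianReal 0 1) :=
  (memLp_id_gaussianReal 1).integrable le_rfl

lemma integrable_gaussianReal_iff {f : ℝ → ℝ} :
    Integrable f (gaussianReal 0 1) ↔ Integrable (fun x => gaussianPDFReal 0 1 x * f x) := by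
  rw [gaussianReal_of_var_ne_zero 0 one_ne_zero,
    integrable_withDensity_iff_integrable_smul' (measurable_gaussianPDF 0 1)
      (.of_forall fun _ => gaussianPDF_lt_top)]
  simp [gaussianPDF, ENNReal.toReal_ofReal (gaussianPDFReal_nonneg _ _ _)]

lemma integrable_mul_gaussianPDFReal : Integrable (fun x => x * gaussianPDFReal 0 1 x) := by
  have := integrable_gaussianReal_iff.1 integrable_id_gaussianReal
  simpa only [mul_comm] using this

lemma integral_gaussianReal (f : ℝ → ℝ) :
    ∫ z, f z ∂gaussianReal 0 1 = ∫ z, gaussianPDFReal 0 1 z * f z := by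
  rw [integral_gaussianReal_eq_integral_smul one_ne_zero]
  simp

/-- Gaussian integration by parts. -/
lemma integral_mul_gaussianReal_eq_integral_deriv {g g' : ℝ → ℝ} {C C' : ℝ}
    (hd : ∀ z, HasDerivAt g (g' z) z) (hg : ∀ z, |g z| ≤ C) (hg' : ∀ z, |g' z| ≤ C')
    (hc : Continuous g') :
    ∫ z, z * g z ∂gaussianReal 0 1 = ∫ z, g' z ∂gaussianReal 0 1 := by
  have hgc : Continuous g := continuous_iff_continuousAt.2 fun z => (hd z).continuousAt
  rw [integral_gaussianReal, integral_gaussianReal]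
  have h := integral_mul_deriv_eq_deriv_mul_of_integrable (u := g) (u' := g')
    (v := gaussianPDFReal 0 1) (v' := fun x => -x * gaussianPDFReal 0 1 x)
    (fun x _ => hd x) (fun x _ => hasDerivAt_gaussianPDFReal x) ?_ ?_ ?_
  · rw [show (∫ z, gaussianPDFReal 0 1 z * (z * g z))
      = - ∫ x, g x * (-x * gaussianPDFReal 0 1 x) by
        rw [← integral_neg]; congr 1; ext x; ring, h, neg_neg]
    congr 1; ext x; ring
  · have := (integrable_mul_gaussianPDFReal.neg).bdd_mul (c := C) hgc.aestronglyMeasurable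
      (.of_forall fun z => hg z)
    refine this.congr (.of_forall fun x => ?_)
    simp
  · exact (integrable_gaussianPDFReal 0 1).bdd_mul (c := C') hc.aestronglyMeasurable
      (.of_forall fun z => hg' z)
  · exact (integrable_gaussianPDFReal 0 1).bdd_mul (c := C) hgc.aestronglyMeasurable
      (.of_forall fun z => hg z)

/-! ### The one-dimensional population loss -/

lemma integrable_const_add_mul_gaussianReal (y c : ℝ) :
    Integrable (fun z : ℝ => y + c * z) (gaussianReal 0 1) :=
  (integrable_const y).add (integrable_id_gaussianReal.const_mul c)

lemma IsLoss.integrable_smooth {V : ℝ → ℝ} (hV : IsLoss V) (y c : ℝ) :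
    Integrable (fun z => V (y + c * z)) (gaussianReal 0 1) :=
  hV.integrable_comp (integrable_const_add_mul_gaussianReal y c)

/-- The derivative formulas fail at `r = 0`, where `√r` is not differentiable; the Lipschitz bound
on the loss gives continuity up to that endpoint. -/
lemma IsLoss.continuous_hpop {V : ℝ → ℝ} (hV : IsLoss V) (σ β : ℝ) :
    Continuous (hpop V σ β) := by
  have key (r s : ℝ) : |(∫ z, V (r + σ * √r * z) ∂gaussianReal 0 1) -
      ∫ z, V (s + σ * √s * z) ∂gaussianReal 0 1| ≤
        |r - s| + |σ * √r - σ * √s| * ∫ z, |z| ∂gaussianReal 0 1 := by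
    rw [← integral_sub (hV.integrable_smooth _ _) (hV.integrable_smooth _ _)]
    have hi : Integrable (fun z : ℝ => |σ * √r - σ * √s| * |z|) (gaussianReal 0 1) :=
      integrable_id_gaussianReal.abs.const_mul _
    refine (abs_integral_le_integral_abs).trans ?_
    calc ∫ z, |V (r + σ * √r * z) - V (s + σ * √s * z)| ∂gaussianReal 0 1
        ≤ ∫ z, (|r - s| + |σ * √r - σ * √s| * |z|) ∂gaussianReal 0 1 := by
          refine integral_mono ((hV.integrable_smooth _ _).sub (hV.integrable_smooth _ _)).abs
            ((integrable_const _).add hi) fun z => ?_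
          refine (hV.abs_sub_le _ _).trans ?_
          rw [← abs_mul]
          refine le_trans (le_of_eq ?_) (abs_add_le _ _)
          congr 1; ring
      _ = _ := by
          rw [integral_add (integrable_const _) hi, integral_const_mul]
          simp
  unfold hpop
  refine Continuous.add ?_ (by fun_prop)
  refine continuous_iff_continuousAt.2 fun s => ?_
  rw [ContinuousAt, tendsto_iff_dist_tendsto_zero]
  refine squeeze_zero (fun _ => dist_nonneg) (fun r => key r s) ?_
  have : Continuous fun r : ℝ => |r - s| + |σ * √r - σ * √s| * ∫ z, |z| ∂gaussianReal 0 1 := by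
    fun_prop
  have h := this.tendsto s
  simpa using h

lemma IsLoss.mul_le_hpop {V : ℝ → ℝ} (hV : IsLoss V) (σ β r : ℝ) : β * r ≤ hpop V σ β r :=
  le_add_of_nonneg_left (integral_nonneg fun _ => hV.nonneg _)

lemma hpop_zero (V : ℝ → ℝ) (σ β : ℝ) : hpop V σ β 0 = V 0 := by simp [hpop]

/-- Along the curve `r ↦ N(r, σ² r)`, Gaussian averages evolve by the generator
`f' + σ² / 2 * f''`. -/
lemma hasDerivAt_integral_gaussianReal {f f₁ f₂ : ℝ → ℝ} {C₁ C₂ σ r : ℝ}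
    (hσ : 0 ≤ σ) (hr : 0 < r)
    (hd1 : ∀ t, HasDerivAt f (f₁ t) t) (hd2 : ∀ t, HasDerivAt f₁ (f₂ t) t)
    (hb1 : ∀ t, |f₁ t| ≤ C₁) (hb2 : ∀ t, |f₂ t| ≤ C₂) (hc : Continuous f₂)
    (hint : Integrable (fun z => f (r + σ * √r * z)) (gaussianReal 0 1)) :
    HasDerivAt (fun r => ∫ z, f (r + σ * √r * z) ∂gaussianReal 0 1)
      (∫ z, (f₁ (r + σ * √r * z) + σ ^ 2 / 2 * f₂ (r + σ * √r * z)) ∂gaussianReal 0 1) r := by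
  have hfc : Continuous f := continuous_iff_continuousAt.2 fun t => (hd1 t).continuousAt
  have hf1c : Continuous f₁ := continuous_iff_continuousAt.2 fun t => (hd2 t).continuousAt
  have hC1 : 0 ≤ C₁ := (abs_nonneg _).trans (hb1 0)
  have hsq : 0 < √r := Real.sqrt_pos.2 hr
  -- Restricting to `r' > r / 2` keeps the factor `1 / √r'` bounded, which supplies the dominating
  -- function.
  have hF := hasDerivAt_integral_of_dominated_loc_of_deriv_le (μ := gaussianReal 0 1)
    (F := fun r z => f (r + σ * √r * z)) (x₀ := r) (s := Ioi (r / 2))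
    (F' := fun r z => f₁ (r + σ * √r * z) * (1 + σ * (1 / (2 * √r)) * z))
    (bound := fun z => C₁ * (1 + σ * (1 / (2 * √(r / 2))) * |z|))
    (Ioi_mem_nhds (by linarith)) (.of_forall fun r => by fun_prop) hint
    (by fun_prop) (.of_forall fun z r' hr' => ?_) ?_ (.of_forall fun z r' hr' => ?_)
  · refine hF.2.congr_deriv ?_
    symm
    -- The derivative of `r + σ √r z` contributes `σ z / (2 √r)`; integration by parts trades the
    -- `z` for a factor `σ √r` and a derivative, whence `σ² / 2`.
    have hst := integral_mul_gaussianReal_eq_integral_deriv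
      (g := fun z => f₁ (r + σ * √r * z)) (g' := fun z => f₂ (r + σ * √r * z) * (σ * √r))
      (C := C₁) (C' := C₂ * |σ * √r|) (fun z => ?_) (fun z => hb1 _) (fun z => ?_) (by fun_prop)
    · have i1 : Integrable (fun z => f₁ (r + σ * √r * z)) (gaussianReal 0 1) :=
        Integrable.of_bound (by fun_prop) C₁ (.of_forall fun z => hb1 _)
      have i2 : Integrable (fun z => f₂ (r + σ * √r * z)) (gaussianReal 0 1) :=
        Integrable.of_bound (by fun_prop) C₂ (.of_forall fun z => hb2 _)
      have i3 : Integrable (fun z => z * f₁ (r + σ * √r * z)) (gaussianReal 0 1) :=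
        integrable_id_gaussianReal.mul_bdd (c := C₁) (by fun_prop) (.of_forall fun z => hb1 _)
      rw [integral_add i1 (i2.const_mul _), integral_const_mul]
      rw [show (fun z => f₁ (r + σ * √r * z) * (1 + σ * (1 / (2 * √r)) * z)) =
        fun z => f₁ (r + σ * √r * z) + σ * (1 / (2 * √r)) * (z * f₁ (r + σ * √r * z)) by
          ext z; ring, integral_add i1 (i3.const_mul _), integral_const_mul, hst,
          integral_mul_const]
      field_simp
    · have := (hd2 (r + σ * √r * z)).comp z
        (((hasDerivAt_id z).const_mul (σ * √r)).const_add r)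
      refine this.congr_deriv ?_
      simp
    · rw [abs_mul]
      exact mul_le_mul_of_nonneg_right (hb2 _) (abs_nonneg _)
  · rw [Real.norm_eq_abs, abs_mul]
    refine mul_le_mul (hb1 _) ?_ (abs_nonneg _) hC1
    refine (abs_add_le _ _).trans ?_
    rw [abs_one, abs_mul, abs_of_nonneg (by positivity : 0 ≤ σ * (1 / (2 * √r')))]
    have h1 : √(r / 2) ≤ √r' := Real.sqrt_le_sqrt (le_of_lt hr')
    have h2 : 0 < √(r / 2) := Real.sqrt_pos.2 (by positivity)
    gcongr
  · exact ((integrable_const (1 : ℝ)).add (integrable_id_gaussianReal.abs.const_mul _)).const_mul _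
  · have hr'0 : 0 < r' := lt_trans (by positivity) hr'
    have hs := ((Real.hasDerivAt_sqrt hr'0.ne').const_mul σ).mul_const z
    exact (hd1 (r' + σ * √r' * z)).comp r' ((hasDerivAt_id r').add hs)

lemma continuous_integral_gaussianReal {f : ℝ → ℝ} {C : ℝ} (σ : ℝ) (hc : Continuous f)
    (hb : ∀ t, |f t| ≤ C) :
    Continuous (fun r => ∫ z, f (r + σ * √r * z) ∂gaussianReal 0 1) :=
  continuous_of_dominated (bound := fun _ => C) (fun r => by fun_prop)
    (fun r => .of_forall fun z => hb _) (integrable_const C) (.of_forall fun z => by fun_prop)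

/-! #### Logistic loss -/

/-- The second derivative of the logistic loss. -/
noncomputable def logitVar (t : ℝ) : ℝ := logit t * (1 - logit t)

lemma logitVar_pos (t : ℝ) : 0 < logitVar t :=
  mul_pos (logit_pos t) (sub_pos.2 (logit_lt_one t))

lemma logitVar_le (t : ℝ) : logitVar t ≤ 1 / 4 := by
  unfold logitVar; nlinarith [sq_nonneg (logit t - 1 / 2)]

lemma hasDerivAt_logitVar (t : ℝ) :
    HasDerivAt logitVar (-(1 - 2 * logit t) * logitVar t) t := by
  have := (hasDerivAt_logit t).mul ((hasDerivAt_logit t).const_sub 1)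
  refine this.congr_deriv ?_
  unfold logitVar
  ring

lemma continuous_logitVar : Continuous logitVar := by
  have := continuous_logit
  unfold logitVar; fun_prop

lemma abs_one_sub_logit_le (t : ℝ) : |1 - 2 * logit t| ≤ 1 := by
  rw [abs_le]; constructor <;> linarith [logit_pos t, logit_lt_one t]

lemma abs_logitVar_le (t : ℝ) : |logitVar t| ≤ 1 := by
  rw [abs_of_pos (logitVar_pos t)]; linarith [logitVar_le t]

/-- Write `p = 1 - 2 * logit t` and `s = σ²`. The generator applied twice to the loss is `logitVar t
* (1 - s p - s² / 4 * (2 * logitVar t - p²))`. As `p ≤ 1` and `logitVar ≤ 1 / 4`, the bracket is at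
least `1 - s - s² / 8`, which is positive under the assumed bound on `σ²`. -/
lemma exists_quadraticGrowth_hpop_logistic {σ β : ℝ} (hσ : 0 ≤ σ) (hβ : 0 < β)
    (h1 : σ ^ 2 < -4 + 2 * √6) (h2 : β < 1 / 2 - σ ^ 2 / 8) :
    ∃ r₀, 0 < r₀ ∧ IsMinOn (hpop logistic σ β) (Ici 0) r₀ ∧
      QuadraticGrowth (hpop logistic σ β) r₀ := by
  have hV : IsLoss logistic := ⟨logistic_nonneg, convexOn_logistic, logistic_abs_sub_le⟩
  have hq := continuous_logit
  have hκ := continuous_logitVar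
  set s := σ ^ 2 with hs
  have hs0 : 0 ≤ s := sq_nonneg σ
  -- The number `-4 + 2√6` is the positive root of `s² + 8 s - 8`.
  have hs8 : s + s ^ 2 / 8 < 1 := by
    have h6 : √6 ^ 2 = 6 := Real.sq_sqrt (by norm_num)
    have h60 : 0 ≤ √6 := Real.sqrt_nonneg _
    nlinarith
  have hs1 : s < 1 := by nlinarith
  -- the generator applied to the loss, once and twice
  set g : ℝ → ℝ := fun t => -logit t + s / 2 * logitVar t with hg
  set g₁ : ℝ → ℝ := fun t => logitVar t - s / 2 * ((1 - 2 * logit t) * logitVar t) with hg1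
  set g₂ : ℝ → ℝ := fun t => -(1 - 2 * logit t) * logitVar t -
    s / 2 * (2 * logitVar t * logitVar t -
      (1 - 2 * logit t) ^ 2 * logitVar t) with hg2
  have hgd (t : ℝ) : HasDerivAt g (g₁ t) t := by
    refine ((hasDerivAt_logit t).neg.add ((hasDerivAt_logitVar t).const_mul (s / 2))).congr_deriv ?_
    simp only [hg1]
    unfold logitVar
    ring
  have hgd1 (t : ℝ) : HasDerivAt g₁ (g₂ t) t := by
    refine ((hasDerivAt_logitVar t).sub (((((hasDerivAt_logit t).const_mul 2).const_sub 1).mul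
      (hasDerivAt_logitVar t)).const_mul (s / 2))).congr_deriv ?_
    simp only [hg2]
    unfold logitVar
    ring
  have hgc : Continuous g := by fun_prop
  have hg1c : Continuous g₁ := by fun_prop
  have hg2c : Continuous g₂ := by fun_prop
  have hgb (t : ℝ) : |g t| ≤ 2 := by
    have a1 := logit_pos t
    have a2 := logit_lt_one t
    have a3 := logitVar_pos t
    have a4 := logitVar_le t
    simp only [hg]
    rw [abs_le]; constructor <;> nlinarith
  have hmul (t : ℝ) : |(1 - 2 * logit t) * logitVar t| ≤ 1 := by
    rw [abs_mul]
    exact mul_le_one₀ (abs_one_sub_logit_le t) (abs_nonneg _) (abs_logitVar_le t)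
  have hg1b (t : ℝ) : |g₁ t| ≤ 2 := by
    have a1 := abs_le.1 (hmul t)
    have a2 := abs_le.1 (abs_logitVar_le t)
    simp only [hg1]
    rw [abs_le]; constructor <;> nlinarith
  have hg2b (t : ℝ) : |g₂ t| ≤ 3 := by
    have a1 := abs_le.1 (hmul t)
    have a2 : 2 * logitVar t * logitVar t ≤ 1 := by nlinarith [logitVar_pos t, logitVar_le t]
    have a2' : 0 ≤ 2 * logitVar t * logitVar t := by nlinarith [logitVar_pos t]
    have a3 : (1 - 2 * logit t) ^ 2 * logitVar t ≤ 1 := by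
      refine mul_le_one₀ ?_ (logitVar_pos t).le (abs_le.1 (abs_logitVar_le t)).2
      rw [sq_le_one_iff_abs_le_one]; exact abs_one_sub_logit_le t
    have a3' : 0 ≤ (1 - 2 * logit t) ^ 2 * logitVar t :=
      mul_nonneg (sq_nonneg _) (logitVar_pos t).le
    simp only [hg2]
    rw [abs_le]; constructor <;> nlinarith
  have hpos (t : ℝ) : 0 < g₁ t + s / 2 * g₂ t := by
    have e : g₁ t + s / 2 * g₂ t = logitVar t * (1 - s * (1 - 2 * logit t) -
        s ^ 2 / 4 * (2 * logitVar t - (1 - 2 * logit t) ^ 2)) := by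
      simp only [hg1, hg2]; ring
    rw [e]
    refine mul_pos (logitVar_pos t) ?_
    have a1 := (abs_le.1 (abs_one_sub_logit_le t)).2
    have a2 := logitVar_le t
    nlinarith [sq_nonneg (1 - 2 * logit t), sq_nonneg s, mul_nonneg (sq_nonneg s)
      (sq_nonneg (1 - 2 * logit t)), mul_le_mul_of_nonneg_left a1 hs0,
      mul_le_mul_of_nonneg_left a2 (sq_nonneg s)]
  have hint (f : ℝ → ℝ) (C : ℝ) (hc : Continuous f) (hb : ∀ t, |f t| ≤ C) (r : ℝ) :
      Integrable (fun z => f (r + σ * √r * z)) (gaussianReal 0 1) :=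
    Integrable.of_bound (by fun_prop) C (.of_forall fun z => hb _)
  refine exists_quadraticGrowth (β := β)
    (h₁ := fun r => (∫ z, g (r + σ * √r * z) ∂gaussianReal 0 1) + β)
    (h₂ := fun r => ∫ z, (g₁ (r + σ * √r * z) + s / 2 * g₂ (r + σ * √r * z)) ∂gaussianReal 0 1)
    hβ (hV.continuous_hpop σ β).continuousOn (fun r hr => ?_) (fun r hr => ?_) (fun r hr => ?_)
    ?_ ?_ (fun r _ => hV.mul_le_hpop σ β r)
  · have := (hasDerivAt_integral_gaussianReal hσ hr hasDerivAt_logistic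
      (fun t => (hasDerivAt_logit t).neg) (C₁ := 1) (C₂ := 1) (fun t => ?_) (fun t => ?_)
      (by simp only [neg_neg]; exact hκ) (hV.integrable_smooth _ _)).add
        ((hasDerivAt_id r).const_mul β)
    · refine this.congr_deriv ?_
      simp [hg, logitVar, hs]
    · rw [abs_neg, abs_of_pos (logit_pos t)]; exact (logit_lt_one t).le
    · rw [neg_neg]; exact abs_logitVar_le t
  · exact (hasDerivAt_integral_gaussianReal hσ hr hgd hgd1 hg1b hg2b hg2c
      (hint g 2 hgc hgb r)).add_const β
  · rw [integral_pos_iff_support_of_nonneg (fun z => (hpos _).le)]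
    · rw [Function.support_eq_univ fun z => (hpos _).ne']
      simp
    · exact (hint g₁ 2 hg1c hg1b r).add ((hint g₂ 3 hg2c hg2b r).const_mul _)
  · exact (continuous_integral_gaussianReal σ (f := fun t => g₁ t + s / 2 * g₂ t)
      (C := 5) (by fun_prop) fun t => by
        have b1 := abs_le.1 (hg1b t)
        have b2 := abs_le.1 (hg2b t)
        rw [abs_le]; constructor <;> nlinarith).continuousOn
  -- The quadratic upper bound on the loss gives `h r - h 0 ≤ r (-1/2 + s/8 + β + r/8)`, which is
  -- `-7 r² / 8` for this `r`.
  · set r := 1 / 2 - s / 8 - β with hr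
    have hr0 : 0 < r := by linarith
    have hsq2 : Integrable (fun z : ℝ => z ^ 2) (gaussianReal 0 1) :=
      (memLp_id_gaussianReal 2).integrable_sq
    have hmean : ∫ z, z ∂gaussianReal 0 1 = 0 := integral_id_gaussianReal
    have hvar : ∫ z, z ^ 2 ∂gaussianReal 0 1 = 1 := by
      have := variance_fun_id_gaussianReal (μ := 0) (v := 1)
      rw [variance_of_integral_eq_zero (by fun_prop) integral_id_gaussianReal] at this
      simpa using this
    have hle : ∫ z, logistic (r + σ * √r * z) ∂gaussianReal 0 1 ≤
        Real.log 2 - r / 2 + (r ^ 2 + s * r) / 8 := by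
      have hb (z : ℝ) : logistic (r + σ * √r * z) ≤ (Real.log 2 - r / 2 + r ^ 2 / 8) +
          ((-1 / 2 + r / 4) * (σ * √r)) * z + s * r / 8 * z ^ 2 := by
        refine (logistic_le _).trans (le_of_eq ?_)
        have : √r ^ 2 = r := Real.sq_sqrt hr0.le
        rw [hs]
        linear_combination σ ^ 2 * z ^ 2 / 8 * this
      have hi1 : Integrable (fun z : ℝ => (Real.log 2 - r / 2 + r ^ 2 / 8) +
          ((-1 / 2 + r / 4) * (σ * √r)) * z) (gaussianReal 0 1) :=
        integrable_const_add_mul_gaussianReal _ _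
      refine (integral_mono (hV.integrable_smooth _ _) (hi1.add (hsq2.const_mul _)) hb).trans
        (le_of_eq ?_)
      simp only [Pi.add_apply]
      rw [integral_add hi1 (hsq2.const_mul _), integral_add (integrable_const _)
        (integrable_id_gaussianReal.const_mul _), integral_const_mul, integral_const_mul, hmean,
        hvar]
      simp
      ring
    refine ⟨r, hr0, ?_⟩
    rw [hpop_zero, show logistic 0 = Real.log 2 by simp [logistic]; norm_num]
    unfold hpop
    nlinarith

/-! #### Hinge loss -/

/-- The distribution function of the standard normal law. -/
noncomputable def normalCDF (x : ℝ) : ℝ := ∫ z in Iic x, gaussianPDFReal 0 1 z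

lemma hasDerivAt_normalCDF (x : ℝ) : HasDerivAt normalCDF (gaussianPDFReal 0 1 x) x := by
  have hi := integrable_gaussianPDFReal 0 1
  have e : normalCDF = fun y => (∫ z in Iic 0, gaussianPDFReal 0 1 z) +
      ∫ z in (0 : ℝ)..y, gaussianPDFReal 0 1 z := by
    ext y
    rw [← intervalIntegral.integral_Iic_sub_Iic hi.integrableOn hi.integrableOn]
    unfold normalCDF
    ring
  rw [e]
  exact (intervalIntegral.integral_hasDerivAt_right (hi.intervalIntegrable)
    (continuous_gaussianPDFReal.stronglyMeasurableAtFilter _ _)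
    continuous_gaussianPDFReal.continuousAt).const_add _

lemma integral_Iic_mul_gaussianPDFReal (x : ℝ) :
    ∫ z in Iic x, z * gaussianPDFReal 0 1 z = -gaussianPDFReal 0 1 x := by
  have hd (z : ℝ) : HasDerivAt (fun z => -gaussianPDFReal 0 1 z) (z * gaussianPDFReal 0 1 z) z :=
    (hasDerivAt_gaussianPDFReal z).neg.congr_deriv (by ring)
  have hi := integrable_mul_gaussianPDFReal
  rw [integral_Iic_of_hasDerivAt_of_tendsto (f := fun z => -gaussianPDFReal 0 1 z) (m := 0)
    (hd x).continuousAt.continuousWithinAt (fun z _ => hd z) hi.integrableOn]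
  · ring
  · exact tendsto_zero_of_hasDerivAt_of_integrableOn_Iic (a := 0) (fun z _ => hd z)
      hi.integrableOn (integrable_gaussianPDFReal 0 1).neg.integrableOn

lemma integral_hinge_gaussianReal {y c : ℝ} (hc : 0 < c) :
    ∫ z, hinge (y + c * z) ∂gaussianReal 0 1 =
      (1 - y) * normalCDF ((1 - y) / c) + c * gaussianPDFReal 0 1 ((1 - y) / c) := by
  rw [integral_gaussianReal]
  have e : (fun z => gaussianPDFReal 0 1 z * hinge (y + c * z)) =
      (Iic ((1 - y) / c)).indicator
        (fun z => (1 - y) * gaussianPDFReal 0 1 z - c * (z * gaussianPDFReal 0 1 z)) := by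
    ext z
    unfold hinge
    by_cases hz : z ≤ (1 - y) / c
    · rw [indicator_of_mem (mem_Iic.2 hz), max_eq_left]
      · ring
      · rw [le_div_iff₀ hc] at hz
        linarith
    · rw [indicator_of_notMem (by simpa using hz), max_eq_right]
      · ring
      · rw [not_le, div_lt_iff₀ hc] at hz
        linarith
  rw [e, integral_indicator measurableSet_Iic, integral_sub, integral_const_mul,
    integral_const_mul, integral_Iic_mul_gaussianPDFReal, normalCDF]
  · ring
  · exact ((integrable_gaussianPDFReal 0 1).const_mul _).integrableOn
  · exact (integrable_mul_gaussianPDFReal.const_mul _).integrableOn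

/-- For `r ≤ 1 / 2` the hinge at `r + t` is at most `1 - r - t + 8 t⁴`. With `t = σ √r z` the error
averages to order `r²`, while the linear part gains `(1 - β) r`. -/
lemma exists_hpop_hinge_lt {σ β : ℝ} (hβ : β < 1) :
    ∃ r, 0 < r ∧ hpop hinge σ β r < hpop hinge σ β 0 := by
  have hV : IsLoss hinge := ⟨hinge_nonneg, convexOn_hinge, hinge_abs_sub_le⟩
  have h4 : Integrable (fun z : ℝ => z ^ 4) (gaussianReal 0 1) := by
    have := (memLp_id_gaussianReal' (μ := 0) (v := 1) 4 (by simp)).integrable_norm_pow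
      (by norm_num : (4 : ℕ) ≠ 0)
    simpa [Even.pow_abs (by decide : Even 4)] using this
  set m := ∫ z, z ^ 4 ∂gaussianReal 0 1 with hm
  have hm0 : 0 ≤ m := integral_nonneg fun z => by positivity
  have hmean : ∫ z, z ∂gaussianReal 0 1 = 0 := integral_id_gaussianReal
  have hb (r : ℝ) (hr : 0 < r) (hr1 : r ≤ 1 / 2) (z : ℝ) :
      hinge (r + σ * √r * z) ≤ (1 - r) + (-(σ * √r)) * z + 8 * σ ^ 4 * r ^ 2 * z ^ 4 := by
    have e4 : √r ^ 4 = r ^ 2 := by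
      rw [show √r ^ 4 = (√r ^ 2) ^ 2 by ring, Real.sq_sqrt hr.le]
    set t := σ * √r * z with ht
    have e : 8 * σ ^ 4 * r ^ 2 * z ^ 4 = 8 * t ^ 4 := by
      rw [ht, ← e4]; ring
    rw [e]
    unfold hinge
    refine max_le ?_ ?_
    · have : 0 ≤ t ^ 4 := by positivity
      linarith
    · rcases le_total t (1 / 2) with h | h
      · have : 0 ≤ t ^ 4 := by positivity
        linarith
      · have h3 : 1 ≤ 8 * t ^ 3 := by nlinarith [sq_nonneg (t - 1 / 2)]
        nlinarith
  have hle (r : ℝ) (hr : 0 < r) (hr1 : r ≤ 1 / 2) :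
      hpop hinge σ β r ≤ 1 - r + 8 * σ ^ 4 * r ^ 2 * m + β * r := by
    refine add_le_add ?_ le_rfl
    have hi1 := integrable_const_add_mul_gaussianReal (1 - r) (-(σ * √r))
    refine (integral_mono (hV.integrable_smooth _ _) (hi1.add (h4.const_mul _))
      (hb r hr hr1)).trans (le_of_eq ?_)
    simp only [Pi.add_apply]
    rw [integral_add hi1 (h4.const_mul _), integral_add (integrable_const _)
        (integrable_id_gaussianReal.const_mul _), integral_const_mul, integral_const_mul, hmean, ← hm]
    simp
  set a := 8 * σ ^ 4 * m with ha
  have ha0 : 0 ≤ a := by positivity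
  set r := min (1 / 2) ((1 - β) / (2 * (a + 1))) with hr
  have hr0 : 0 < r := lt_min (by norm_num) (div_pos (by linarith) (by positivity))
  refine ⟨r, hr0, ?_⟩
  rw [hpop_zero, show hinge 0 = 1 by simp [hinge]]
  refine (hle r hr0 (min_le_left _ _)).trans_lt ?_
  have h1 : r * (2 * (a + 1)) ≤ 1 - β := (le_div_iff₀ (by positivity)).1 (min_le_right _ _)
  have h2 : a * r < 1 - β := by nlinarith
  nlinarith [mul_pos hr0 (sub_pos.2 h2)]

/-- The Gaussian average of the hinge is explicit in the normal distribution function and density.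
The sign of the second derivative is that of `(1 + r)² - σ² r`, positive because `(1 + r)² ≥ 4 r >
σ² r`. -/
lemma exists_quadraticGrowth_hpop_hinge {σ β : ℝ} (hσ : 0 < σ) (hβ : 0 < β)
    (h1 : σ ^ 2 < 4) (h2 : β < 1) :
    ∃ r₀, 0 < r₀ ∧ IsMinOn (hpop hinge σ β) (Ici 0) r₀ ∧
      QuadraticGrowth (hpop hinge σ β) r₀ := by
  have hV : IsLoss hinge := ⟨hinge_nonneg, convexOn_hinge, hinge_abs_sub_le⟩
  set n := gaussianPDFReal 0 1 with hn
  have hnpos (x : ℝ) : 0 < n x := gaussianPDFReal_pos 0 1 x one_ne_zero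
  set x : ℝ → ℝ := fun r => (1 - r) / (σ * √r) with hx
  have hxd (r : ℝ) (hr : 0 < r) : HasDerivAt x (-((1 + r) / (2 * σ * r * √r))) r := by
    have hs : 0 < √r := Real.sqrt_pos.2 hr
    have h := ((hasDerivAt_id r).const_sub 1).div ((Real.hasDerivAt_sqrt hr.ne').const_mul σ)
      (by positivity)
    refine h.congr_deriv ?_
    simp only [id]
    have e : √r ^ 2 = r := Real.sq_sqrt hr.le
    field_simp
    rw [e]
    ring
  have hnd (r : ℝ) (hr : 0 < r) :
      HasDerivAt (fun r => n (x r)) (-(x r) * n (x r) * -((1 + r) / (2 * σ * r * √r))) r :=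
    (hasDerivAt_gaussianPDFReal (x r)).comp r (hxd r hr)
  have hΦd (r : ℝ) (hr : 0 < r) :
      HasDerivAt (fun r => normalCDF (x r)) (n (x r) * -((1 + r) / (2 * σ * r * √r))) r :=
    (hasDerivAt_normalCDF (x r)).comp r (hxd r hr)
  have hform (r : ℝ) (hr : 0 < r) : hpop hinge σ β r =
      (1 - r) * normalCDF (x r) + σ * √r * n (x r) + β * r := by
    rw [hpop, integral_hinge_gaussianReal (mul_pos hσ (Real.sqrt_pos.2 hr))]
  refine exists_quadraticGrowth (β := β)
    (h₁ := fun r => -normalCDF (x r) + σ / 2 * (√r)⁻¹ * n (x r) + β)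
    (h₂ := fun r => n (x r) * (((1 + r) ^ 2 - σ ^ 2 * r) / (4 * σ * r ^ 2 * √r)))
    hβ (hV.continuous_hpop σ β).continuousOn (fun r hr => ?_) (fun r hr => ?_) (fun r hr => ?_)
    ?_ (exists_hpop_hinge_lt h2) (fun r _ => hV.mul_le_hpop σ β r)
  · have hs : 0 < √r := Real.sqrt_pos.2 hr
    have e : √r ^ 2 = r := Real.sq_sqrt hr.le
    have hd := ((((hasDerivAt_id r).const_sub 1).mul (hΦd r hr)).add
      (((Real.hasDerivAt_sqrt hr.ne').const_mul σ).mul (hnd r hr))).add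
      ((hasDerivAt_id r).const_mul β)
    have hd' : HasDerivAt (fun r => (1 - r) * normalCDF (x r) + σ * √r * n (x r) + β * r) _ r := hd
    refine (hd'.congr_of_eventuallyEq ?_).congr_deriv ?_
    · filter_upwards [Ioi_mem_nhds hr] with r' hr'
      exact hform r' hr'
    -- This identity cancels the two terms that contain the derivative of `x`.
    · have ex : σ * √r * x r = 1 - r := by
        simp only [hx]; field_simp
      clear_value x
      simp only [id]
      linear_combination (n (x r) * ((1 + r) / (2 * σ * r * √r))) * ex
  · have hs : 0 < √r := Real.sqrt_pos.2 hr
    have e : √r ^ 2 = r := Real.sq_sqrt hr.le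
    have hd := (((hΦd r hr).neg).add ((((Real.hasDerivAt_sqrt hr.ne').inv hs.ne').const_mul
      (σ / 2)).mul (hnd r hr))).add_const β
    refine hd.congr_deriv ?_
    simp only [hx]
    simp only [Pi.inv_apply]
    field_simp
    simp only [e]
    ring
  · have hs : 0 < √r := Real.sqrt_pos.2 hr
    refine mul_pos (hnpos _) (div_pos ?_ (by positivity))
    nlinarith [sq_nonneg (1 - r)]
  · have hnc : Continuous n := continuous_gaussianPDFReal
    have hxc : ContinuousOn x (Ioi 0) := fun r hr => (hxd r hr).continuousAt.continuousWithinAt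
    refine (hnc.comp_continuousOn hxc).mul (ContinuousOn.div (by fun_prop) (by fun_prop) ?_)
    intro r hr
    have hs : 0 < √r := Real.sqrt_pos.2 hr
    have : (0 : ℝ) < r := hr
    positivity

lemma hpop_hinge_zero {β r : ℝ} : hpop hinge 0 β r = hinge r + β * r := by
  simp [hpop]

/-- Without noise `h` is piecewise linear, with slopes `β - 1` and `β` on the two sides of `1`. -/
lemma abs_sub_one_le_hpop_hinge {β : ℝ} {r : ℝ} :
    min (1 - β) β * |r - 1| ≤ hpop hinge 0 β r - hpop hinge 0 β 1 := by
  rw [hpop_hinge_zero, hpop_hinge_zero]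
  unfold hinge
  rcases le_total r 1 with h | h
  · rw [abs_of_nonpos (by linarith), max_eq_left (by linarith)]
    have := mul_le_mul_of_nonneg_right (min_le_left (1 - β) β) (by linarith : 0 ≤ 1 - r)
    norm_num
    nlinarith
  · rw [abs_of_nonneg (by linarith), max_eq_right (by linarith)]
    have := mul_le_mul_of_nonneg_right (min_le_right (1 - β) β) (by linarith : 0 ≤ r - 1)
    norm_num
    nlinarith

/-- The linear growth dominates the square for `|r - 1| ≤ 1`, and the excess allowed here confines
`r` to `|r - 1| ≤ 1 / 2`. -/
lemma quadraticGrowth_hpop_hinge_zero {β : ℝ} (hβ : 0 < β) (h2 : β < 1) :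
    IsMinOn (hpop hinge 0 β) (Ici 0) 1 ∧ QuadraticGrowth (hpop hinge 0 β) 1 := by
  have hc : 0 < min (1 - β) β := lt_min (by linarith) hβ
  refine ⟨fun r _ => ?_, min (1 - β) β, hc, min (1 - β) β / 2, by positivity, fun r hr hle => ?_⟩
  · have := abs_sub_one_le_hpop_hinge (β := β) (r := r)
    have h3 : 0 ≤ min (1 - β) β * |r - 1| := by positivity
    show hpop hinge 0 β 1 ≤ hpop hinge 0 β r
    linarith
  · have h := abs_sub_one_le_hpop_hinge (β := β) (r := r)
    have h3 : |r - 1| ≤ 1 / 2 := by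
      by_contra! h4
      nlinarith
    have h4 := abs_le.1 h3
    refine ⟨by linarith, by linarith, le_trans ?_ h⟩
    refine mul_le_mul_of_nonneg_left ?_ hc.le
    rw [← sq_abs]
    nlinarith [abs_nonneg (r - 1)]

/-- The one-dimensional population loss has a positive minimizer with quadratic growth. -/
lemma LossCondition.exists_quadraticGrowth {V : ℝ → ℝ} {σ β : ℝ} (hV : LossCondition V σ β)
    (hσ : 0 ≤ σ) (hβ : 0 < β) :
    ∃ r₀, 0 < r₀ ∧ IsMinOn (hpop V σ β) (Ici 0) r₀ ∧ QuadraticGrowth (hpop V σ β) r₀ := by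
  rcases hV with ⟨rfl, h1, h2⟩ | ⟨rfl, h1, h2⟩
  · rcases hσ.eq_or_lt with rfl | hσ
    · exact ⟨1, one_pos, quadraticGrowth_hpop_hinge_zero hβ h2⟩
    · exact exists_quadraticGrowth_hpop_hinge hσ hβ h1 h2
  · exact exists_quadraticGrowth_hpop_logistic hσ hβ h1 h2

/-! ### Gaussian averages of a loss -/

/-- The average of `V` under the normal law of mean `y` and standard deviation `b`. -/
noncomputable def gaussAvg (V : ℝ → ℝ) (b y : ℝ) : ℝ := ∫ z, V (y + b * z) ∂gaussianReal 0 1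

lemma hpop_eq_gaussAvg (V : ℝ → ℝ) (σ β r : ℝ) :
    hpop V σ β r = gaussAvg V (σ * √r) r + β * r := rfl

@[simp] lemma gaussAvg_zero (V : ℝ → ℝ) (y : ℝ) : gaussAvg V 0 y = V y := by simp [gaussAvg]

lemma integral_neg_gaussianReal (f : ℝ → ℝ) :
    ∫ z, f (-z) ∂gaussianReal 0 1 = ∫ z, f z ∂gaussianReal 0 1 := by
  have h : (gaussianReal 0 1).map (fun z => -z) = gaussianReal 0 1 := by
    rw [gaussianReal_map_neg, neg_zero]
  conv_rhs => rw [← h]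
  exact (integral_map_equiv (MeasurableEquiv.neg ℝ) f).symm

section IsLoss
variable {V : ℝ → ℝ}

lemma IsLoss.gaussAvg (hV : IsLoss V) (b : ℝ) : IsLoss (gaussAvg V b) where
  nonneg t := integral_nonneg fun _ => hV.nonneg _
  convexOn := by
    refine ⟨convex_univ, fun x _ y _ p q hp hq hpq => ?_⟩
    simp only [Watermark.gaussAvg, smul_eq_mul]
    rw [← integral_const_mul, ← integral_const_mul, ← integral_add
      ((hV.integrable_smooth _ _).const_mul _) ((hV.integrable_smooth _ _).const_mul _)]
    refine integral_mono (hV.integrable_smooth _ _) (((hV.integrable_smooth _ _).const_mul _).add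
      ((hV.integrable_smooth _ _).const_mul _)) fun z => ?_
    have := hV.convexOn.2 (mem_univ (x + b * z)) (mem_univ (y + b * z)) hp hq hpq
    simp only [smul_eq_mul] at this
    refine le_trans (le_of_eq ?_) this
    congr 1
    linear_combination -(b * z) * hpq
  abs_sub_le x y := by
    simp only [Watermark.gaussAvg]
    rw [← integral_sub (hV.integrable_smooth _ _) (hV.integrable_smooth _ _)]
    refine abs_integral_le_integral_abs.trans ?_
    have : |x - y| = ∫ z, |x - y| ∂gaussianReal 0 1 := by simp
    rw [this]
    refine integral_mono ((hV.integrable_smooth _ _).sub (hV.integrable_smooth _ _)).abs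
      (integrable_const _) fun z => ?_
    refine (hV.abs_sub_le _ _).trans (le_of_eq ?_)
    congr 1; ring

lemma IsLoss.integrable_gap (hV : IsLoss V) (b y s : ℝ) :
    Integrable (fun z => V (y + b * z + s) + V (y + b * z - s) - 2 * V (y + b * z))
      (gaussianReal 0 1) := by
  have h1 := hV.integrable_comp ((integrable_const_add_mul_gaussianReal y b).add
    (integrable_const s))
  have h2 := hV.integrable_comp ((integrable_const_add_mul_gaussianReal y b).sub
    (integrable_const s))
  exact (h1.add h2).sub ((hV.integrable_smooth y b).const_mul 2)

lemma IsLoss.gaussAvg_gap (hV : IsLoss V) (b y s : ℝ) :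
    Watermark.gaussAvg V b (y + s) + Watermark.gaussAvg V b (y - s) - 2 * Watermark.gaussAvg V b y =
      ∫ z, (V (y + b * z + s) + V (y + b * z - s) - 2 * V (y + b * z)) ∂gaussianReal 0 1 := by
  have h1 := hV.integrable_smooth (y + s) b
  have h2 := hV.integrable_smooth (y - s) b
  have h3 := hV.integrable_smooth y b
  unfold Watermark.gaussAvg
  have e : (fun z => V (y + b * z + s) + V (y + b * z - s) - 2 * V (y + b * z)) =
      fun z => V (y + s + b * z) + V (y - s + b * z) - 2 * V (y + b * z) := by
    ext z
    rw [show y + b * z + s = y + s + b * z by ring, show y + b * z - s = y - s + b * z by ring]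
  have h12 : Integrable (fun z => V (y + s + b * z) + V (y - s + b * z)) (gaussianReal 0 1) :=
    h1.add h2
  rw [e, integral_sub h12 (h3.const_mul 2), integral_add h1 h2, integral_const_mul]

/-- Averaging over `s` and `-s` together, by symmetry of the normal law, expresses a Jensen gap
through second differences. -/
lemma IsLoss.gaussAvg_sub_eq (hV : IsLoss V) (a y : ℝ) :
    Watermark.gaussAvg V a y - V y =
      1 / 2 * ∫ s, (V (y + a * s) + V (y - a * s) - 2 * V y) ∂gaussianReal 0 1 := by
  have h1 := hV.integrable_smooth y a
  have h2 : Integrable (fun s => V (y - a * s)) (gaussianReal 0 1) := by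
    simpa [sub_eq_add_neg] using hV.integrable_smooth y (-a)
  have h3 : ∫ s, V (y - a * s) ∂gaussianReal 0 1 = ∫ s, V (y + a * s) ∂gaussianReal 0 1 := by
    rw [← integral_neg_gaussianReal]
    simp
  have h12 : Integrable (fun s => V (y + a * s) + V (y - a * s)) (gaussianReal 0 1) := h1.add h2
  rw [integral_sub h12 (integrable_const _), integral_add h1 h2, h3]
  simp [Watermark.gaussAvg]
  ring

lemma IsLoss.le_gaussAvg (hV : IsLoss V) (a y : ℝ) : V y ≤ Watermark.gaussAvg V a y := by
  have := hV.gaussAvg_sub_eq a y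
  have h : 0 ≤ ∫ s, (V (y + a * s) + V (y - a * s) - 2 * V y) ∂gaussianReal 0 1 :=
    integral_nonneg fun s => by
      have := hV.two_mul_le y (a * s)
      simp only [Pi.zero_apply]
      linarith
  linarith

end IsLoss

/-! ### Lower bounds on convexity gaps -/

lemma gaussianPDFReal_le_of_abs_le {z Y : ℝ} (h : |z| ≤ Y) :
    gaussianPDFReal 0 1 Y ≤ gaussianPDFReal 0 1 z := by
  unfold gaussianPDFReal
  refine mul_le_mul_of_nonneg_left (Real.exp_le_exp.2 ?_) (by positivity)
  have : z ^ 2 ≤ Y ^ 2 := sq_le_sq' (by linarith [abs_le.1 h]) (abs_le.1 h).2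
  simp
  linarith

/-- Only the window from `p` to `q` is kept, and there the density is at least its value at `Y`. -/
lemma le_integral_gaussianReal {f : ℝ → ℝ} {m p q Y : ℝ} (hf : ∀ z, 0 ≤ f z)
    (hi : Integrable f (gaussianReal 0 1)) (hm : 0 ≤ m) (hpq : p ≤ q)
    (hY : ∀ z ∈ Icc p q, |z| ≤ Y) (hmf : ∀ z ∈ Icc p q, m ≤ f z) :
    m * (q - p) * gaussianPDFReal 0 1 Y ≤ ∫ z, f z ∂gaussianReal 0 1 := by
  rw [integral_gaussianReal]
  have hi' := integrable_gaussianReal_iff.1 hi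
  have hnn (z : ℝ) : 0 ≤ gaussianPDFReal 0 1 z * f z :=
    mul_nonneg (gaussianPDFReal_nonneg _ _ _) (hf z)
  calc m * (q - p) * gaussianPDFReal 0 1 Y
      = ∫ z in Icc p q, gaussianPDFReal 0 1 Y * m := by
        simp [hpq]; ring
    _ ≤ ∫ z in Icc p q, gaussianPDFReal 0 1 z * f z := by
        refine setIntegral_mono_on (integrable_const _) hi'.integrableOn measurableSet_Icc
          fun z hz => ?_
        exact mul_le_mul (gaussianPDFReal_le_of_abs_le (hY z hz)) (hmf z hz) hm
          (gaussianPDFReal_nonneg _ _ _)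
    _ ≤ ∫ z, gaussianPDFReal 0 1 z * f z :=
        setIntegral_le_integral hi' (.of_forall hnn)

lemma logistic_gap {Y y s : ℝ} (h : |y| + |s| ≤ Y) :
    Real.exp (-Y) / 4 * s ^ 2 ≤ logistic (y + s) + logistic (y - s) - 2 * logistic y := by
  have hc := convexOn_logistic_sub_sq (c := Real.exp (-Y) / 4) (convex_Icc (-Y) Y) fun t ht =>
    exp_neg_le_logit_mul (abs_le.2 ht)
  have h1 : |y + s| ≤ Y := (abs_add_le _ _).trans h
  have h2 : |y - s| ≤ Y := (abs_sub _ _).trans h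
  have := hc.2 (abs_le.1 h1) (abs_le.1 h2) (show (0 : ℝ) ≤ 1 / 2 by norm_num)
    (show (0 : ℝ) ≤ 1 / 2 by norm_num) (by norm_num)
  simp only [smul_eq_mul] at this
  rw [show 1 / 2 * (y + s) + 1 / 2 * (y - s) = y by ring] at this
  nlinarith

/-- The averaged loss is uniformly strongly convex at bounded scales. -/
lemma exists_gaussAvg_gap {V : ℝ → ℝ} {σ : ℝ} (hσ : 0 ≤ σ)
    (hV : V = logistic ∨ (V = hinge ∧ 0 < σ)) {r₀ r₁ M : ℝ} (hr₀ : 0 < r₀) (hr₁ : r₀ ≤ r₁)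
    (hM : 0 ≤ M) :
    ∃ c > 0, ∀ r ∈ Icc r₀ r₁, ∀ s, |s| ≤ M →
      c * s ^ 2 ≤ gaussAvg V (σ * √r) (r + s) + gaussAvg V (σ * √r) (r - s)
        - 2 * gaussAvg V (σ * √r) r := by
  have hn (x : ℝ) : 0 < gaussianPDFReal 0 1 x := gaussianPDFReal_pos 0 1 x one_ne_zero
  have hs₀ : 0 < √r₀ := Real.sqrt_pos.2 hr₀
  rcases hV with rfl | ⟨rfl, hσ⟩
  · have hV : IsLoss logistic := ⟨logistic_nonneg, convexOn_logistic, logistic_abs_sub_le⟩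
    -- For noise `|z| ≤ 1` all arguments of the loss stay within `Y`, so its curvature is at least
    -- `exp (-Y) / 4`; the factor `2` is the length of the window.
    set Y := r₁ + σ * √r₁ + M with hY
    refine ⟨Real.exp (-Y) / 4 * 2 * gaussianPDFReal 0 1 1, by have := hn 1; positivity,
      fun r hr s hs => ?_⟩
    rw [hV.gaussAvg_gap]
    have := le_integral_gaussianReal (f := fun z => logistic (r + σ * √r * z + s) +
      logistic (r + σ * √r * z - s) - 2 * logistic (r + σ * √r * z))
      (m := Real.exp (-Y) / 4 * s ^ 2) (p := -1) (q := 1) (Y := 1)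
      (fun z => by have := hV.two_mul_le (r + σ * √r * z) s; linarith)
      (hV.integrable_gap _ _ _) (by positivity) (by norm_num) (fun z hz => abs_le.2 hz)
      (fun z hz => logistic_gap ?_)
    · refine le_trans (le_of_eq ?_) this
      ring
    · have h1 : |r + σ * √r * z| ≤ r₁ + σ * √r₁ := by
        refine (abs_add_le _ _).trans (add_le_add ?_ ?_)
        · rw [abs_of_pos (hr₀.trans_le hr.1)]; exact hr.2
        · rw [abs_mul, abs_of_nonneg (by positivity : 0 ≤ σ * √r)]
          have := Real.sqrt_le_sqrt hr.2
          calc σ * √r * |z| ≤ σ * √r * 1 := by gcongr; exact abs_le.2 hz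
            _ ≤ σ * √r₁ := by rw [mul_one]; gcongr
      linarith
  · have hV : IsLoss hinge := ⟨hinge_nonneg, convexOn_hinge, hinge_abs_sub_le⟩
    set Y := (1 + r₁) / (σ * √r₀) + M / (2 * (σ * √r₀)) with hY
    have hs₁ : 0 < √r₁ := Real.sqrt_pos.2 (hr₀.trans_le hr₁)
    refine ⟨1 / 2 * (1 / (σ * √r₁)) * gaussianPDFReal 0 1 Y, by have := hn Y; positivity,
      fun r hr s hs => ?_⟩
    have hr0 : 0 < r := hr₀.trans_le hr.1
    have hsr : 0 < √r := Real.sqrt_pos.2 hr0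
    have hsr0 : √r₀ ≤ √r := Real.sqrt_le_sqrt hr.1
    have hsr1 : √r ≤ √r₁ := Real.sqrt_le_sqrt hr.2
    rw [hV.gaussAvg_gap]
    set b := σ * √r with hb
    have hbpos : 0 < b := by positivity
    set x := (1 - r) / b with hx
    set d := |s| / (2 * b) with hd
    have hd0 : 0 ≤ d := by positivity
    have hxY : |x| + d ≤ Y := by
      refine add_le_add ?_ ?_
      · rw [hx, abs_div, abs_of_pos hbpos]
        refine div_le_div₀ (by linarith [hr.2]) ?_ (by positivity) (by rw [hb]; gcongr)
        rw [abs_le]; constructor <;> linarith [hr.2]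
      · refine div_le_div₀ hM hs (by positivity) (by rw [hb]; gcongr)
    -- For `|z - x| ≤ d` the argument is within `|s| / 2` of the kink and the gap is at least `|s| /
    -- 2`. The window has length `|s| / b`, so the noise produces a gap of order `s²`. The bound `Y`
    -- holds on every such window.
    have := le_integral_gaussianReal (f := fun z => hinge (r + b * z + s) +
      hinge (r + b * z - s) - 2 * hinge (r + b * z))
      (m := |s| / 2) (p := x - d) (q := x + d) (Y := Y)
      (fun z => by have := hV.two_mul_le (r + b * z) s; linarith)
      (hV.integrable_gap _ _ _) (by positivity) (by linarith) (fun z hz => ?_)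
      (fun z hz => ?_)
    · refine le_trans ?_ this
      rw [mul_right_comm]
      refine mul_le_mul_of_nonneg_right ?_ (hn Y).le
      have e : |s| / 2 * (x + d - (x - d)) = 1 / 2 * (1 / b) * s ^ 2 := by
        rw [← sq_abs, hd]; field_simp; ring
      rw [e]
      gcongr
      exact mul_le_mul_of_nonneg_left hsr1 hσ.le
    · have := abs_le.1 (le_refl |x|)
      rw [abs_le]; constructor <;> linarith [hz.1, hz.2]
    · rw [hinge_add_hinge_sub]
      refine le_max_of_le_left ?_
      have e : 1 - (r + b * z) = b * (x - z) := by rw [hx]; field_simp; ring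
      rw [e, abs_mul, abs_of_pos hbpos]
      have h1 : |x - z| ≤ d := by rw [abs_le]; constructor <;> linarith [hz.1, hz.2]
      have h2 : b * |x - z| ≤ b * d := by gcongr
      have h3 : b * d = |s| / 2 := by rw [hd]; field_simp
      linarith

/-- A convexity gap of `F` at scales up to `M` passes to its Gaussian averages. -/
lemma exists_mul_sq_le_gaussAvg_sub :
    ∃ κ > 0, ∀ (F : ℝ → ℝ), IsLoss F → ∀ c M y a : ℝ, 0 < c → |a| ≤ M →
      (∀ s, |s| ≤ M → c * s ^ 2 ≤ F (y + s) + F (y - s) - 2 * F y) →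
      κ * c * a ^ 2 ≤ gaussAvg F a y - F y := by
  have hn (x : ℝ) : 0 < gaussianPDFReal 0 1 x := gaussianPDFReal_pos 0 1 x one_ne_zero
  -- The window is `[1 / 2, 1]`: a factor `1 / 2` from the symmetrization, `1 / 4` from `z²`, and `1
  -- / 2` from its length.
  refine ⟨1 / 16 * gaussianPDFReal 0 1 1, by have := hn 1; positivity,
    fun F hF c M y a hc ha hgap => ?_⟩
  rw [hF.gaussAvg_sub_eq]
  have h1 := hF.integrable_smooth y a
  have h2 : Integrable (fun s => F (y - a * s)) (gaussianReal 0 1) := by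
    simpa [sub_eq_add_neg] using hF.integrable_smooth y (-a)
  have := le_integral_gaussianReal (f := fun s => F (y + a * s) + F (y - a * s) - 2 * F y)
      (m := c * a ^ 2 / 4) (p := 1 / 2) (q := 1) (Y := 1)
      (fun z => by have := hF.two_mul_le y (a * z); linarith)
      ((h1.add h2).sub (integrable_const _)) (by positivity) (by norm_num) (fun z hz => ?_)
      (fun z hz => ?_)
  · refine le_trans (le_of_eq ?_) (mul_le_mul_of_nonneg_left this (by norm_num : (0 : ℝ) ≤ 1 / 2))
    ring
  · rw [abs_le]; constructor <;> linarith [hz.1, hz.2]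
  · refine le_trans ?_ (hgap (a * z) ?_)
    · have : 1 / 4 ≤ z ^ 2 := by nlinarith [hz.1]
      have h3 : 0 ≤ c * a ^ 2 := by positivity
      nlinarith
    · rw [abs_mul]
      have : |z| ≤ 1 := by rw [abs_le]; constructor <;> linarith [hz.1, hz.2]
      calc |a| * |z| ≤ |a| * 1 := by gcongr
        _ ≤ M := by linarith

/-- The noiseless hinge loss has a linear convexity gap around its kink. -/
lemma exists_abs_le_gaussAvg_hinge_sub :
    ∃ κ > 0, ∀ y a : ℝ, κ * |a| ≤ gaussAvg hinge a y - hinge y + |1 - y| := by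
  have hV : IsLoss hinge := ⟨hinge_nonneg, convexOn_hinge, hinge_abs_sub_le⟩
  have hn (x : ℝ) : 0 < gaussianPDFReal 0 1 x := gaussianPDFReal_pos 0 1 x one_ne_zero
  refine ⟨1 / 8 * gaussianPDFReal 0 1 1, by have := hn 1; positivity, fun y a => ?_⟩
  rw [hV.gaussAvg_sub_eq]
  simp only [hinge_add_hinge_sub]
  have hi : Integrable (fun s : ℝ => |a * s|) (gaussianReal 0 1) :=
    (integrable_id_gaussianReal.const_mul a).abs
  have h1 := le_integral_gaussianReal (f := fun s => |a * s|)
      (m := |a| / 2) (p := 1 / 2) (q := 1) (Y := 1) (fun z => abs_nonneg _) hi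
      (by positivity) (by norm_num)
      (fun z hz => by rw [abs_le]; constructor <;> linarith [hz.1, hz.2])
      (fun z hz => by
        rw [abs_mul, abs_of_nonneg (by linarith [hz.1] : 0 ≤ z)]
        nlinarith [hz.1, abs_nonneg a])
  have h2 : (∫ s, |a * s| ∂gaussianReal 0 1) - |1 - y| ≤
      ∫ s, max (|a * s| - |1 - y|) 0 ∂gaussianReal 0 1 := by
    have : (∫ s, |a * s| ∂gaussianReal 0 1) - |1 - y| =
        ∫ s, (|a * s| - |1 - y|) ∂gaussianReal 0 1 := by
      rw [integral_sub hi (integrable_const _)]; simp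
    rw [this]
    exact integral_mono (hi.sub (integrable_const _)) (hi.sub (integrable_const _)).pos_part
      fun s => le_max_left _ _
  have h3 := abs_nonneg (1 - y)
  have h4 := mul_nonneg (abs_nonneg a) (hn 1).le
  nlinarith

/-! ### Averages over messages -/

lemma bit_neg {K : ℕ} (m : Fin K → ℤˣ) (k : Fin K) : bit (-m) k = -bit m k := by
  simp [bit]

lemma bit_mul_self {K : ℕ} (m : Fin K → ℤˣ) (k : Fin K) : bit m k * bit m k = 1 := by
  rcases Int.units_eq_one_or (m k) with h | h <;> simp [bit, h]

lemma abs_bit {K : ℕ} (m : Fin K → ℤˣ) (k : Fin K) : |bit m k| = 1 := by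
  rcases Int.units_eq_one_or (m k) with h | h <;> simp [bit, h]

/-- Pair each `m` with `φ m`: the two arguments are `A ± S`, and midpoint convexity applies to each
pair. -/
lemma le_expect_of_involutive {α : Type*} [Fintype α] {φ : α → α} (hφ : φ.Involutive)
    {H : ℝ → ℝ} (hH : ∀ x s, 2 * H x ≤ H (x + s) + H (x - s)) {A S : α → ℝ}
    (hA : ∀ m, A (φ m) = A m) (hS : ∀ m, S (φ m) = -S m) :
    𝔼 m, H (A m) ≤ 𝔼 m, H (A m + S m) := by
  have h1 : 𝔼 m, H (A m + S m) = 𝔼 m, H (A m - S m) := by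
    refine Fintype.expect_equiv (Function.Involutive.toPerm φ hφ) _ _ fun m => ?_
    simp [hA, hS]
  have h2 : 𝔼 m, 2 * H (A m) ≤ 𝔼 m, (H (A m + S m) + H (A m - S m)) :=
    Finset.expect_le_expect fun m _ => hH _ _
  rw [Finset.expect_add_distrib, ← h1, ← Finset.mul_expect] at h2
  linarith

/-- The message with the bits outside `s` flipped. -/
def flipOutside {K : ℕ} (s : Finset (Fin K)) (m : Fin K → ℤˣ) : Fin K → ℤˣ :=
  fun l => if l ∈ s then m l else -m l

lemma flipOutside_involutive {K : ℕ} (s : Finset (Fin K)) : (flipOutside s).Involutive := by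
  intro m; ext l; by_cases h : l ∈ s <;> simp [flipOutside, h]

lemma bit_flipOutside_of_mem {K : ℕ} {s : Finset (Fin K)} (m : Fin K → ℤˣ) {l : Fin K}
    (h : l ∈ s) : bit (flipOutside s m) l = bit m l := by simp [bit, flipOutside, h]

lemma bit_flipOutside_of_notMem {K : ℕ} {s : Finset (Fin K)} (m : Fin K → ℤˣ) {l : Fin K}
    (h : l ∉ s) : bit (flipOutside s m) l = -bit m l := by simp [bit, flipOutside, h]

/-- Flipping the bits outside `s` fixes the terms in `s` and reverses all others, so Jensen's
inequality erases the latter. -/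
lemma expect_partial_le {K : ℕ} {H : ℝ → ℝ} (hH : ∀ x s, 2 * H x ≤ H (x + s) + H (x - s))
    (c : Fin K → ℝ) {k : Fin K} {s : Finset (Fin K)} (hk : k ∈ s) :
    𝔼 m : Fin K → ℤˣ, H (∑ j ∈ s, bit m k * bit m j * c j) ≤
      𝔼 m : Fin K → ℤˣ, H (∑ j, bit m k * bit m j * c j) := by
  have := le_expect_of_involutive (flipOutside_involutive s) hH
    (A := fun m => ∑ j ∈ s, bit m k * bit m j * c j)
    (S := fun m => ∑ j ∈ sᶜ, bit m k * bit m j * c j) (fun m => ?_) (fun m => ?_)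
  · simpa only [Finset.sum_add_sum_compl] using this
  · refine Finset.sum_congr rfl fun j hj => ?_
    rw [bit_flipOutside_of_mem m hk, bit_flipOutside_of_mem m hj]
  · rw [← Finset.sum_neg_distrib]
    refine Finset.sum_congr rfl fun j hj => ?_
    rw [bit_flipOutside_of_mem m hk, bit_flipOutside_of_notMem m (Finset.mem_compl.1 hj)]
    ring

lemma le_expect_message {K : ℕ} {H : ℝ → ℝ} (hH : ∀ x s, 2 * H x ≤ H (x + s) + H (x - s))
    (c : Fin K → ℝ) (k : Fin K) :
    H (c k) ≤ 𝔼 m : Fin K → ℤˣ, H (∑ j, bit m k * bit m j * c j) := by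
  have := expect_partial_le hH c (Finset.mem_singleton_self k)
  simpa [bit_mul_self, Fintype.expect_const] using this

/-- Only the terms `k` and `j` are kept; the remaining product `m k * m j` is a fair sign. -/
lemma add_le_two_mul_expect_message {K : ℕ} {H : ℝ → ℝ}
    (hH : ∀ x s, 2 * H x ≤ H (x + s) + H (x - s)) (c : Fin K → ℝ) {k j : Fin K} (hkj : k ≠ j) :
    H (c k + c j) + H (c k - c j) ≤
      2 * 𝔼 m : Fin K → ℤˣ, H (∑ l, bit m k * bit m l * c l) := by
  have h := expect_partial_le hH c (Finset.mem_insert_self k {j})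
  have e (m : Fin K → ℤˣ) : ∑ l ∈ {k, j}, bit m k * bit m l * c l =
      c k + bit m k * bit m j * c j := by
    rw [Finset.sum_pair hkj, bit_mul_self, one_mul]
  simp only [e] at h
  have h1 : 𝔼 m : Fin K → ℤˣ, H (c k + bit m k * bit m j * c j) =
      𝔼 m : Fin K → ℤˣ, H (c k - bit m k * bit m j * c j) := by
    refine Fintype.expect_equiv (Function.Involutive.toPerm _ (flipOutside_involutive {k})) _ _
      fun m => ?_
    simp only [Function.Involutive.coe_toPerm]
    rw [bit_flipOutside_of_mem m (Finset.mem_singleton_self k),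
      bit_flipOutside_of_notMem m (by simpa using hkj.symm)]
    congr 1; ring
  have h2 : H (c k + c j) + H (c k - c j) = 𝔼 m : Fin K → ℤˣ,
      (H (c k + bit m k * bit m j * c j) + H (c k - bit m k * bit m j * c j)) := by
    rw [← Fintype.expect_const (ι := Fin K → ℤˣ) (H (c k + c j) + H (c k - c j))]
    refine Finset.expect_congr rfl fun m _ => ?_
    rcases Int.units_eq_one_or (m k) with h | h <;> rcases Int.units_eq_one_or (m j) with h' | h' <;>
      simp [bit, h, h', add_comm, sub_eq_add_neg]
  rw [h2, Finset.expect_add_distrib, ← h1]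
  linarith

/-! ### One-dimensional projections of the image law -/

-- The projection is presented as a multiple of a standard normal variable, so that the degenerate
-- directions, of deviation zero, need no separate treatment.
open Matrix in
lemma map_inner_multivariateGaussian {n : ℕ} {S : Matrix (Fin n) (Fin n) ℝ} (hS : S.PosSemidef)
    (v : EuclideanSpace ℝ (Fin n)) :
    (multivariateGaussian 0 S).map (fun z => ⟪v, z⟫) =
      (gaussianReal 0 1).map (fun t => √(v ⬝ᵥ S *ᵥ v) * t) := by
  have h := IsGaussian.map_eq_gaussianReal (μ := multivariateGaussian 0 S) (innerSL ℝ v)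
  rw [ContinuousLinearMap.integral_comp_comm _ IsGaussian.integrable_fun_id] at h
  have hvar : Var[innerSL ℝ v; multivariateGaussian 0 S] = v ⬝ᵥ S *ᵥ v := by
    rw [← covariance_self (by fun_prop), ← covarianceBilin_multivariateGaussian (μ := 0) hS,
      covarianceBilin_apply_eq_cov IsGaussian.memLp_two_id]
    rfl
  have hv : 0 ≤ v ⬝ᵥ S *ᵥ v := by rw [← hvar]; exact variance_nonneg _ _
  rw [hvar] at h
  rw [gaussianReal_map_const_mul]
  simp only [integral_id_multivariateGaussian, map_zero] at h
  have h' : (multivariateGaussian 0 S).map (fun z => ⟪v, z⟫) =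
      gaussianReal 0 (v ⬝ᵥ S *ᵥ v).toNNReal := h
  rw [h', mul_zero, mul_one]
  congr 1
  ext
  simp [hv, Real.sq_sqrt]

section
variable {D d : ℕ} (B : Matrix (Fin D) (Fin d) ℝ) (SZ : Matrix (Fin d) (Fin d) ℝ) (σ : ℝ)

open Matrix in
/-- The standard deviation of the projection on `u` of the signal part of an image. -/
noncomputable def signalStd (u : EuclideanSpace ℝ (Fin D)) : ℝ :=
  √(LinearMap.adjoint (Matrix.toEuclideanLin B) u ⬝ᵥ
    SZ *ᵥ LinearMap.adjoint (Matrix.toEuclideanLin B) u)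

lemma posSemidef_noise : (σ ^ 2 • (1 : Matrix (Fin D) (Fin D) ℝ)).PosSemidef :=
  Matrix.PosSemidef.one.smul (sq_nonneg σ)

open Matrix in
lemma sqrt_noise (hσ : 0 ≤ σ) (u : EuclideanSpace ℝ (Fin D)) :
    √(u ⬝ᵥ (σ ^ 2 • (1 : Matrix (Fin D) (Fin D) ℝ)) *ᵥ u) = σ * ‖u‖ := by
  rw [smul_mulVec, one_mulVec, dotProduct_smul]
  have : (u : Fin D → ℝ) ⬝ᵥ u = ‖u‖ ^ 2 := by
    rw [EuclideanSpace.real_norm_sq_eq]; simp [dotProduct, sq]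
  rw [this, smul_eq_mul, ← mul_pow, Real.sqrt_sq (by positivity)]

instance : IsProbabilityMeasure (imageLaw B SZ σ) :=
  Measure.isProbabilityMeasure_map (by fun_prop)

lemma integral_comp_inner_imageLaw {F : ℝ → ℝ} (hF : Continuous F)
    (u : EuclideanSpace ℝ (Fin D)) :
    ∫ x, F ⟪u, x⟫ ∂imageLaw B SZ σ =
      ∫ p, F (⟪LinearMap.adjoint (Matrix.toEuclideanLin B) u, p.1⟫ + ⟪u, p.2⟫)
        ∂((multivariateGaussian (0 : EuclideanSpace ℝ (Fin d)) SZ).prod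
          (multivariateGaussian (0 : EuclideanSpace ℝ (Fin D))
            (σ ^ 2 • (1 : Matrix (Fin D) (Fin D) ℝ)))) := by
  rw [imageLaw, integral_map (by fun_prop)
    (Continuous.aestronglyMeasurable (by fun_prop))]
  simp only [inner_add_right, LinearMap.adjoint_inner_left]

variable {SZ σ}

/-- The noise is integrated first, for fixed signal. The two averages are kept apart because the
noise is present at the optimum, whereas the average over the signal is pure excess. -/
lemma integral_loss_imageLaw {V : ℝ → ℝ} (hV : IsLoss V) (hSZ : SZ.PosSemidef) (hσ : 0 ≤ σ)
    (c : ℝ) (u : EuclideanSpace ℝ (Fin D)) :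
    ∫ x, V (c + ⟪u, x⟫) ∂imageLaw B SZ σ =
      gaussAvg (gaussAvg V (σ * ‖u‖)) (signalStd B SZ u) c := by
  have hVc := hV.continuous
  rw [integral_comp_inner_imageLaw B SZ σ (F := fun t => V (c + t)) (by fun_prop), integral_prod]
  · set v := LinearMap.adjoint (Matrix.toEuclideanLin B) u with hv
    have inner_eq (y : ℝ) : ∫ e, V (y + ⟪u, e⟫) ∂(multivariateGaussian
        (0 : EuclideanSpace ℝ (Fin D)) (σ ^ 2 • (1 : Matrix (Fin D) (Fin D) ℝ))) =
        gaussAvg V (σ * ‖u‖) y := by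
      rw [← integral_map (φ := fun e => ⟪u, e⟫) (f := fun t => V (y + t)) (by fun_prop)
        (by fun_prop), map_inner_multivariateGaussian (posSemidef_noise σ),
        integral_map (by fun_prop) (by fun_prop), sqrt_noise σ hσ, gaussAvg]
    simp only [← add_assoc, inner_eq]
    have hGc := (hV.gaussAvg (σ * ‖u‖)).continuous
    rw [← integral_map (φ := fun z => ⟪v, z⟫) (f := fun t => gaussAvg V (σ * ‖u‖) (c + t))
      (by fun_prop) (by fun_prop), map_inner_multivariateGaussian hSZ,
      integral_map (by fun_prop) (by fun_prop)]
    rfl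
  · refine hV.integrable_comp ((integrable_const c).add (Integrable.add ?_ ?_))
    · exact ((innerSL ℝ (LinearMap.adjoint (Matrix.toEuclideanLin B) u)).integrable_comp
        IsGaussian.integrable_id).comp_fst _
    · exact ((innerSL ℝ u).integrable_comp IsGaussian.integrable_id).comp_snd _

lemma integrable_inner_imageLaw (u : EuclideanSpace ℝ (Fin D)) :
    Integrable (fun x => ⟪u, x⟫) (imageLaw B SZ σ) := by
  rw [imageLaw, integrable_map_measure (by fun_prop) (by fun_prop)]
  have : (fun x => ⟪u, x⟫) ∘ (fun p : EuclideanSpace ℝ (Fin d) × EuclideanSpace ℝ (Fin D) =>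
      Matrix.toEuclideanLin B p.1 + p.2) = fun p =>
      ⟪LinearMap.adjoint (Matrix.toEuclideanLin B) u, p.1⟫ + ⟪u, p.2⟫ := by
    ext p; simp only [Function.comp, inner_add_right, LinearMap.adjoint_inner_left]
  rw [this]
  refine Integrable.add ?_ ?_
  · exact ((innerSL ℝ (LinearMap.adjoint (Matrix.toEuclideanLin B) u)).integrable_comp
      IsGaussian.integrable_id).comp_fst _
  · exact ((innerSL ℝ u).integrable_comp IsGaussian.integrable_id).comp_snd _

lemma signalStd_nonneg (u : EuclideanSpace ℝ (Fin D)) : 0 ≤ signalStd B SZ u := Real.sqrt_nonneg _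

lemma adjoint_eq_zero_of_mem {u : EuclideanSpace ℝ (Fin D)} (hu : u ∈ (imageSubspace B)ᗮ) :
    LinearMap.adjoint (Matrix.toEuclideanLin B) u = 0 := by
  refine ext_inner_right ℝ fun z => ?_
  rw [LinearMap.adjoint_inner_left, inner_zero_left, real_inner_comm]
  exact (Submodule.mem_orthogonal _ _).1 hu _ (LinearMap.mem_range_self _ z)

lemma signalStd_eq_zero {u : EuclideanSpace ℝ (Fin D)} (hu : u ∈ (imageSubspace B)ᗮ) :
    signalStd B SZ u = 0 := by
  simp [signalStd, adjoint_eq_zero_of_mem B hu]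

lemma signalStd_smul_bit {K : ℕ} (m : Fin K → ℤˣ) (k : Fin K) (u : EuclideanSpace ℝ (Fin D)) :
    signalStd B SZ (bit m k • u) = signalStd B SZ u := by
  rcases Int.units_eq_one_or (m k) with h | h <;>
    simp [bit, h, signalStd, Matrix.mulVec_neg]

-- The map is the square root of `SZ` composed with the adjoint of `B`; by positive definiteness its
-- kernel is that of the adjoint.
open scoped MatrixOrder in
lemma exists_linearMap_norm_eq_signalStd (hSZ : SZ.PosDef) :
    ∃ T : EuclideanSpace ℝ (Fin D) →ₗ[ℝ] EuclideanSpace ℝ (Fin d),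
      (∀ u, signalStd B SZ u = ‖T u‖) ∧
      ∀ u, T u = 0 ↔ LinearMap.adjoint (Matrix.toEuclideanLin B) u = 0 := by
  set A := Matrix.toEuclideanCLM (𝕜 := ℝ) (CFC.sqrt SZ) with hA
  have key (v : EuclideanSpace ℝ (Fin d)) : ‖A v‖ ^ 2 = v ⬝ᵥ SZ.mulVec v := by
    rw [← real_inner_self_eq_norm_sq]
    have hsa : IsSelfAdjoint A := (CFC.sqrt_nonneg SZ).isSelfAdjoint.map _
    rw [← ContinuousLinearMap.adjoint_inner_right, hsa.adjoint_eq,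
      ← ContinuousLinearMap.comp_apply, ← ContinuousLinearMap.mul_def, hA, ← map_mul,
      CFC.sqrt_mul_sqrt_self _ hSZ.posSemidef.nonneg, Matrix.inner_toEuclideanCLM]
  refine ⟨(A : _ →ₗ[ℝ] _) ∘ₗ LinearMap.adjoint (Matrix.toEuclideanLin B), fun u => ?_, fun u => ?_⟩
  · simp only [LinearMap.comp_apply, signalStd, ContinuousLinearMap.coe_coe]
    rw [← key, Real.sqrt_sq (norm_nonneg _)]
  · simp only [LinearMap.comp_apply, ContinuousLinearMap.coe_coe]
    refine ⟨fun h => ?_, fun h => by simp [h]⟩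
    by_contra hne
    have h1 := key (LinearMap.adjoint (Matrix.toEuclideanLin B) u)
    rw [h, norm_zero] at h1
    have h2 := hSZ.dotProduct_mulVec_pos (x := (LinearMap.adjoint (Matrix.toEuclideanLin B) u).ofLp)
      (by simpa using hne)
    simp at h1 h2
    linarith

/-- A vector of the image subspace killed by the adjoint of `B` is orthogonal to itself. So the
linear map of the previous lemma is injective there, hence bounded below in finite dimension; and it
sees only the projection of `u`, as it vanishes on the orthogonal complement. -/
lemma exists_signalStd_bounds (hSZ : SZ.PosDef) :
    ∃ C > 0, ∀ u, signalStd B SZ u ≤ C * ‖u‖ ∧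
      ‖(imageSubspace B).starProjection u‖ ≤ C * signalStd B SZ u := by
  obtain ⟨T, hT, hT0⟩ := exists_linearMap_norm_eq_signalStd B hSZ
  have hker : (T ∘ₗ (imageSubspace B).subtype).ker = ⊥ := by
    rw [LinearMap.ker_eq_bot']
    intro u hu
    have h1 : LinearMap.adjoint (Matrix.toEuclideanLin B) u = 0 := (hT0 u).1 hu
    obtain ⟨z, hz⟩ := u.2
    have h2 : ⟪(u : EuclideanSpace ℝ (Fin D)), (u : EuclideanSpace ℝ (Fin D))⟫ = 0 := by
      conv_lhs => rw [← hz]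
      rw [← LinearMap.adjoint_inner_right, hz, h1, inner_zero_right]
    exact Subtype.ext (inner_self_eq_zero.1 h2)
  obtain ⟨K, hK, hanti⟩ := LinearMap.exists_antilipschitzWith _ hker
  have hK' : (0 : ℝ) < K := hK
  set Tc := LinearMap.toContinuousLinearMap T with hTc
  refine ⟨max K (‖Tc‖ + 1), lt_max_of_lt_left hK', fun u => ⟨?_, ?_⟩⟩
  · rw [hT]
    have h1 : ‖T u‖ ≤ ‖Tc‖ * ‖u‖ := Tc.le_opNorm u
    have h2 : (‖Tc‖ + 1) * ‖u‖ ≤ max (K : ℝ) (‖Tc‖ + 1) * ‖u‖ := by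
      gcongr; exact le_max_right _ _
    nlinarith [norm_nonneg u]
  · have h0 : T u = T ((imageSubspace B).starProjection u) := by
      rw [← sub_eq_zero, ← map_sub, hT0]
      exact adjoint_eq_zero_of_mem B (Submodule.sub_starProjection_mem_orthogonal u)
    have h1 := hanti.le_mul_dist ((imageSubspace B).orthogonalProjectionOnto u) 0
    simp only [dist_zero_right, map_zero] at h1
    rw [hT, h0]
    refine le_trans h1 ?_
    exact mul_le_mul_of_nonneg_right (le_max_left _ _) (norm_nonneg _)

end

/-! ### The population loss -/

lemma decodingLoss_eq {D K : ℕ} (V : ℝ → ℝ) (w : Fin K → EuclideanSpace ℝ (Fin D))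
    (x : EuclideanSpace ℝ (Fin D)) :
    decodingLoss V w x = 𝔼 m : Fin K → ℤˣ, ∑ k,
      V (∑ j, bit m k * bit m j * ⟪w k, w j⟫ + ⟪bit m k • w k, x⟫) := by
  unfold decodingLoss embed
  refine Finset.expect_congr rfl fun m _ => Finset.sum_congr rfl fun k _ => ?_
  congr 1
  rw [inner_add_right, inner_sum, real_inner_smul_left, mul_add, Finset.mul_sum, add_comm]
  congr 1
  refine Finset.sum_congr rfl fun j _ => ?_
  rw [real_inner_smul_right]; ring

/-- The contribution of the `k`-th watermark to the population loss. -/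
noncomputable def popTerm {D d K : ℕ} (V : ℝ → ℝ) (β : ℝ) (B : Matrix (Fin D) (Fin d) ℝ)
    (SZ : Matrix (Fin d) (Fin d) ℝ) (σ : ℝ) (w : Fin K → EuclideanSpace ℝ (Fin D)) (k : Fin K) :
    ℝ :=
  (𝔼 m : Fin K → ℤˣ, gaussAvg (gaussAvg V (σ * ‖w k‖)) (signalStd B SZ (w k))
    (∑ j, bit m k * bit m j * ⟪w k, w j⟫)) + β * ‖w k‖ ^ 2

section
variable {D d K : ℕ} {V : ℝ → ℝ} (β : ℝ) (B : Matrix (Fin D) (Fin d) ℝ)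
  {SZ : Matrix (Fin d) (Fin d) ℝ} {σ : ℝ} (w : Fin K → EuclideanSpace ℝ (Fin D))

lemma IsLoss.integrable_imageLaw (hV : IsLoss V) (c : ℝ) (u : EuclideanSpace ℝ (Fin D)) :
    Integrable (fun x => V (c + ⟪u, x⟫)) (imageLaw B SZ σ) :=
  hV.integrable_comp ((integrable_const c).add (integrable_inner_imageLaw B u))

lemma IsLoss.popLoss_eq_sum (hV : IsLoss V) (hSZ : SZ.PosSemidef) (hσ : 0 ≤ σ) :
    popLoss V β B SZ σ w = ∑ k, popTerm V β B SZ σ w k := by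
  unfold popLoss popTerm
  rw [Finset.sum_add_distrib, ← Finset.mul_sum]
  congr 1
  simp only [decodingLoss_eq, Fintype.expect_eq_sum_div_card]
  rw [integral_div, integral_finsetSum _ fun m _ => integrable_finsetSum _ fun k _ =>
    hV.integrable_imageLaw B _ _, ← Finset.sum_div, Finset.sum_comm]
  congr 1
  refine Finset.sum_congr rfl fun m _ => ?_
  rw [integral_finsetSum _ fun k _ => hV.integrable_imageLaw B _ _]
  refine Finset.sum_congr rfl fun k _ => ?_
  rw [integral_loss_imageLaw B hV hSZ hσ, signalStd_smul_bit, norm_smul, Real.norm_eq_abs, abs_bit,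
    one_mul]

lemma real_inner_self_norm_sq (k : Fin K) : ⟪w k, w k⟫ = ‖w k‖ ^ 2 := real_inner_self_eq_norm_sq _

lemma IsLoss.gaussAvg_gaussAvg_le_popTerm (hV : IsLoss V) (k : Fin K) :
    Watermark.gaussAvg (Watermark.gaussAvg V (σ * ‖w k‖)) (signalStd B SZ (w k)) (‖w k‖ ^ 2) + β * ‖w k‖ ^ 2 ≤
      popTerm V β B SZ σ w k := by
  refine add_le_add ?_ le_rfl
  have := le_expect_message (((hV.gaussAvg (σ * ‖w k‖)).gaussAvg (signalStd B SZ (w k))).two_mul_le)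
    (fun j => ⟪w k, w j⟫) k
  rwa [real_inner_self_norm_sq] at this

/-- Jensen's inequality twice: over the bits other than `k`, then over the signal. -/
lemma IsLoss.hpop_le_popTerm (hV : IsLoss V) (k : Fin K) :
    hpop V σ β (‖w k‖ ^ 2) ≤ popTerm V β B SZ σ w k := by
  refine le_trans ?_ (hV.gaussAvg_gaussAvg_le_popTerm β B w k)
  rw [hpop_eq_gaussAvg, Real.sqrt_sq (norm_nonneg _)]
  exact add_le_add ((hV.gaussAvg _).le_gaussAvg _ _) le_rfl

lemma IsLoss.gaussAvg_pair_le_popTerm (hV : IsLoss V) {k j : Fin K} (hkj : k ≠ j) :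
    Watermark.gaussAvg V (σ * ‖w k‖) (‖w k‖ ^ 2 + ⟪w k, w j⟫) +
      Watermark.gaussAvg V (σ * ‖w k‖) (‖w k‖ ^ 2 - ⟪w k, w j⟫) ≤
      2 * (popTerm V β B SZ σ w k - β * ‖w k‖ ^ 2) := by
  unfold popTerm
  rw [add_sub_cancel_right]
  have h := add_le_two_mul_expect_message
    (((hV.gaussAvg (σ * ‖w k‖)).gaussAvg (signalStd B SZ (w k))).two_mul_le)
    (fun j => ⟪w k, w j⟫) hkj
  rw [real_inner_self_norm_sq] at h
  exact (add_le_add ((hV.gaussAvg _).le_gaussAvg _ _) ((hV.gaussAvg _).le_gaussAvg _ _)).trans h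

end

/-! ### Existence of minimizers -/

section
variable {D K n : ℕ} {V : ℝ → ℝ} {β : ℝ}

lemma IsLoss.continuous_decodingLoss (hV : IsLoss V) (x : EuclideanSpace ℝ (Fin D)) :
    Continuous fun w : Fin K → EuclideanSpace ℝ (Fin D) => decodingLoss V w x := by
  have := hV.continuous
  simp only [decodingLoss_eq, Fintype.expect_eq_sum_div_card]
  fun_prop

lemma IsLoss.continuous_empLoss (hV : IsLoss V) (x : Fin n → EuclideanSpace ℝ (Fin D)) :
    Continuous (empLoss (K := K) V β x) := by
  have h (i : Fin n) := hV.continuous_decodingLoss (K := K) (x i)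
  unfold empLoss
  fun_prop

lemma IsLoss.le_decodingLoss (hV : IsLoss V) (w : Fin K → EuclideanSpace ℝ (Fin D))
    (x : EuclideanSpace ℝ (Fin D)) : K * ⨅ t, V t ≤ decodingLoss V w x := by
  rw [decodingLoss, ← Fintype.expect_const (ι := Fin K → ℤˣ) (K * ⨅ t, V t : ℝ)]
  refine Finset.expect_le_expect fun m _ => ?_
  calc (K * ⨅ t, V t : ℝ) = ∑ _k : Fin K, ⨅ t, V t := by simp
    _ ≤ _ := Finset.sum_le_sum fun k _ => hV.iInf_le _

lemma decodingLoss_zero (x : EuclideanSpace ℝ (Fin D)) :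
    decodingLoss V (0 : Fin K → EuclideanSpace ℝ (Fin D)) x = K * V 0 := by
  simp [decodingLoss]

lemma empLoss_zero (hn : 0 < n) (x : Fin n → EuclideanSpace ℝ (Fin D)) :
    empLoss V β x (0 : Fin K → EuclideanSpace ℝ (Fin D)) = K * V 0 := by
  have : (n : ℝ) ≠ 0 := by positivity
  simp [empLoss, decodingLoss_zero]
  field_simp

lemma IsLoss.le_empLoss (hV : IsLoss V) (hn : 0 < n) (x : Fin n → EuclideanSpace ℝ (Fin D))
    (w : Fin K → EuclideanSpace ℝ (Fin D)) :
    K * (⨅ t, V t) + β * ∑ k, ‖w k‖ ^ 2 ≤ empLoss V β x w := by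
  refine add_le_add ?_ le_rfl
  have hn' : (0 : ℝ) < n := by positivity
  have : (n : ℝ) * (K * ⨅ t, V t) ≤ ∑ i, decodingLoss V w (x i) := by
    calc (n : ℝ) * (K * ⨅ t, V t) = ∑ _i : Fin n, (K * ⨅ t, V t : ℝ) := by simp
      _ ≤ _ := Finset.sum_le_sum fun i _ => hV.le_decodingLoss _ _
  rw [one_div, inv_mul_eq_div, le_div_iff₀ hn']
  linarith

/-- Comparison with the zero watermark: the penalty cannot exceed the largest possible saving in
loss, `K (V 0 - inf V)`. -/
lemma IsLoss.mem_ball_of_empLoss_le (hV : IsLoss V) (hβ : 0 < β) (hn : 0 < n)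
    {x : Fin n → EuclideanSpace ℝ (Fin D)} {w : Fin K → EuclideanSpace ℝ (Fin D)}
    (h : empLoss V β x w ≤ empLoss V β x (0 : Fin K → EuclideanSpace ℝ (Fin D))) :
    w ∈ ball V β D K := by
  rw [empLoss_zero hn] at h
  have h1 := hV.le_empLoss (β := β) hn x w
  show ∑ k, ‖w k‖ ^ 2 ≤ K * (V 0 - ⨅ t, V t) / β
  rw [le_div_iff₀ hβ]
  linarith

lemma IsLoss.radiusSq_nonneg (hV : IsLoss V) (hβ : 0 < β) (K : ℕ) : 0 ≤ radiusSq V β K := by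
  have := hV.iInf_le 0
  unfold radiusSq
  have h : 0 ≤ V 0 - ⨅ t, V t := by linarith
  positivity

lemma IsLoss.zero_mem_ball (hV : IsLoss V) (hβ : 0 < β) :
    (0 : Fin K → EuclideanSpace ℝ (Fin D)) ∈ ball V β D K := by
  show ∑ k : Fin K, ‖(0 : EuclideanSpace ℝ (Fin D))‖ ^ 2 ≤ _
  simpa using hV.radiusSq_nonneg hβ K

lemma norm_sq_le_of_mem_ball {w : Fin K → EuclideanSpace ℝ (Fin D)} (hw : w ∈ ball V β D K)
    (k : Fin K) : ‖w k‖ ^ 2 ≤ radiusSq V β K :=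
  le_trans (Finset.single_le_sum (f := fun k => ‖w k‖ ^ 2) (fun _ _ => sq_nonneg _)
    (Finset.mem_univ k)) hw

lemma isCompact_ball : IsCompact (ball V β D K) := by
  refine Metric.isCompact_of_isClosed_isBounded ?_ ?_
  · exact isClosed_le (by fun_prop) continuous_const
  · refine isBounded_iff_forall_norm_le.2 ⟨√(radiusSq V β K), fun w hw => ?_⟩
    refine (pi_norm_le_iff_of_nonneg (Real.sqrt_nonneg _)).2 fun k => ?_
    exact Real.le_sqrt_of_sq_le (norm_sq_le_of_mem_ball hw k)

lemma IsLoss.exists_isMinOn_empLoss (hV : IsLoss V) (hβ : 0 < β) (hn : 0 < n)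
    (x : Fin n → EuclideanSpace ℝ (Fin D)) :
    (∃ w : Fin K → EuclideanSpace ℝ (Fin D), IsMinOn (empLoss V β x) univ w) ∧
      ∀ w : Fin K → EuclideanSpace ℝ (Fin D), IsMinOn (empLoss V β x) univ w →
        w ∈ ball V β D K := by
  refine ⟨?_, fun w hw => hV.mem_ball_of_empLoss_le hβ hn (hw (mem_univ _))⟩
  obtain ⟨w, hw, hmin⟩ := isCompact_ball.exists_isMinOn ⟨0, hV.zero_mem_ball hβ⟩
    (hV.continuous_empLoss (K := K) (β := β) x).continuousOn
  refine ⟨w, fun w' _ => ?_⟩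
  by_cases h : w' ∈ ball V β D K
  · exact hmin h
  · have h0 : empLoss V β x w ≤ empLoss V β x 0 := hmin (hV.zero_mem_ball hβ)
    by_contra h1
    exact h (hV.mem_ball_of_empLoss_le hβ hn ((not_le.1 h1).le.trans h0))

end

/-! ### Geometry of approximate minimizers of the population loss -/

section
variable {D d K : ℕ} {V : ℝ → ℝ} {β σ r₀ : ℝ} {B : Matrix (Fin D) (Fin d) ℝ}
  {SZ : Matrix (Fin d) (Fin d) ℝ}

lemma exists_orthonormal_orthogonal_imageSubspace (hdD : d + K < D)
    (B : Matrix (Fin D) (Fin d) ℝ) :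
    ∃ e : Fin K → EuclideanSpace ℝ (Fin D), Orthonormal ℝ e ∧ ∀ k, e k ∈ (imageSubspace B)ᗮ := by
  have h1 : Module.finrank ℝ (imageSubspace B) ≤ d := by
    refine (LinearMap.finrank_range_le _).trans ?_
    simp
  have h2 := (imageSubspace B).finrank_add_finrank_orthogonal
  rw [finrank_euclideanSpace_fin] at h2
  have h3 : K ≤ Module.finrank ℝ (imageSubspace B)ᗮ := by omega
  set b := stdOrthonormalBasis ℝ (imageSubspace B)ᗮ
  refine ⟨fun k => b (Fin.castLE h3 k), ?_, fun k => (b _).2⟩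
  exact (b.orthonormal.comp_linearIsometry (imageSubspace B)ᗮ.subtypeₗᵢ).comp _
    (Fin.castLE_injective h3)

/-- Orthogonality makes the loss independent of the other bits, and orthogonality to the image
subspace removes the signal, so no Jensen step loses anything. The inequality `h r₀ ≤ h 0` places
this competitor in the ball, where uniform closeness is available. -/
lemma IsLoss.exists_popLoss_eq (hV : IsLoss V) (hβ : 0 < β) (hσ : 0 ≤ σ) (hSZ : SZ.PosSemidef)
    (hdD : d + K < D) (hr₀ : 0 < r₀) (hmin : IsMinOn (hpop V σ β) (Ici 0) r₀) :
    ∃ w ∈ ball V β D K, popLoss V β B SZ σ w = K * hpop V σ β r₀ := by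
  obtain ⟨e, he, hmem⟩ := exists_orthonormal_orthogonal_imageSubspace hdD B
  set w : Fin K → EuclideanSpace ℝ (Fin D) := fun k => √r₀ • e k with hw
  have hnorm (k : Fin K) : ‖w k‖ = √r₀ := by
    simp [hw, norm_smul, he.1 k]
  have hinner (k j : Fin K) : ⟪w k, w j⟫ = if k = j then r₀ else 0 := by
    simp only [hw, real_inner_smul_left, real_inner_smul_right, orthonormal_iff_ite.1 he k j]
    split_ifs
    · rw [mul_one, Real.mul_self_sqrt hr₀.le]
    · simp
  have hsq : √r₀ ^ 2 = r₀ := Real.sq_sqrt hr₀.le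
  refine ⟨w, ?_, ?_⟩
  · show ∑ k, ‖w k‖ ^ 2 ≤ K * (V 0 - ⨅ t, V t) / β
    simp only [hnorm, hsq]
    have h1 : hpop V σ β r₀ ≤ hpop V σ β 0 := hmin (mem_Ici.2 le_rfl)
    rw [hpop_zero] at h1
    have h2 : ⨅ t, V t ≤ ∫ z, V (r₀ + σ * √r₀ * z) ∂gaussianReal 0 1 := by
      have := integral_mono (integrable_const (μ := gaussianReal 0 1) (⨅ t, V t))
        (hV.integrable_smooth r₀ (σ * √r₀)) fun z => hV.iInf_le _
      simpa using this
    unfold hpop at h1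
    have h3 : β * r₀ ≤ V 0 - ⨅ t, V t := by linarith
    rw [Finset.sum_const, Finset.card_univ, Fintype.card_fin, nsmul_eq_mul, le_div_iff₀ hβ]
    have : (0 : ℝ) ≤ K := by positivity
    nlinarith
  · rw [hV.popLoss_eq_sum β B w hSZ hσ]
    have hterm (k : Fin K) : popTerm V β B SZ σ w k = hpop V σ β r₀ := by
      unfold popTerm
      have h0 : signalStd B SZ (w k) = 0 :=
        signalStd_eq_zero B (Submodule.smul_mem _ _ (hmem k))
      rw [h0, hnorm, hsq, hpop_eq_gaussAvg]
      simp [hinner, bit_mul_self]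
    simp [hterm]

lemma IsLoss.popTerm_le (hV : IsLoss V) (hσ : 0 ≤ σ) (hSZ : SZ.PosSemidef)
    (hmin : IsMinOn (hpop V σ β) (Ici 0) r₀) {w : Fin K → EuclideanSpace ℝ (Fin D)} {ε : ℝ}
    (hw : popLoss V β B SZ σ w ≤ K * hpop V σ β r₀ + ε) (k : Fin K) :
    popTerm V β B SZ σ w k ≤ hpop V σ β r₀ + ε := by
  rw [hV.popLoss_eq_sum β B w hSZ hσ, ← Finset.add_sum_erase _ _ (Finset.mem_univ k)] at hw
  have h1 : ((K : ℝ) - 1) * hpop V σ β r₀ ≤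
      ∑ j ∈ Finset.univ.erase k, popTerm V β B SZ σ w j := by
    have hK : 1 ≤ K := k.pos
    calc ((K : ℝ) - 1) * hpop V σ β r₀ = ∑ j ∈ Finset.univ.erase k, hpop V σ β r₀ := by
          rw [Finset.sum_const, Finset.card_erase_of_mem (Finset.mem_univ k), Finset.card_univ,
            Fintype.card_fin, nsmul_eq_mul, Nat.cast_sub hK, Nat.cast_one]
      _ ≤ _ := Finset.sum_le_sum fun j _ =>
          (show hpop V σ β r₀ ≤ hpop V σ β (‖w j‖ ^ 2) from hmin (mem_Ici.2 (sq_nonneg _))).trans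
            (hV.hpop_le_popTerm β B w j)
  linarith

lemma abs_le_sqrt_mul_sqrt {c k x ε : ℝ} (hc : 0 < c) (hk : 0 ≤ k) (h : c * x ^ 2 ≤ k * ε) :
    |x| ≤ √(k / c) * √ε := by
  rw [← Real.sqrt_mul (by positivity)]
  refine Real.abs_le_sqrt ?_
  rw [div_mul_eq_mul_div, le_div_iff₀ hc]
  linarith

/-- The three consequences, for one watermark, of an excess of at most `2 ε`. -/
lemma IsLoss.gap_le (hV : IsLoss V) (hmin : IsMinOn (hpop V σ β) (Ici 0) r₀)
    {w : Fin K → EuclideanSpace ℝ (Fin D)} {ε : ℝ} {k : Fin K}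
    (hk : popTerm V β B SZ σ w k ≤ hpop V σ β r₀ + 2 * ε) :
    hpop V σ β (‖w k‖ ^ 2) - hpop V σ β r₀ ≤ 2 * ε ∧
    Watermark.gaussAvg (Watermark.gaussAvg V (σ * ‖w k‖)) (signalStd B SZ (w k)) (‖w k‖ ^ 2)
      - Watermark.gaussAvg V (σ * ‖w k‖) (‖w k‖ ^ 2) ≤ 2 * ε ∧
    ∀ j, k ≠ j → Watermark.gaussAvg V (σ * ‖w k‖) (‖w k‖ ^ 2 + ⟪w k, w j⟫) +
      Watermark.gaussAvg V (σ * ‖w k‖) (‖w k‖ ^ 2 - ⟪w k, w j⟫)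
      - 2 * Watermark.gaussAvg V (σ * ‖w k‖) (‖w k‖ ^ 2) ≤ 4 * ε := by
  have h0 := hV.hpop_le_popTerm (SZ := SZ) (σ := σ) β B w k
  have h1 := hV.gaussAvg_gaussAvg_le_popTerm (SZ := SZ) (σ := σ) β B w k
  have h2 : hpop V σ β r₀ ≤ hpop V σ β (‖w k‖ ^ 2) := hmin (mem_Ici.2 (sq_nonneg _))
  have h3 : hpop V σ β (‖w k‖ ^ 2) =
      Watermark.gaussAvg V (σ * ‖w k‖) (‖w k‖ ^ 2) + β * ‖w k‖ ^ 2 := by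
    rw [hpop_eq_gaussAvg, Real.sqrt_sq (norm_nonneg _)]
  refine ⟨by linarith, by linarith, fun j hj => ?_⟩
  have h4 := hV.gaussAvg_pair_le_popTerm (SZ := SZ) (σ := σ) β B w hj
  linarith

lemma abs_inner_le_radiusSq {w : Fin K → EuclideanSpace ℝ (Fin D)} (hw : w ∈ ball V β D K)
    (k j : Fin K) : |⟪w k, w j⟫| ≤ radiusSq V β K := by
  have h1 := norm_sq_le_of_mem_ball hw k
  have h2 := norm_sq_le_of_mem_ball hw j
  have h3 := abs_real_inner_le_norm (w k) (w j)
  nlinarith [sq_nonneg (‖w k‖ - ‖w j‖)]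

/-- Bounds on the signal part and the inner products for one watermark. -/
lemma exists_signal_inner_bounds (hV : LossCondition V σ β) (hσ : 0 ≤ σ) (hβ : 0 < β)
    (hSZ : SZ.PosDef) (hr₀ : 0 < r₀) (hmin : IsMinOn (hpop V σ β) (Ici 0) r₀) :
    ∃ C > 0, ∀ w ∈ ball V β D K, ∀ (ε : ℝ) (k : Fin K), 0 ≤ ε → ε ≤ 1 →
      popTerm V β B SZ σ w k ≤ hpop V σ β r₀ + 2 * ε →
      ‖w k‖ ^ 2 ∈ Icc (r₀ / 2) (2 * r₀) →
      signalStd B SZ (w k) ≤ C * √ε ∧ (∀ j, k ≠ j → |⟪w k, w j⟫| ≤ C * √ε) ∧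
        ((V = hinge ∧ σ = 0) → ∀ j, k ≠ j → |⟪w k, w j⟫| ≤ C * ε) := by
  have hL := hV.isLoss
  obtain ⟨A, hA, hAb⟩ := exists_signalStd_bounds B hSZ
  by_cases hcase : V = logistic ∨ (V = hinge ∧ 0 < σ)
  · set R := radiusSq V β K with hR
    have hR0 : 0 ≤ R := hL.radiusSq_nonneg hβ K
    -- One scale for both applications: `R` bounds the inner products and `A * √R` the signal
    -- deviations.
    set M := max R (A * √R) with hM
    have hM0 : 0 ≤ M := le_max_of_le_left hR0
    obtain ⟨c, hc, hgap⟩ := exists_gaussAvg_gap hσ hcase (r₀ := r₀ / 2) (r₁ := 2 * r₀) (M := M)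
      (by positivity) (by linarith) hM0
    obtain ⟨κ, hκ, hav⟩ := exists_mul_sq_le_gaussAvg_sub
    refine ⟨√(2 / (κ * c)) + √(4 / c), by positivity, fun w hw ε k hε hε1 hk hr => ?_⟩
    obtain ⟨-, g1, g2⟩ := hL.gap_le hmin hk
    have hgap' := hgap (‖w k‖ ^ 2) hr
    rw [Real.sqrt_sq (norm_nonneg _)] at hgap'
    have hsig : |signalStd B SZ (w k)| ≤ M := by
      rw [abs_of_nonneg (signalStd_nonneg B _)]
      refine le_max_of_le_right ((hAb (w k)).1.trans ?_)
      gcongr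
      exact Real.le_sqrt_of_sq_le (norm_sq_le_of_mem_ball hw k)
    have h1 := (hav _ (hL.gaussAvg (σ * ‖w k‖)) c M _ _ hc hsig hgap').trans g1
    have h2 := abs_le_sqrt_mul_sqrt (by positivity) (by norm_num) h1
    have hs := Real.sqrt_nonneg ε
    refine ⟨?_, fun j hj => ?_, fun h => ?_⟩
    · rw [abs_of_nonneg (signalStd_nonneg B _)] at h2
      refine h2.trans ?_
      gcongr
      exact le_add_of_nonneg_right (by positivity)
    · have h3 := (hgap' ⟪w k, w j⟫ (le_max_of_le_left (abs_inner_le_radiusSq hw k j))).trans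
        (g2 j hj)
      refine (abs_le_sqrt_mul_sqrt hc (by norm_num) h3).trans ?_
      gcongr
      exact le_add_of_nonneg_left (by positivity)
    -- This clause is vacuous here: the two losses differ at `2`, where only the hinge vanishes, and
    -- `σ = 0` contradicts `0 < σ`.
    · rcases hcase with h' | h'
      · rw [h'] at h
        have := congr_fun h.1 2
        simp only [logistic, hinge] at this
        have h5 : 0 < Real.log (1 + Real.exp (-2)) :=
          Real.log_pos (by linarith [Real.exp_pos (-2)])
        norm_num at this
        rcases this with h6 | h6 <;> linarith [Real.exp_pos (-2)]
      · exact absurd h.2 h'.2.ne'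
  · have hh : V = hinge ∧ σ = 0 ∧ β < 1 := by
      rcases hV with ⟨h, -, h'⟩ | ⟨h, -⟩
      · refine ⟨h, ?_, h'⟩
        by_contra h0
        exact hcase (Or.inr ⟨h, lt_of_le_of_ne hσ (Ne.symm h0)⟩)
      · exact absurd (Or.inl h) hcase
    obtain ⟨rfl, rfl, hβ1⟩ := hh
    obtain ⟨-, hq⟩ := quadraticGrowth_hpop_hinge_zero hβ hβ1
    have hr1 : r₀ = 1 := hq.eq_of_isMinOn zero_le_one hr₀.le hmin
    subst hr1
    set c := min (1 - β) β with hc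
    have hc0 : 0 < c := lt_min (by linarith) hβ
    obtain ⟨κ, hκ, hav⟩ := exists_abs_le_gaussAvg_hinge_sub
    -- All bounds are linear in `ε`: the distance to the kink is at most `2 ε / c`, to which the
    -- signal gap adds `2 ε` and the pair gap `4 ε`. Then `ε ≤ √ε`, as `ε ≤ 1`.
    refine ⟨(2 + 2 / c) / κ + (4 + 2 / c), by positivity, fun w hw ε k hε hε1 hk hr => ?_⟩
    obtain ⟨g0, g1, g2⟩ := hL.gap_le hmin hk
    have hεs : ε ≤ √ε := Real.le_sqrt_of_sq_le (by nlinarith)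
    have hd : |1 - ‖w k‖ ^ 2| ≤ 2 / c * ε := by
      rw [abs_sub_comm, div_mul_eq_mul_div, le_div_iff₀ hc0]
      have := abs_sub_one_le_hpop_hinge (β := β) (r := ‖w k‖ ^ 2)
      linarith
    have e (y : ℝ) : gaussAvg hinge (0 * ‖w k‖) y = hinge y := by simp
    have e' : gaussAvg hinge (0 * ‖w k‖) = hinge := funext e
    rw [e'] at g1 g2
    have hin (j : Fin K) (hj : k ≠ j) :
        |⟪w k, w j⟫| ≤ ((2 + 2 / c) / κ + (4 + 2 / c)) * ε := by
      have h1 := g2 j hj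
      rw [hinge_add_hinge_sub] at h1
      have h2 := (le_max_left _ _).trans h1
      have h3 : 0 ≤ (2 + 2 / c) / κ * ε := by positivity
      linarith
    refine ⟨?_, fun j hj => (hin j hj).trans (by gcongr), fun _ => hin⟩
    have h1 := hav (‖w k‖ ^ 2) (signalStd B SZ (w k))
    rw [abs_of_nonneg (signalStd_nonneg B _)] at h1
    have h2 : signalStd B SZ (w k) ≤ (2 + 2 / c) / κ * ε := by
      rw [div_mul_eq_mul_div, le_div_iff₀ hκ]
      linarith
    have h3 : 0 ≤ (4 + 2 / c) * ε := by positivity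
    calc signalStd B SZ (w k) ≤ ((2 + 2 / c) / κ + (4 + 2 / c)) * ε := by linarith
      _ ≤ _ := by gcongr

/-- Approximate minimizers of the population loss have the asserted geometry. -/
theorem exists_geometricBounds (hV : LossCondition V σ β) (hσ : 0 ≤ σ) (hβ : 0 < β)
    (hSZ : SZ.PosDef) (hr₀ : 0 < r₀) (hmin : IsMinOn (hpop V σ β) (Ici 0) r₀)
    (hgrowth : QuadraticGrowth (hpop V σ β) r₀) :
    ∃ τ > 0, ∃ C > 0, ∀ w ∈ ball V β D K, ∀ ε, 0 ≤ ε → ε ≤ τ →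
      popLoss V β B SZ σ w ≤ K * hpop V σ β r₀ + 2 * ε → GeometricBounds V σ B r₀ C ε w := by
  have hL := hV.isLoss
  obtain ⟨c, hc, η, hη, hg⟩ := hgrowth
  obtain ⟨A, hA, hAb⟩ := exists_signalStd_bounds B hSZ
  obtain ⟨C, hC, hb⟩ := exists_signal_inner_bounds (D := D) (K := K) (B := B) hV hσ hβ hSZ hr₀ hmin
  -- The excess `2 ε` must stay below the threshold `η` of quadratic growth, and `ε ≤ 1` is needed
  -- for the signal and inner product bounds.
  refine ⟨min 1 (η / 2), lt_min one_pos (by positivity), √(2 / c) + A * C + C, by positivity,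
    fun w hw ε hε hετ hpop => ?_⟩
  have hε1 : ε ≤ 1 := hετ.trans (min_le_left _ _)
  have hεη : 2 * ε ≤ η := by linarith [hετ.trans (min_le_right 1 (η / 2))]
  have hk (k : Fin K) := hL.popTerm_le hσ hSZ.posSemidef hmin hpop k
  have hr (k : Fin K) := hg (‖w k‖ ^ 2) (sq_nonneg _) ((hL.gap_le hmin (hk k)).1.trans hεη)
  have hbk (k : Fin K) := hb w hw ε k hε hε1 (hk k) ⟨(hr k).1, (hr k).2.1⟩
  have hs := Real.sqrt_nonneg ε
  have hs2 : 0 ≤ √(2 / c) := Real.sqrt_nonneg _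
  refine ⟨fun k => (hr k).1, fun k => ?_, fun k => ?_, fun _ k j hkj => ?_, fun h k j hkj => ?_⟩
  · have h1 := (hr k).2.2.trans (hL.gap_le hmin (hk k)).1
    refine (abs_le_sqrt_mul_sqrt hc (by norm_num) h1).trans ?_
    gcongr
    have : 0 ≤ A * C := by positivity
    linarith
  · have h1 := (hAb (w k)).2
    have h2 : A * signalStd B SZ (w k) ≤ A * (C * √ε) := by gcongr; exact (hbk k).1
    have h3 : (A * C) * √ε ≤ (√(2 / c) + A * C + C) * √ε := by gcongr; linarith
    linarith
  -- The bound obtained is of order `√ε`; the other two powers are only added.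
  · refine ((hbk k).2.1 j hkj).trans ?_
    rw [Real.sqrt_eq_rpow]
    have h1 : 0 ≤ ε ^ (1 / 4 : ℝ) := Real.rpow_nonneg hε _
    have h2 : 0 ≤ ε ^ (1 / 2 : ℝ) := Real.rpow_nonneg hε _
    have h3 : 0 ≤ A * C := by positivity
    exact mul_le_mul (by linarith) (by linarith) h2 (by linarith)
  · refine ((hbk k).2.2 h j hkj).trans ?_
    have h3 : 0 ≤ A * C := by positivity
    exact mul_le_mul (by linarith) (by linarith) hε (by linarith)

/-- Minimizers of the empirical loss inherit the geometry under uniform closeness. -/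
theorem IsLoss.popLoss_le_of_uniformlyClose (hV : IsLoss V) (hβ : 0 < β) (hσ : 0 ≤ σ)
    (hSZ : SZ.PosSemidef) (hdD : d + K < D) (hr₀ : 0 < r₀)
    (hmin : IsMinOn (hpop V σ β) (Ici 0) r₀) {n : ℕ} (hn : 0 < n)
    {x : Fin n → EuclideanSpace ℝ (Fin D)} {ε : ℝ}
    (hx : UniformlyClose (K := K) V β B SZ σ x ε) {w : Fin K → EuclideanSpace ℝ (Fin D)}
    (hw : IsMinOn (empLoss V β x) univ w) :
    w ∈ ball V β D K ∧ 0 ≤ ε ∧ popLoss V β B SZ σ w ≤ K * hpop V σ β r₀ + 2 * ε := by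
  have hwb := (hV.exists_isMinOn_empLoss hβ hn x).2 w hw
  obtain ⟨w', hw'b, hw'⟩ := hV.exists_popLoss_eq (B := B) hβ hσ hSZ hdD hr₀ hmin
  have h1 := abs_le.1 (hx w hwb)
  have h2 := abs_le.1 (hx w' hw'b)
  have h3 : empLoss V β x w ≤ empLoss V β x w' := hw (mem_univ _)
  exact ⟨hwb, (abs_nonneg _).trans (hx w hwb), by linarith⟩

end

/-! ### Rademacher averages -/

lemma expect_signs_succ {n : ℕ} (f : (Fin (n + 1) → ℤˣ) → ℝ) :
    𝔼 m, f m = ((𝔼 m : Fin n → ℤˣ, f (Fin.cons 1 m)) + 𝔼 m : Fin n → ℤˣ, f (Fin.cons (-1) m)) / 2 := by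
  simp only [Fintype.expect_eq_sum_div_card]
  rw [← (Fin.consEquiv fun _ : Fin (n + 1) => ℤˣ).sum_comp, Fintype.sum_prod_type,
    UnitsInt.univ, Finset.sum_pair (by decide)]
  simp [Fin.consEquiv, pow_succ]
  ring

lemma bit_cons_zero {n : ℕ} (s : ℤˣ) (m : Fin n → ℤˣ) :
    bit (Fin.cons s m : Fin (n + 1) → ℤˣ) 0 = ((s : ℤ) : ℝ) := rfl

lemma bit_cons_succ {n : ℕ} (s : ℤˣ) (m : Fin n → ℤˣ) (i : Fin n) :
    bit (Fin.cons s m : Fin (n + 1) → ℤˣ) i.succ = bit m i := rfl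

lemma expect_signs_neg {n : ℕ} (f : (Fin n → ℤˣ) → ℝ) :
    𝔼 m, f (-m) = 𝔼 m, f m :=
  Fintype.expect_equiv (Equiv.neg _) _ _ fun _ => rfl

lemma expect_signs_perm {n : ℕ} (e : Equiv.Perm (Fin n)) (f : (Fin n → ℤˣ) → ℝ) :
    𝔼 m : Fin n → ℤˣ, f (m ∘ e) = 𝔼 m, f m :=
  Fintype.expect_equiv (Equiv.arrowCongr e.symm (Equiv.refl _)) _ _ fun _ => rfl

/-! #### Contraction for the positive part -/

/-- Take maximizers `p` and `q` of the two suprema on the left. Unless `t` is nonpositive at both,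
they can be assigned, possibly crosswise, to the two suprema on the right. In the remaining case `α
p = α q`, and `p` serves both suprema because `cosh ≥ 1`. -/
lemma exp_sup_posPart_le {ι : Type*} {S : Finset ι} (hS : S.Nonempty) (α t : ι → ℝ) :
    Real.exp (S.sup' hS fun s => α s + max (t s) 0) +
      Real.exp (S.sup' hS fun s => α s - max (t s) 0) ≤
    Real.exp (S.sup' hS fun s => α s + t s) + Real.exp (S.sup' hS fun s => α s - t s) := by
  obtain ⟨p, hp, hpe⟩ := Finset.exists_mem_eq_sup' hS fun s => α s + max (t s) 0
  obtain ⟨q, hq, hqe⟩ := Finset.exists_mem_eq_sup' hS fun s => α s - max (t s) 0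
  have hle1 (s : ι) (hs : s ∈ S) : α s + t s ≤ S.sup' hS fun s => α s + t s :=
    Finset.le_sup' (fun s => α s + t s) hs
  have hle2 (s : ι) (hs : s ∈ S) : α s - t s ≤ S.sup' hS fun s => α s - t s :=
    Finset.le_sup' (fun s => α s - t s) hs
  have h1 := Finset.le_sup' (fun s => α s + max (t s) 0) hq
  have h2 := Finset.le_sup' (fun s => α s - max (t s) 0) hp
  rw [hpe] at h1 ⊢
  rw [hqe] at h2 ⊢
  rcases le_total 0 (t p) with hp0 | hp0 <;> rcases le_total 0 (t q) with hq0 | hq0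
  · rw [max_eq_left hp0, max_eq_left hq0]
    exact add_le_add (Real.exp_le_exp.2 (hle1 p hp)) (Real.exp_le_exp.2 (hle2 q hq))
  · rw [max_eq_left hp0, max_eq_right hq0]
    refine add_le_add (Real.exp_le_exp.2 (hle1 p hp)) (Real.exp_le_exp.2 ?_)
    linarith [hle2 q hq]
  · rw [max_eq_right hp0, max_eq_left hq0, add_comm]
    refine add_le_add (Real.exp_le_exp.2 ?_) (Real.exp_le_exp.2 ?_)
    · linarith [hle1 q hq]
    · linarith [hle2 p hp]
  · rw [max_eq_right hp0, max_eq_right hq0] at h1 h2 ⊢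
    have hpq : α q = α p := by linarith
    rw [hpq, add_zero, sub_zero]
    have h3 : Real.exp (α p + t p) + Real.exp (α p - t p) = 2 * Real.cosh (t p) * Real.exp (α p) := by
      rw [Real.cosh_eq, Real.exp_add, Real.exp_sub, Real.exp_neg]; ring
    have h4 := Real.one_le_cosh (t p)
    have h5 := Real.exp_le_exp.2 (hle1 p hp)
    have h6 := Real.exp_le_exp.2 (hle2 p hp)
    nlinarith [Real.exp_pos (α p)]

/-- Comparison of the exponential moments of Rademacher suprema under the positive part. -/
lemma expect_exp_sup_posPart_le {ι : Type*} {S : Finset ι} (hS : S.Nonempty) {n : ℕ} (α : ι → ℝ)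
    (t : Fin n → ι → ℝ) :
    𝔼 m : Fin n → ℤˣ, Real.exp (S.sup' hS fun s => α s + ∑ i, bit m i * max (t i s) 0) ≤
      𝔼 m : Fin n → ℤˣ, Real.exp (S.sup' hS fun s => α s + ∑ i, bit m i * t i s) := by
  induction n generalizing α with
  | zero => simp
  | succ n ih =>
    rw [expect_signs_succ, expect_signs_succ]
    simp only [Fin.sum_univ_succ, bit_cons_zero, bit_cons_succ, ← add_assoc]
    refine div_le_div_of_nonneg_right ?_ zero_le_two
    -- The first sign is absorbed into `α`, which is why `α` is arbitrary in the induction.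
    refine (add_le_add (ih (fun s => α s + ((1 : ℤˣ) : ℤ) * max (t 0 s) 0) fun i => t i.succ)
      (ih (fun s => α s + ((-1 : ℤˣ) : ℤ) * max (t 0 s) 0) fun i => t i.succ)).trans ?_
    rw [← Finset.expect_add_distrib, ← Finset.expect_add_distrib]
    refine Finset.expect_le_expect fun m _ => ?_
    have := exp_sup_posPart_le hS (fun s => α s + ∑ i, bit m i * t i.succ s) (t 0)
    refine le_trans (le_of_eq ?_) (this.trans (le_of_eq ?_)) <;>
    · simp only [Units.val_one, Units.val_neg, Int.cast_one, Int.cast_neg, one_mul, neg_mul]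
      congr 3 <;> ext s <;> ring

/-! #### A maximal inequality of Lévy type -/

/-- The maximum of `0` and the partial sums of `y`. -/
noncomputable def walkMax : ∀ {n : ℕ}, (Fin n → ℝ) → ℝ
  | 0, _ => 0
  | _ + 1, y => max 0 (y 0 + walkMax (Fin.tail y))

lemma walkMax_nonneg {n : ℕ} (y : Fin n → ℝ) : 0 ≤ walkMax y := by
  cases n
  · exact le_rfl
  · exact le_max_left _ _

/-- For increasing weights, truncated weighted sums are dominated by the maximal partial sum. -/
lemma sum_mul_min_le_walkMax {n : ℕ} {a : Fin n → ℝ} (ha : Monotone a) (θ : Fin n → ℝ)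
    {b : ℝ} (hb : 0 ≤ b) :
    ∑ i, θ i * min b (a i) ≤ walkMax fun i => θ i * a i := by
  induction n generalizing b with
  | zero => simp [walkMax]
  | succ n ih =>
    -- The ratios `min b (a i) / a i` decrease within `[0, 1]`, so the sum is a combination of
    -- partial sums of total weight at most one. An untruncated first term is peeled off; if `b < a
    -- 0`, every term is truncated and the sum is a multiple of the one for `b = a 0`.
    have key (b : ℝ) (hb : 0 ≤ b) (hab : a 0 ≤ b) :
        ∑ i, θ i * min b (a i) ≤ walkMax fun i => θ i * a i := by
      rw [Fin.sum_univ_succ, min_eq_right hab]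
      exact le_max_of_le_right (add_le_add le_rfl
        (ih (a := Fin.tail a) (fun i j h => ha (Fin.succ_le_succ_iff.2 h)) (Fin.tail θ) hb))
    rcases le_total (a 0) b with h | h
    · exact key b hb h
    rcases hb.eq_or_lt with rfl | hb'
    · simp only [min_eq_left (h.trans (ha (Fin.zero_le _))), mul_zero, Finset.sum_const_zero]
      exact walkMax_nonneg _
    · have ha0 : 0 < a 0 := hb'.trans_le h
      have h1 := key (a 0) ha0.le le_rfl
      have e1 : ∑ i, θ i * min b (a i) = b / a 0 * ∑ i, θ i * min (a 0) (a i) := by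
        rw [Finset.mul_sum]
        refine Finset.sum_congr rfl fun i _ => ?_
        rw [min_eq_left (h.trans (ha (Fin.zero_le i))), min_eq_left (ha (Fin.zero_le i))]
        field_simp
      rw [e1]
      have h2 : b / a 0 ≤ 1 := (div_le_one ha0).2 h
      have h3 := walkMax_nonneg fun i => θ i * a i
      have h4 : b / a 0 * ∑ i, θ i * min (a 0) (a i) ≤ b / a 0 * walkMax fun i => θ i * a i := by
        gcongr
      have h5 : 0 ≤ b / a 0 := by positivity
      nlinarith

/-- Induction over all monotone `ψ` at once: conditioning on the first sign replaces `ψ` by `χ`. The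
maximum of the remaining walk is positive, which gives `χ` of it exactly, and passing from `χ` of
the positive part back to `ψ` costs an error `g` whose symmetrization is at most `ψ c - ψ 0`. -/
lemma expect_walkMax_le {n : ℕ} {a : Fin n → ℝ} (ha : ∀ i, 0 ≤ a i) {ψ : ℝ → ℝ}
    (hψ : Monotone ψ) :
    𝔼 m : Fin n → ℤˣ, ψ (walkMax fun i => bit m i * a i) ≤
      2 * (𝔼 m : Fin n → ℤˣ, ψ (max (∑ i, bit m i * a i) 0)) - ψ 0 := by
  induction n generalizing ψ with
  | zero => simp [walkMax]; linarith
  | succ n ih =>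
    set c := a 0 with hc
    have hc0 : 0 ≤ c := ha 0
    set M : (Fin n → ℤˣ) → ℝ := fun m => walkMax fun i => bit m i * a i.succ with hM
    set T : (Fin n → ℤˣ) → ℝ := fun m => ∑ i, bit m i * a i.succ with hT
    set χ : ℝ → ℝ := fun t => (ψ (c + t) + ψ (max (t - c) 0)) / 2 with hχ
    have hχm : Monotone χ := fun s t h =>
      div_le_div_of_nonneg_right (add_le_add (hψ (by linarith))
        (hψ (max_le_max (by linarith) le_rfl))) zero_le_two
    have h1 := ih (a := fun i => a i.succ) (fun i => ha _) hχm
    have hL : 𝔼 m : Fin (n + 1) → ℤˣ, ψ (walkMax fun i => bit m i * a i) =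
        𝔼 m : Fin n → ℤˣ, χ (M m) := by
      rw [expect_signs_succ, ← Finset.expect_add_distrib, Finset.expect_div]
      refine Finset.expect_congr rfl fun m _ => ?_
      have hMm : 0 ≤ M m := walkMax_nonneg _
      have e1 : (walkMax fun i => bit (Fin.cons 1 m : Fin (n + 1) → ℤˣ) i * a i) = c + M m := by
        show max 0 (((1 : ℤˣ) : ℤ) * c + M m) = c + M m
        simp only [Units.val_one, Int.cast_one, one_mul]
        rw [max_eq_right (by linarith)]
      have e2 : (walkMax fun i => bit (Fin.cons (-1) m : Fin (n + 1) → ℤˣ) i * a i) =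
          max (M m - c) 0 := by
        show max 0 (((-1 : ℤˣ) : ℤ) * c + M m) = max (M m - c) 0
        simp only [Units.val_one, Units.val_neg, Int.cast_one, Int.cast_neg, neg_mul, one_mul]
        rw [max_comm]; congr 1; ring
      rw [e1, e2]
    have hR : 𝔼 m : Fin (n + 1) → ℤˣ, ψ (max (∑ i, bit m i * a i) 0) =
        𝔼 m : Fin n → ℤˣ, (ψ (max (c + T m) 0) + ψ (max (T m - c) 0)) / 2 := by
      rw [expect_signs_succ, ← Finset.expect_add_distrib, Finset.expect_div]
      refine Finset.expect_congr rfl fun m _ => ?_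
      simp only [Fin.sum_univ_succ, bit_cons_zero, bit_cons_succ, Units.val_one, Units.val_neg,
        Int.cast_one, Int.cast_neg, neg_mul, one_mul, ← hc]
      rw [show -c + ∑ i, bit m i * a i.succ = T m - c by simp only [hT]; ring]
    set g : ℝ → ℝ := fun t => ψ (c + max t 0) - ψ (max (c + t) 0) with hg
    have hgs (t : ℝ) : g t + g (-t) ≤ ψ c - ψ 0 := by
      have h0 : ψ 0 ≤ ψ c := hψ hc0
      have hpos (t : ℝ) (ht : 0 ≤ t) : g t + g (-t) ≤ ψ c - ψ 0 := by
        simp only [hg]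
        rw [max_eq_left ht, max_eq_left (by linarith : 0 ≤ c + t), max_eq_right (by linarith),
          add_zero]
        have := hψ (le_max_right (c + -t) 0)
        linarith
      rcases le_total 0 t with ht | ht
      · exact hpos t ht
      · have := hpos (-t) (by linarith)
        rw [neg_neg] at this
        linarith
    have hTneg (m : Fin n → ℤˣ) : T (-m) = -T m := by
      simp only [hT, bit_neg, neg_mul, Finset.sum_neg_distrib]
    have hge : 2 * 𝔼 m, g (T m) ≤ ψ c - ψ 0 := by
      have e : 𝔼 m, g (-T m) = 𝔼 m, g (T m) := by
        rw [← expect_signs_neg fun m => g (T m)]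
        simp only [hTneg]
      calc 2 * 𝔼 m, g (T m) = 𝔼 m, (g (T m) + g (-T m)) := by
            rw [Finset.expect_add_distrib, e]; ring
        _ ≤ 𝔼 _m : Fin n → ℤˣ, (ψ c - ψ 0) := Finset.expect_le_expect fun m _ => hgs _
        _ = _ := Fintype.expect_const _
    have hdiff : (𝔼 m, χ (max (T m) 0)) =
        (𝔼 m, (ψ (max (c + T m) 0) + ψ (max (T m - c) 0)) / 2) + (𝔼 m, g (T m)) / 2 := by
      rw [Finset.expect_div, ← Finset.expect_add_distrib]
      refine Finset.expect_congr rfl fun m _ => ?_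
      simp only [hχ, hg]
      have : max (max (T m) 0 - c) 0 = max (T m - c) 0 := by
        rcases le_total 0 (T m) with h | h
        · rw [max_eq_left h]
        · rw [max_eq_right h, max_eq_right (by linarith), max_eq_right (by linarith)]
      rw [this]; ring
    rw [hL, hR]
    have hχ0 : χ 0 = (ψ c + ψ 0) / 2 := by
      simp only [hχ]
      rw [add_zero, max_eq_right (by linarith)]
    rw [hχ0] at h1
    linarith

lemma expect_exp_sum {n : ℕ} (y : Fin n → ℝ) :
    𝔼 m : Fin n → ℤˣ, Real.exp (∑ i, bit m i * y i) = ∏ i, Real.cosh (y i) := by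
  induction n with
  | zero => simp
  | succ n ih =>
    rw [expect_signs_succ, Fin.prod_univ_succ, ← ih]
    simp only [Fin.sum_univ_succ, bit_cons_zero, bit_cons_succ, Units.val_one, Units.val_neg,
        Int.cast_one, Int.cast_neg, neg_mul, one_mul, Real.exp_add, ← Finset.mul_expect]
    rw [Real.cosh_eq]; ring

/-- With `P` the product of the `cosh`, the maximal inequality gives `2 (P + 1) - 1`, at most `3 P`
as `P ≥ 1`. -/
lemma expect_exp_walkMax_le {n : ℕ} {a : Fin n → ℝ} (ha : ∀ i, 0 ≤ a i) {c : ℝ} (hc : 0 ≤ c) :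
    𝔼 m : Fin n → ℤˣ, Real.exp (c * walkMax fun i => bit m i * a i) ≤
      3 * ∏ i, Real.cosh (c * a i) := by
  have h1 := expect_walkMax_le ha (ψ := fun t => Real.exp (c * t)) fun s t h =>
    Real.exp_le_exp.2 (mul_le_mul_of_nonneg_left h hc)
  have h2 : 𝔼 m : Fin n → ℤˣ, Real.exp (c * max (∑ i, bit m i * a i) 0) ≤
      𝔼 m : Fin n → ℤˣ, (Real.exp (∑ i, bit m i * (c * a i)) + 1) := by
    refine Finset.expect_le_expect fun m _ => ?_
    have e : ∑ i, bit m i * (c * a i) = c * ∑ i, bit m i * a i := by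
      rw [Finset.mul_sum]; exact Finset.sum_congr rfl fun i _ => by ring
    rw [e]
    rcases le_total 0 (∑ i, bit m i * a i) with h | h
    · rw [max_eq_left h]; linarith
    · rw [max_eq_right h, mul_zero, Real.exp_zero]
      linarith [Real.exp_pos (c * ∑ i, bit m i * a i)]
  rw [Finset.expect_add_distrib, expect_exp_sum, Fintype.expect_const] at h2
  have h3 : 1 ≤ ∏ i, Real.cosh (c * a i) :=
    Finset.prod_induction _ (1 ≤ ·) (fun _ _ => one_le_mul_of_one_le_of_one_le) le_rfl
      fun i _ => Real.one_le_cosh _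
  simp only [mul_zero, Real.exp_zero] at h1
  linarith

/-- The law of the signs is invariant under permutations, so the weights may be sorted; one maximal
partial sum then dominates all truncation levels. -/
lemma expect_exp_sup_min_le {n : ℕ} {S : Finset ℝ} (hS : S.Nonempty) (hS0 : ∀ b ∈ S, 0 ≤ b)
    {a : Fin n → ℝ} (ha : ∀ i, 0 ≤ a i) {c : ℝ} (hc : 0 ≤ c) :
    𝔼 m : Fin n → ℤˣ, Real.exp (c * S.sup' hS fun b => ∑ i, bit m i * min b (a i)) ≤
      3 * ∏ i, Real.cosh (c * a i) := by
  set e := Tuple.sort a with he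
  have hmono : Monotone (a ∘ e) := Tuple.monotone_sort a
  calc 𝔼 m : Fin n → ℤˣ, Real.exp (c * S.sup' hS fun b => ∑ i, bit m i * min b (a i))
      ≤ 𝔼 m : Fin n → ℤˣ, Real.exp (c * walkMax fun i => bit (m ∘ e) i * (a ∘ e) i) := by
        refine Finset.expect_le_expect fun m _ => Real.exp_le_exp.2
          (mul_le_mul_of_nonneg_left (Finset.sup'_le _ _ fun b hb => ?_) hc)
        refine le_trans (le_of_eq ?_) (sum_mul_min_le_walkMax hmono _ (hS0 b hb))
        exact (Equiv.sum_comp e fun i => bit m i * min b (a i)).symm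
    _ = 𝔼 m : Fin n → ℤˣ, Real.exp (c * walkMax fun i => bit m i * (a ∘ e) i) :=
        expect_signs_perm e fun m => Real.exp (c * walkMax fun i => bit m i * (a ∘ e) i)
    _ ≤ 3 * ∏ i, Real.cosh (c * (a ∘ e) i) := expect_exp_walkMax_le (fun i => ha _) hc
    _ = 3 * ∏ i, Real.cosh (c * a i) := by
        congr 1; exact Equiv.prod_comp e fun i => Real.cosh (c * a i)

/-! #### Rademacher averages of affine positive parts -/

lemma two_mul_exp_add_le (p q : ℝ) :
    2 * Real.exp (p + q) ≤ Real.exp (2 * p) + Real.exp (2 * q) := by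
  rw [Real.exp_add, two_mul p, two_mul q, Real.exp_add, Real.exp_add]
  nlinarith [sq_nonneg (Real.exp p - Real.exp q)]

/-- The exponential moment of the Rademacher supremum over thresholded half-space functions
`(⟪u, x⟫ - b)₊`, with nonnegative thresholds `b` and `‖u‖ ≤ 1`. -/
lemma expect_exp_sup_threshold_le {E : Type*} [NormedAddCommGroup E] [InnerProductSpace ℝ E]
    {n : ℕ} {S : Finset (ℝ × E)} (hS : S.Nonempty) (hS0 : ∀ s ∈ S, 0 ≤ s.1 ∧ ‖s.2‖ ≤ 1)
    (x : Fin n → E) {c : ℝ} (hc : 0 ≤ c) :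
    𝔼 m : Fin n → ℤˣ,
      Real.exp (S.sup' hS fun s => ∑ i, bit m i * (c * max (⟪s.2, x i⟫ - s.1) 0)) ≤
      (𝔼 m : Fin n → ℤˣ, Real.cosh (2 * c * ‖∑ i, bit m i • x i‖)) +
        3 / 2 * ∏ i, Real.cosh (2 * c * ‖x i‖) := by
  classical
  have hS1 : (S.image Prod.fst).Nonempty := hS.image _
  -- Since `⟪u, y⟫ ≤ ‖y‖`, thresholds above `‖y‖` act like `‖y‖`. Clipping must precede the
  -- contraction, which would otherwise leave the unbounded `b`.
  have hclip (s : ℝ × E) (hs : s ∈ S) (y : E) : c * max (⟪s.2, y⟫ - s.1) 0 =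
      max (c * (⟪s.2, y⟫ - min s.1 ‖y‖)) 0 := by
    rw [← mul_zero c, ← mul_max_of_nonneg _ _ hc, mul_zero]
    congr 1
    have h1 : ⟪s.2, y⟫ ≤ ‖y‖ := by
      have h2 := real_inner_le_norm s.2 y
      have h3 := (hS0 s hs).2
      nlinarith [norm_nonneg y]
    rcases le_total s.1 ‖y‖ with h | h
    · rw [min_eq_left h]
    · rw [min_eq_right h, max_eq_right (by linarith), max_eq_right (by linarith)]
  have hcontract : 𝔼 m : Fin n → ℤˣ,
      Real.exp (S.sup' hS fun s => ∑ i, bit m i * (c * max (⟪s.2, x i⟫ - s.1) 0)) ≤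
      𝔼 m : Fin n → ℤˣ,
        Real.exp (S.sup' hS fun s => ∑ i, bit m i * (c * (⟪s.2, x i⟫ - min s.1 ‖x i‖))) := by
    have := expect_exp_sup_posPart_le hS 0 fun i s => c * (⟪s.2, x i⟫ - min s.1 ‖x i‖)
    simp only [Pi.zero_apply, zero_add] at this
    refine le_trans (le_of_eq ?_) this
    refine Finset.expect_congr rfl fun m _ => ?_
    congr 1
    refine Finset.sup'_congr hS rfl fun s hs => Finset.sum_congr rfl fun i _ => ?_
    rw [hclip s hs]
  refine hcontract.trans ?_
  -- The linear and the threshold parts are separated at the cost of doubling both exponents.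
  have hsigns (m : Fin n → ℤˣ) :
      Real.exp (S.sup' hS fun s => ∑ i, bit m i * (c * (⟪s.2, x i⟫ - min s.1 ‖x i‖))) ≤
      Real.cosh (2 * c * ‖∑ i, bit m i • x i‖) + 1 / 2 * Real.exp (2 * c *
        (S.image Prod.fst).sup' hS1 fun b => ∑ i, bit (-m) i * min b ‖x i‖) := by
    have h1 : S.sup' hS (fun s => ∑ i, bit m i * (c * (⟪s.2, x i⟫ - min s.1 ‖x i‖))) ≤
        c * ‖∑ i, bit m i • x i‖ +
        c * (S.image Prod.fst).sup' hS1 fun b => ∑ i, bit (-m) i * min b ‖x i‖ := by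
      refine Finset.sup'_le _ _ fun s hs => ?_
      have e : ∑ i, bit m i * (c * (⟪s.2, x i⟫ - min s.1 ‖x i‖)) =
          c * ⟪s.2, ∑ i, bit m i • x i⟫ + c * ∑ i, bit (-m) i * min s.1 ‖x i‖ := by
        rw [inner_sum, Finset.mul_sum, Finset.mul_sum, ← Finset.sum_add_distrib]
        refine Finset.sum_congr rfl fun i _ => ?_
        rw [real_inner_smul_right, bit_neg]; ring
      rw [e]
      refine add_le_add (mul_le_mul_of_nonneg_left ?_ hc) (mul_le_mul_of_nonneg_left ?_ hc)
      · refine (real_inner_le_norm _ _).trans ?_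
        have := (hS0 s hs).2
        nlinarith [norm_nonneg (∑ i, bit m i • x i)]
      · exact Finset.le_sup' (fun b => ∑ i, bit (-m) i * min b ‖x i‖)
          (Finset.mem_image_of_mem _ hs)
    have h2 := two_mul_exp_add_le (c * ‖∑ i, bit m i • x i‖)
      (c * (S.image Prod.fst).sup' hS1 fun b => ∑ i, bit (-m) i * min b ‖x i‖)
    have h3 := Real.exp_le_exp.2 h1
    have h4 : Real.exp (2 * (c * ‖∑ i, bit m i • x i‖)) ≤
        2 * Real.cosh (2 * c * ‖∑ i, bit m i • x i‖) := by
      rw [Real.cosh_eq, ← mul_assoc]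
      linarith [Real.exp_pos (-(2 * c * ‖∑ i, bit m i • x i‖))]
    rw [← mul_assoc 2 c ((S.image Prod.fst).sup' hS1 _)] at h2
    linarith
  refine (Finset.expect_le_expect fun m _ => hsigns m).trans ?_
  rw [Finset.expect_add_distrib, ← Finset.mul_expect]
  refine add_le_add le_rfl ?_
  have h5 : 𝔼 m : Fin n → ℤˣ, Real.exp (2 * c *
        (S.image Prod.fst).sup' hS1 fun b => ∑ i, bit (-m) i * min b ‖x i‖) ≤
        3 * ∏ i, Real.cosh (2 * c * ‖x i‖) := by
    rw [expect_signs_neg fun m => Real.exp (2 * c *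
        (S.image Prod.fst).sup' hS1 fun b => ∑ i, bit m i * min b ‖x i‖)]
    refine expect_exp_sup_min_le hS1 (fun b hb => ?_) (fun i => norm_nonneg _) (by positivity)
    obtain ⟨s, hs, rfl⟩ := Finset.mem_image.1 hb
    exact (hS0 s hs).1
  linarith

/-! ### Symmetrization -/

section Symmetrization
variable {E : Type*} [NormedAddCommGroup E] [MeasurableSpace E]
  [SecondCountableTopology E] {μ : Measure E} [IsProbabilityMeasure μ] {n : ℕ}

lemma integrable_exp_sum_norm (hexp : ∀ c : ℝ, Integrable (fun x => Real.exp (c * ‖x‖)) μ)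
    (c : ℝ) : Integrable (fun x : Fin n → E => Real.exp (c * ∑ i, ‖x i‖))
      (Measure.pi fun _ => μ) := by
  have := Integrable.fintype_prod (μ := fun _ : Fin n => μ)
    (f := fun _ x => Real.exp (c * ‖x‖)) fun _ => hexp c
  refine this.congr (.of_forall fun x => ?_)
  simp only [Finset.mul_sum, Real.exp_sum]

/-- The map exchanging the coordinates of two samples at the indices where `m` is `-1`. -/
def swapSamples (m : Fin n → ℤˣ) (p : (Fin n → E) × (Fin n → E)) : (Fin n → E) × (Fin n → E) :=
  (fun i => if m i = 1 then p.1 i else p.2 i, fun i => if m i = 1 then p.2 i else p.1 i)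

lemma measurePreserving_swapSamples (m : Fin n → ℤˣ) :
    MeasurePreserving (swapSamples (E := E) m)
      ((Measure.pi fun _ : Fin n => μ).prod (Measure.pi fun _ : Fin n => μ))
      ((Measure.pi fun _ : Fin n => μ).prod (Measure.pi fun _ : Fin n => μ)) := by
  have h1 := measurePreserving_arrowProdEquivProdArrow E E (Fin n) (fun _ => μ) fun _ => μ
  have h2 : MeasurePreserving (fun (a : Fin n → E × E) i =>
      (if m i = 1 then id else Prod.swap) (a i)) (Measure.pi fun _ => μ.prod μ)
      (Measure.pi fun _ => μ.prod μ) := by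
    refine measurePreserving_pi (fun _ => μ.prod μ) (fun _ => μ.prod μ) fun i => ?_
    split_ifs
    · exact MeasurePreserving.id _
    · exact Measure.measurePreserving_swap
  have h3 := h1.comp (h2.comp h1.symm)
  convert h3 using 1
  ext p i <;>
  · simp only [swapSamples, Function.comp, MeasurableEquiv.arrowProdEquivProdArrow]
    by_cases h : m i = 1 <;> simp [h, Equiv.arrowProdEquivProdArrow]

variable {ι : Type*} {S : Finset ι} (hS : S.Nonempty) {f : ι → E → ℝ}

lemma sum_swapSamples_sub {α : Type*} (m : Fin n → ℤˣ) (g : α → ℝ)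
    (p : (Fin n → α) × (Fin n → α)) :
    ∑ i, (g ((swapSamples m p).1 i) - g ((swapSamples m p).2 i)) =
      ∑ i, bit m i * (g (p.1 i) - g (p.2 i)) := by
  refine Finset.sum_congr rfl fun i _ => ?_
  rcases Int.units_eq_one_or (m i) with h | h
  · simp [swapSamples, bit, h]
  · simp [swapSamples, bit, h]

/-- Symmetrization for exponential moments of suprema over a finite class. -/
lemma integral_exp_sup_centered_le [BorelSpace E]
    (hexp : ∀ c : ℝ, Integrable (fun x => Real.exp (c * ‖x‖)) μ)
    (hf : ∀ s ∈ S, Continuous (f s)) {C : ℝ} (hb : ∀ s ∈ S, ∀ x, |f s x| ≤ C * ‖x‖) :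
    Integrable (fun x : Fin n → E => Real.exp (S.sup' hS fun s => ∑ i, (f s (x i) - ∫ y, f s y ∂μ)))
      (Measure.pi fun _ => μ) ∧
    (∀ m : Fin n → ℤˣ, Integrable (fun x : Fin n → E =>
      Real.exp (S.sup' hS fun s => ∑ i, bit m i * (2 * f s (x i)))) (Measure.pi fun _ => μ)) ∧
    ∫ x : Fin n → E, Real.exp (S.sup' hS fun s => ∑ i, (f s (x i) - ∫ y, f s y ∂μ))
        ∂(Measure.pi fun _ => μ) ≤
      𝔼 m : Fin n → ℤˣ, ∫ x : Fin n → E,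
        Real.exp (S.sup' hS fun s => ∑ i, bit m i * (2 * f s (x i))) ∂(Measure.pi fun _ => μ) := by
  set P := Measure.pi fun _ : Fin n => μ with hP
  have hnorm : Integrable (fun x : E => ‖x‖) μ := by
    refine (hexp 1).mono' (by fun_prop) (.of_forall fun x => ?_)
    simp only [norm_norm, one_mul]
    linarith [Real.add_one_le_exp ‖x‖]
  have hfi (s : ι) (hs : s ∈ S) : Integrable (f s) μ :=
    (hnorm.const_mul C).mono' (hf s hs).aestronglyMeasurable (.of_forall (hb s hs))
  have hsup (g : ι → ℝ) : ∃ s ∈ S, S.sup' hS g = g s := Finset.exists_mem_eq_sup' hS g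
  -- domination
  have hI1 : Integrable (fun x : Fin n → E =>
      Real.exp (S.sup' hS fun s => ∑ i, (f s (x i) - ∫ y, f s y ∂μ))) P := by
    set A := S.sup' hS fun s => ∑ _i : Fin n, |∫ y, f s y ∂μ| with hA
    refine ((integrable_exp_sum_norm (n := n) hexp C).const_mul (Real.exp A)).mono'
      (Continuous.aestronglyMeasurable ?_) (.of_forall fun x => ?_)
    · refine Real.continuous_exp.comp (Continuous.finset_sup'_apply hS fun s hs => ?_)
      have := hf s hs
      fun_prop
    · rw [Real.norm_eq_abs, Real.abs_exp, ← Real.exp_add, Real.exp_le_exp]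
      refine Finset.sup'_le _ _ fun s hs => ?_
      have h1 : ∑ _i : Fin n, |∫ y, f s y ∂μ| ≤ A :=
        Finset.le_sup' (fun s => ∑ _i : Fin n, |∫ y, f s y ∂μ|) hs
      rw [Finset.mul_sum]
      refine le_trans ?_ (add_le_add h1 le_rfl)
      rw [← Finset.sum_add_distrib]
      refine Finset.sum_le_sum fun i _ => ?_
      have h2 := (abs_le.1 (hb s hs (x i))).2
      have h3 := neg_abs_le (∫ y, f s y ∂μ)
      linarith
  have hI2 (m : Fin n → ℤˣ) : Integrable (fun x : Fin n → E =>
      Real.exp (S.sup' hS fun s => ∑ i, bit m i * (2 * f s (x i)))) P := by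
    refine (integrable_exp_sum_norm (n := n) hexp (2 * C)).mono'
      (Continuous.aestronglyMeasurable ?_) (.of_forall fun x => ?_)
    · refine Real.continuous_exp.comp (Continuous.finset_sup'_apply hS fun s hs => ?_)
      have := hf s hs
      fun_prop
    · rw [Real.norm_eq_abs, Real.abs_exp, Real.exp_le_exp]
      refine Finset.sup'_le _ _ fun s hs => ?_
      rw [Finset.mul_sum]
      refine Finset.sum_le_sum fun i _ => (le_abs_self _).trans ?_
      rw [abs_mul, abs_bit, one_mul, abs_mul, abs_two, mul_assoc]
      exact mul_le_mul_of_nonneg_left (hb s hs (x i)) zero_le_two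
  have hI3 (m : Fin n → ℤˣ) : Integrable (fun p : (Fin n → E) × (Fin n → E) =>
      Real.exp (S.sup' hS fun s => ∑ i, bit m i * (f s (p.1 i) - f s (p.2 i)))) (P.prod P) := by
    refine ((integrable_exp_sum_norm (n := n) hexp C).mul_prod
      (integrable_exp_sum_norm (n := n) hexp C)).mono'
      (Continuous.aestronglyMeasurable ?_) (.of_forall fun x => ?_)
    · refine Real.continuous_exp.comp (Continuous.finset_sup'_apply hS fun s hs => ?_)
      have := hf s hs
      fun_prop
    · rw [Real.norm_eq_abs, Real.abs_exp, ← Real.exp_add, Real.exp_le_exp]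
      refine Finset.sup'_le _ _ fun s hs => ?_
      rw [Finset.mul_sum, Finset.mul_sum, ← Finset.sum_add_distrib]
      refine Finset.sum_le_sum fun i _ => (le_abs_self _).trans ?_
      rw [abs_mul, abs_bit, one_mul]
      refine (abs_sub _ _).trans (add_le_add (hb s hs _) (hb s hs _))
  have hI3' : Integrable (fun p : (Fin n → E) × (Fin n → E) =>
      Real.exp (S.sup' hS fun s => ∑ i, (f s (p.1 i) - f s (p.2 i)))) (P.prod P) := by
    have := hI3 1
    simpa [bit] using this
  have heval (i : Fin n) : MeasurePreserving (fun x : Fin n → E => x i) P μ :=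
    measurePreserving_eval (fun _ : Fin n => μ) i
  -- Jensen
  have hjensen : ∫ x, Real.exp (S.sup' hS fun s => ∑ i, (f s (x i) - ∫ y, f s y ∂μ)) ∂P ≤
      ∫ p, Real.exp (S.sup' hS fun s => ∑ i, (f s (p.1 i) - f s (p.2 i))) ∂(P.prod P) := by
    rw [integral_prod _ hI3']
    refine integral_mono_ae hI1 hI3'.integral_prod_left ?_
    filter_upwards [hI3'.prod_right_ae] with x hx
    obtain ⟨s, hs, he⟩ := hsup fun s => ∑ i, (f s (x i) - ∫ y, f s y ∂μ)
    rw [he]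
    have hint (i : Fin n) : Integrable (fun x' : Fin n → E => f s (x' i)) P :=
      (heval i).integrable_comp_of_integrable (hfi s hs)
    have hint1 (i : Fin n) : Integrable (fun x' : Fin n → E => f s (x i) - f s (x' i)) P :=
      (integrable_const _).sub (hint i)
    have hint2 : Integrable (fun x' : Fin n → E => ∑ i, (f s (x i) - f s (x' i))) P :=
      integrable_finsetSum _ fun i _ => hint1 i
    have e : ∑ i, (f s (x i) - ∫ y, f s y ∂μ) =
        ∫ x' : Fin n → E, ∑ i, (f s (x i) - f s (x' i)) ∂P := by
      rw [integral_finsetSum _ fun i _ => hint1 i]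
      refine Finset.sum_congr rfl fun i _ => ?_
      rw [integral_sub (integrable_const _) (hint i)]
      have : ∫ x' : Fin n → E, f s (x' i) ∂P = ∫ y, f s y ∂μ := by
        rw [← (heval i).map_eq]
        exact (integral_map (heval i).measurable.aemeasurable
          (hf s hs).aestronglyMeasurable).symm
      rw [this]
      simp
    have hle (x' : Fin n → E) : Real.exp (∑ i, (f s (x i) - f s (x' i))) ≤
        Real.exp (S.sup' hS fun s => ∑ i, (f s (x i) - f s (x' i))) :=
      Real.exp_le_exp.2 (Finset.le_sup' (fun s => ∑ i, (f s (x i) - f s (x' i))) hs)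
    have hint3 : Integrable (fun x' : Fin n → E => Real.exp (∑ i, (f s (x i) - f s (x' i)))) P := by
      refine hx.mono' (Continuous.aestronglyMeasurable ?_) (.of_forall fun x' => ?_)
      · have := hf s hs
        fun_prop
      · rw [Real.norm_eq_abs, Real.abs_exp]; exact hle x'
    rw [e]
    refine (convexOn_exp.map_integral_le Real.continuous_exp.continuousOn isClosed_univ
      (.of_forall fun _ => mem_univ _) hint2 hint3).trans ?_
    exact integral_mono hint3 hx hle
  -- exchanging the two samples
  have hswap (m : Fin n → ℤˣ) :
      ∫ p, Real.exp (S.sup' hS fun s => ∑ i, (f s (p.1 i) - f s (p.2 i))) ∂(P.prod P) =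
      ∫ p, Real.exp (S.sup' hS fun s => ∑ i, bit m i * (f s (p.1 i) - f s (p.2 i))) ∂(P.prod P) := by
    have hmp := measurePreserving_swapSamples (μ := μ) (n := n) m
    conv_lhs => rw [hP, ← hmp.map_eq]
    rw [integral_map hmp.measurable.aemeasurable]
    · simp only [sum_swapSamples_sub]; rfl
    · rw [hmp.map_eq]; exact hI3'.aestronglyMeasurable
  -- separating the two samples
  have hsplit (m : Fin n → ℤˣ) :
      ∫ p, Real.exp (S.sup' hS fun s => ∑ i, bit m i * (f s (p.1 i) - f s (p.2 i))) ∂(P.prod P) ≤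
      ((∫ x, Real.exp (S.sup' hS fun s => ∑ i, bit m i * (2 * f s (x i))) ∂P) +
        ∫ x, Real.exp (S.sup' hS fun s => ∑ i, bit (-m) i * (2 * f s (x i))) ∂P) / 2 := by
    have i1 := (hI2 m).comp_fst P
    have i2 := (hI2 (-m)).comp_snd P
    have e : ((∫ x, Real.exp (S.sup' hS fun s => ∑ i, bit m i * (2 * f s (x i))) ∂P) +
        ∫ x, Real.exp (S.sup' hS fun s => ∑ i, bit (-m) i * (2 * f s (x i))) ∂P) / 2 =
        ∫ p : (Fin n → E) × (Fin n → E),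
          (Real.exp (S.sup' hS fun s => ∑ i, bit m i * (2 * f s (p.1 i))) +
          Real.exp (S.sup' hS fun s => ∑ i, bit (-m) i * (2 * f s (p.2 i)))) / 2 ∂(P.prod P) := by
      rw [integral_div, integral_add i1 i2]
      congr 2
      · exact (integral_fun_fst (μ := P) (ν := P) fun x =>
          Real.exp (S.sup' hS fun s => ∑ i, bit m i * (2 * f s (x i)))).symm ▸ by simp
      · exact (integral_fun_snd (μ := P) (ν := P) fun x =>
          Real.exp (S.sup' hS fun s => ∑ i, bit (-m) i * (2 * f s (x i)))).symm ▸ by simp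
    rw [e]
    refine integral_mono (hI3 m) ((i1.add i2).div_const 2) fun p => ?_
    obtain ⟨s, hs, he⟩ := hsup fun s => ∑ i, bit m i * (f s (p.1 i) - f s (p.2 i))
    simp only [he]
    have e2 : ∑ i, bit m i * (f s (p.1 i) - f s (p.2 i)) =
        (∑ i, bit m i * f s (p.1 i)) + ∑ i, bit (-m) i * f s (p.2 i) := by
      rw [← Finset.sum_add_distrib]
      exact Finset.sum_congr rfl fun i _ => by rw [bit_neg]; ring
    rw [e2, le_div_iff₀ zero_lt_two, mul_comm]
    refine (two_mul_exp_add_le _ _).trans (add_le_add ?_ ?_)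
    · refine Real.exp_le_exp.2 (le_trans (le_of_eq ?_)
        (Finset.le_sup' (fun s => ∑ i, bit m i * (2 * f s (p.1 i))) hs))
      rw [Finset.mul_sum]
      exact Finset.sum_congr rfl fun i _ => by ring
    · refine Real.exp_le_exp.2 (le_trans (le_of_eq ?_)
        (Finset.le_sup' (fun s => ∑ i, bit (-m) i * (2 * f s (p.2 i))) hs))
      rw [Finset.mul_sum]
      exact Finset.sum_congr rfl fun i _ => by ring
  refine ⟨hI1, hI2, hjensen.trans ?_⟩
  have h1 : ∫ p, Real.exp (S.sup' hS fun s => ∑ i, (f s (p.1 i) - f s (p.2 i))) ∂(P.prod P) ≤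
      𝔼 m : Fin n → ℤˣ,
        ((∫ x, Real.exp (S.sup' hS fun s => ∑ i, bit m i * (2 * f s (x i))) ∂P) +
        ∫ x, Real.exp (S.sup' hS fun s => ∑ i, bit (-m) i * (2 * f s (x i))) ∂P) / 2 := by
    rw [← Fintype.expect_const (ι := Fin n → ℤˣ)
      (∫ p, Real.exp (S.sup' hS fun s => ∑ i, (f s (p.1 i) - f s (p.2 i))) ∂(P.prod P))]
    refine Finset.expect_le_expect fun m _ => ?_
    rw [hswap m]
    exact hsplit m
  refine h1.trans (le_of_eq ?_)
  rw [← Finset.expect_div, Finset.expect_add_distrib, expect_signs_neg fun m => ∫ x, Real.exp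
    (S.sup' hS fun s => ∑ i, bit m i * (2 * f s (x i))) ∂P]
  ring

end Symmetrization

/-! ### Sub-Gaussian norms -/

section Norm
variable {D : ℕ} {v : Fin D → ℝ} {T : ℝ}

/-- The square `‖y‖²` is the mean of `T² y j² / v j` with weights `v j / T²`. Convexity of powers,
applied to each term of the `cosh` series, reduces the norm to single coordinates without a
dimension factor. -/
lemma cosh_norm_le (hv : ∀ j, 0 ≤ v j) (hT : ∑ j, v j = T ^ 2) (hT0 : 0 < T)
    {y : EuclideanSpace ℝ (Fin D)} (hy : ∀ j, v j = 0 → y j = 0) (c : ℝ) :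
    Real.cosh (c * ‖y‖) ≤ ∑ j, v j / T ^ 2 * Real.cosh (c * T / √(v j) * y j) := by
  have h1 : HasSum (fun p : ℕ => ∑ j, v j / T ^ 2 *
      ((c * T / √(v j) * y j) ^ (2 * p) / ((2 * p).factorial : ℝ)))
      (∑ j, v j / T ^ 2 * Real.cosh (c * T / √(v j) * y j)) :=
    hasSum_sum fun j _ => (Real.hasSum_cosh _).mul_left _
  refine hasSum_le (fun p => ?_) (Real.hasSum_cosh (c * ‖y‖)) h1
  have h2 := Real.pow_arith_mean_le_arith_mean_pow Finset.univ (fun j => v j / T ^ 2)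
    (fun j => (c * T / √(v j) * y j) ^ 2) (fun j _ => div_nonneg (hv j) (sq_nonneg _))
    (by rw [← Finset.sum_div, hT, div_self (by positivity)]) (fun j _ => sq_nonneg _) p
  have h3 : ∑ j, v j / T ^ 2 * (c * T / √(v j) * y j) ^ 2 = (c * ‖y‖) ^ 2 := by
    rw [mul_pow, EuclideanSpace.real_norm_sq_eq, Finset.mul_sum]
    refine Finset.sum_congr rfl fun j _ => ?_
    rcases (hv j).eq_or_lt with h | h
    · simp [hy j h.symm]
    · have hs : √(v j) ^ 2 = v j := Real.sq_sqrt h.le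
      have hs0 : 0 < √(v j) := Real.sqrt_pos.2 h
      rw [mul_pow, div_pow, hs]
      field_simp
  rw [h3, ← pow_mul] at h2
  have h4 : (0 : ℝ) < ((2 * p).factorial : ℝ) := by positivity
  calc (c * ‖y‖) ^ (2 * p) / ((2 * p).factorial : ℝ)
      ≤ (∑ j, v j / T ^ 2 * ((c * T / √(v j) * y j) ^ 2) ^ p) / ((2 * p).factorial : ℝ) := by
        gcongr
    _ = _ := by
        rw [Finset.sum_div]
        exact Finset.sum_congr rfl fun j _ => by rw [← pow_mul]; ring

variable {Ω : Type*} [MeasurableSpace Ω] {P : Measure Ω}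

lemma integrable_cosh_of_mgf {f : Ω → ℝ} {w : ℝ}
    (h : ∀ t : ℝ, ∫ ω, Real.exp (t * f ω) ∂P = Real.exp (w * t ^ 2 / 2)) (t : ℝ) :
    Integrable (fun ω => Real.cosh (t * f ω)) P ∧
      ∫ ω, Real.cosh (t * f ω) ∂P = Real.exp (w * t ^ 2 / 2) := by
  -- A nonintegrable function has Bochner integral `0`, so the positive value prescribed by `h`
  -- forces integrability.
  have hi (t : ℝ) : Integrable (fun ω => Real.exp (t * f ω)) P :=
    Integrable.of_integral_ne_zero (by rw [h]; exact (Real.exp_pos _).ne')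
  have e : (fun ω => Real.cosh (t * f ω)) =
      fun ω => (Real.exp (t * f ω) + Real.exp (-t * f ω)) / 2 := by
    ext ω; rw [Real.cosh_eq, neg_mul]
  rw [e]
  refine ⟨((hi t).add (hi (-t))).div_const 2, ?_⟩
  rw [integral_div, integral_add (hi t) (hi (-t)), h, h, neg_sq]
  ring

/-- The norm of a vector with Gaussian coordinates, of variances `w * v j`, has the exponential
moments of a centered Gaussian variable of variance `w * ∑ j, v j`. -/
lemma integral_cosh_norm_le [IsProbabilityMeasure P] (hv : ∀ j, 0 ≤ v j) (hT : ∑ j, v j = T ^ 2) (hT0 : 0 < T)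
    {Y : Ω → EuclideanSpace ℝ (Fin D)} (hY : AEStronglyMeasurable Y P) {w : ℝ}
    (h : ∀ j (t : ℝ), ∫ ω, Real.exp (t * Y ω j) ∂P = Real.exp (w * v j * t ^ 2 / 2)) (c : ℝ) :
    Integrable (fun ω => Real.cosh (c * ‖Y ω‖)) P ∧
      ∫ ω, Real.cosh (c * ‖Y ω‖) ∂P ≤ Real.exp (w * c ^ 2 * T ^ 2 / 2) := by
  have hzero : ∀ᵐ ω ∂P, ∀ j, v j = 0 → Y ω j = 0 := by
    rw [ae_all_iff]
    intro j
    by_cases hj : v j = 0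
    -- A coordinate of variance zero vanishes almost surely: its `cosh` is at least `1` and has mean
    -- `1`.
    · have h1 := integrable_cosh_of_mgf (h j) 1
      have h2 : ∫ ω, (Real.cosh (1 * Y ω j) - 1) ∂P = 0 := by
        rw [integral_sub h1.1 (integrable_const _), h1.2, hj]
        simp
      rw [integral_eq_zero_iff_of_nonneg (fun ω => sub_nonneg.2 (Real.one_le_cosh _))
        (h1.1.sub (integrable_const _))] at h2
      filter_upwards [h2] with ω hω _
      by_contra hne
      have := Real.one_lt_cosh.2 hne
      simp only [one_mul, Pi.zero_apply] at hω
      linarith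
    · exact .of_forall fun ω h' => absurd h' hj
  have hdom : ∀ᵐ ω ∂P, Real.cosh (c * ‖Y ω‖) ≤
      ∑ j, v j / T ^ 2 * Real.cosh (c * T / √(v j) * Y ω j) := by
    filter_upwards [hzero] with ω hω
    exact cosh_norm_le hv hT hT0 hω c
  have hint : Integrable (fun ω => ∑ j, v j / T ^ 2 * Real.cosh (c * T / √(v j) * Y ω j)) P :=
    integrable_finsetSum _ fun j _ => (integrable_cosh_of_mgf (h j) _).1.const_mul _
  have hI : Integrable (fun ω => Real.cosh (c * ‖Y ω‖)) P := by
    refine hint.mono' ?_ ?_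
    · exact Real.continuous_cosh.comp_aestronglyMeasurable (hY.norm.const_mul c)
    · filter_upwards [hdom] with ω hω
      rwa [Real.norm_eq_abs, abs_of_pos (Real.cosh_pos _)]
  refine ⟨hI, (integral_mono_ae hI hint hdom).trans (le_of_eq ?_)⟩
  rw [integral_finsetSum _ fun j _ => (integrable_cosh_of_mgf (h j) _).1.const_mul _]
  have e (j : Fin D) : ∫ ω, v j / T ^ 2 * Real.cosh (c * T / √(v j) * Y ω j) ∂P =
      v j / T ^ 2 * Real.exp (w * c ^ 2 * T ^ 2 / 2) := by
    rw [integral_const_mul, (integrable_cosh_of_mgf (h j) _).2]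
    rcases (hv j).eq_or_lt with h | h
    · simp [← h]
    · have hs : √(v j) ^ 2 = v j := Real.sq_sqrt h.le
      congr 2
      rw [div_pow, hs]
      field_simp
  simp only [e]
  rw [← Finset.sum_mul, ← Finset.sum_div, hT, div_self (by positivity), one_mul]

end Norm

/-! ### Tail bounds -/

/-- The thresholded half-space function `(⟪u, x⟫ - b)₊`, for `s = (b, u)`. -/
noncomputable def threshold {E : Type*} [NormedAddCommGroup E] [InnerProductSpace ℝ E]
    (s : ℝ × E) (x : E) : ℝ := max (⟪s.2, x⟫ - s.1) 0

section
variable {E : Type*} [NormedAddCommGroup E] [InnerProductSpace ℝ E]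

lemma continuous_threshold : Continuous fun p : (ℝ × E) × E => threshold p.1 p.2 := by
  unfold threshold; fun_prop

lemma threshold_nonneg (s : ℝ × E) (x : E) : 0 ≤ threshold s x := le_max_right _ _

lemma abs_threshold_le {s : ℝ × E} (hs : 0 ≤ s.1 ∧ ‖s.2‖ ≤ 1) (x : E) :
    |threshold s x| ≤ ‖x‖ := by
  rw [abs_of_nonneg (threshold_nonneg s x)]
  refine max_le ?_ (norm_nonneg _)
  have h2 := real_inner_le_norm s.2 x
  have h3 := hs.2
  have h4 := hs.1
  nlinarith [norm_nonneg x]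

end

section
variable {D : ℕ} {v : Fin D → ℝ} {T : ℝ} {μ : Measure (EuclideanSpace ℝ (Fin D))}
  [IsProbabilityMeasure μ] {n : ℕ}

lemma integrable_exp_norm_of_mgf (hv : ∀ j, 0 ≤ v j) (hT : ∑ j, v j = T ^ 2) (hT0 : 0 < T)
    (hμ : ∀ j (t : ℝ), ∫ x, Real.exp (t * x j) ∂μ = Real.exp (v j * t ^ 2 / 2)) (c : ℝ) :
    Integrable (fun x => Real.exp (c * ‖x‖)) μ := by
  have h := (integral_cosh_norm_le hv hT hT0 (P := μ) (Y := fun x => x) (w := 1)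
    (by fun_prop) (fun j t => by rw [hμ, one_mul]) c).1
  refine (h.const_mul 2).mono' (by fun_prop) (.of_forall fun x => ?_)
  rw [Real.norm_eq_abs, Real.abs_exp, Real.cosh_eq]
  linarith [Real.exp_pos (-(c * ‖x‖))]

lemma integral_cosh_norm_sum_le (hv : ∀ j, 0 ≤ v j) (hT : ∑ j, v j = T ^ 2) (hT0 : 0 < T)
    (hμ : ∀ j (t : ℝ), ∫ x, Real.exp (t * x j) ∂μ = Real.exp (v j * t ^ 2 / 2))
    (m : Fin n → ℤˣ) (c : ℝ) :
    Integrable (fun x : Fin n → EuclideanSpace ℝ (Fin D) =>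
      Real.cosh (c * ‖∑ i, bit m i • x i‖)) (Measure.pi fun _ => μ) ∧
    ∫ x : Fin n → EuclideanSpace ℝ (Fin D), Real.cosh (c * ‖∑ i, bit m i • x i‖)
      ∂(Measure.pi fun _ => μ) ≤ Real.exp (n * c ^ 2 * T ^ 2 / 2) := by
  refine integral_cosh_norm_le hv hT hT0 (Continuous.aestronglyMeasurable (by fun_prop))
    (fun j t => ?_) c
  have e (x : Fin n → EuclideanSpace ℝ (Fin D)) :
      Real.exp (t * (∑ i, bit m i • x i) j) = ∏ i, Real.exp (t * bit m i * x i j) := by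
    rw [← Real.exp_sum]
    congr 1
    simp only [WithLp.ofLp_sum, Finset.sum_apply, PiLp.smul_apply, smul_eq_mul, Finset.mul_sum]
    exact Finset.sum_congr rfl fun i _ => by ring
  simp only [e]
  rw [integral_fintype_prod_eq_prod (μ := fun _ : Fin n => μ)
    (f := fun i (x : EuclideanSpace ℝ (Fin D)) => Real.exp (t * bit m i * x j))]
  simp only [hμ]
  rw [← Real.exp_sum]
  congr 1
  have e2 (i : Fin n) : v j * (t * bit m i) ^ 2 / 2 = v j * t ^ 2 / 2 := by
    rw [mul_pow, sq (bit m i), bit_mul_self, mul_one]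
  simp only [e2, Finset.sum_const, Finset.card_univ, Fintype.card_fin, nsmul_eq_mul]
  ring

lemma integral_prod_cosh_norm_le (hv : ∀ j, 0 ≤ v j) (hT : ∑ j, v j = T ^ 2) (hT0 : 0 < T)
    (hμ : ∀ j (t : ℝ), ∫ x, Real.exp (t * x j) ∂μ = Real.exp (v j * t ^ 2 / 2)) (c : ℝ) :
    Integrable (fun x : Fin n → EuclideanSpace ℝ (Fin D) => ∏ i, Real.cosh (c * ‖x i‖))
      (Measure.pi fun _ => μ) ∧
    ∫ x : Fin n → EuclideanSpace ℝ (Fin D), ∏ i, Real.cosh (c * ‖x i‖)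
      ∂(Measure.pi fun _ => μ) ≤ Real.exp (n * c ^ 2 * T ^ 2 / 2) := by
  have h := integral_cosh_norm_le hv hT hT0 (P := μ) (Y := fun x => x) (w := 1)
    (by fun_prop) (fun j t => by rw [hμ, one_mul]) c
  refine ⟨Integrable.fintype_prod (μ := fun _ : Fin n => μ)
    (f := fun _ x => Real.cosh (c * ‖x‖)) fun _ => h.1, ?_⟩
  rw [integral_fintype_prod_eq_prod (μ := fun _ : Fin n => μ)
    (f := fun _ (x : EuclideanSpace ℝ (Fin D)) => Real.cosh (c * ‖x‖)), Finset.prod_const,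
    Finset.card_univ, Fintype.card_fin]
  refine (pow_le_pow_left₀ (integral_nonneg fun _ => (Real.cosh_pos _).le) h.2 n).trans
    (le_of_eq ?_)
  rw [← Real.exp_nat_mul]
  congr 1; ring

/-- Exponential moments of the one-sided suprema of the centered empirical process. -/
lemma integral_exp_sup_threshold_le (hv : ∀ j, 0 ≤ v j) (hT : ∑ j, v j = T ^ 2) (hT0 : 0 < T)
    (hμ : ∀ j (t : ℝ), ∫ x, Real.exp (t * x j) ∂μ = Real.exp (v j * t ^ 2 / 2))
    {S : Finset (ℝ × EuclideanSpace ℝ (Fin D))} (hS : S.Nonempty)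
    (hS0 : ∀ s ∈ S, 0 ≤ s.1 ∧ ‖s.2‖ ≤ 1) (θ : ℤˣ) {c : ℝ} (hc : 0 ≤ c) :
    Integrable (fun x : Fin n → EuclideanSpace ℝ (Fin D) => Real.exp (S.sup' hS fun s =>
      ∑ i, ((θ : ℤ) * c * threshold s (x i) - ∫ y, (θ : ℤ) * c * threshold s y ∂μ)))
        (Measure.pi fun _ => μ) ∧
    ∫ x : Fin n → EuclideanSpace ℝ (Fin D), Real.exp (S.sup' hS fun s =>
      ∑ i, ((θ : ℤ) * c * threshold s (x i) - ∫ y, (θ : ℤ) * c * threshold s y ∂μ))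
        ∂(Measure.pi fun _ => μ) ≤ 5 / 2 * Real.exp (8 * n * c ^ 2 * T ^ 2) := by
  have hθ : |((θ : ℤ) : ℝ)| = 1 := by
    rcases Int.units_eq_one_or θ with h | h <;> simp [h]
  obtain ⟨h1, h2, h3⟩ := integral_exp_sup_centered_le (n := n) hS
    (f := fun s x => (θ : ℤ) * c * threshold s x) (C := c)
    (integrable_exp_norm_of_mgf hv hT hT0 hμ)
    (fun s _ => continuous_const.mul (continuous_threshold.comp
      (by fun_prop : Continuous fun y : EuclideanSpace ℝ (Fin D) => (s, y))))
    (fun s hs x => by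
      rw [abs_mul, abs_mul, hθ, one_mul, abs_of_nonneg hc]
      exact mul_le_mul_of_nonneg_left (abs_threshold_le (hS0 s hs) x) hc)
  refine ⟨h1, h3.trans ?_⟩
  have hsw : (𝔼 m : Fin n → ℤˣ, ∫ x : Fin n → EuclideanSpace ℝ (Fin D), Real.exp (S.sup' hS
      fun s => ∑ i, bit m i * (2 * ((θ : ℤ) * c * threshold s (x i)))) ∂(Measure.pi fun _ => μ)) =
      ∫ x : Fin n → EuclideanSpace ℝ (Fin D), 𝔼 m : Fin n → ℤˣ, Real.exp (S.sup' hS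
      fun s => ∑ i, bit m i * (2 * ((θ : ℤ) * c * threshold s (x i)))) ∂(Measure.pi fun _ => μ) := by
    simp only [Fintype.expect_eq_sum_div_card]
    rw [integral_div, integral_finsetSum _ fun m _ => h2 m]
  rw [hsw]
  have hpt (x : Fin n → EuclideanSpace ℝ (Fin D)) : 𝔼 m : Fin n → ℤˣ, Real.exp (S.sup' hS
      fun s => ∑ i, bit m i * (2 * ((θ : ℤ) * c * threshold s (x i)))) ≤
      (𝔼 m : Fin n → ℤˣ, Real.cosh (4 * c * ‖∑ i, bit m i • x i‖)) +
        3 / 2 * ∏ i, Real.cosh (4 * c * ‖x i‖) := by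
    have h4 := expect_exp_sup_threshold_le hS hS0 x (c := 2 * c) (by positivity)
    rw [show 2 * (2 * c) = 4 * c by ring] at h4
    refine le_trans (le_of_eq ?_) h4
    rcases Int.units_eq_one_or θ with h | h
    · refine Finset.expect_congr rfl fun m _ => ?_
      congr 2
      ext s
      refine Finset.sum_congr rfl fun i _ => ?_
      simp only [h, threshold, Units.val_one, Int.cast_one]; ring
    · rw [← expect_signs_neg fun m : Fin n → ℤˣ => Real.exp (S.sup' hS fun s =>
        ∑ i, bit m i * (2 * c * max (⟪s.2, x i⟫ - s.1) 0))]
      refine Finset.expect_congr rfl fun m _ => ?_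
      congr 2
      ext s
      refine Finset.sum_congr rfl fun i _ => ?_
      simp only [h, threshold, Units.val_one, Units.val_neg, Int.cast_neg, Int.cast_one, bit_neg]
      ring
  have hi1 (m : Fin n → ℤˣ) := integral_cosh_norm_sum_le (n := n) hv hT hT0 hμ m (4 * c)
  have hi2 := integral_prod_cosh_norm_le (n := n) hv hT hT0 hμ (4 * c)
  have hI1 : Integrable (fun x : Fin n → EuclideanSpace ℝ (Fin D) => 𝔼 m : Fin n → ℤˣ,
      Real.exp (S.sup' hS fun s => ∑ i, bit m i * (2 * ((θ : ℤ) * c * threshold s (x i)))))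
      (Measure.pi fun _ => μ) := by
    simp only [Fintype.expect_eq_sum_div_card]
    exact (integrable_finsetSum _ fun m _ => h2 m).div_const _
  have hI2 : Integrable (fun x : Fin n → EuclideanSpace ℝ (Fin D) => 𝔼 m : Fin n → ℤˣ,
      Real.cosh (4 * c * ‖∑ i, bit m i • x i‖)) (Measure.pi fun _ => μ) := by
    simp only [Fintype.expect_eq_sum_div_card]
    exact (integrable_finsetSum _ fun m _ => (hi1 m).1).div_const _
  refine (integral_mono hI1 (hI2.add (hi2.1.const_mul _)) hpt).trans ?_
  have e1 : ∫ x : Fin n → EuclideanSpace ℝ (Fin D), 𝔼 m : Fin n → ℤˣ,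
      Real.cosh (4 * c * ‖∑ i, bit m i • x i‖) ∂(Measure.pi fun _ => μ) ≤
      Real.exp (n * (4 * c) ^ 2 * T ^ 2 / 2) := by
    have e2 : ∫ x : Fin n → EuclideanSpace ℝ (Fin D), 𝔼 m : Fin n → ℤˣ,
      Real.cosh (4 * c * ‖∑ i, bit m i • x i‖) ∂(Measure.pi fun _ => μ) = 𝔼 m : Fin n → ℤˣ,
      ∫ x : Fin n → EuclideanSpace ℝ (Fin D),
        Real.cosh (4 * c * ‖∑ i, bit m i • x i‖) ∂(Measure.pi fun _ => μ) := by
      simp only [Fintype.expect_eq_sum_div_card]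
      rw [integral_div, integral_finsetSum _ fun m _ => (hi1 m).1]
    rw [e2]
    refine (Finset.expect_le_expect fun m _ => (hi1 m).2).trans (le_of_eq ?_)
    exact Fintype.expect_const _
  simp only [Pi.add_apply]
  rw [integral_add hI2 (hi2.1.const_mul _), integral_const_mul]
  have e3 : Real.exp (n * (4 * c) ^ 2 * T ^ 2 / 2) = Real.exp (8 * n * c ^ 2 * T ^ 2) := by
    congr 1; ring
  have e4 := hi2.2
  rw [e3] at e1 e4
  linarith

lemma measureReal_threshold_le (hv : ∀ j, 0 ≤ v j) (hT : ∑ j, v j = T ^ 2) (hT0 : 0 < T)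
    (hμ : ∀ j (t : ℝ), ∫ x, Real.exp (t * x j) ∂μ = Real.exp (v j * t ^ 2 / 2))
    {S : Finset (ℝ × EuclideanSpace ℝ (Fin D))}
    (hS0 : ∀ s ∈ S, 0 ≤ s.1 ∧ ‖s.2‖ ≤ 1) (θ : ℤˣ) (hn : 0 < n) {a : ℝ} (ha : 0 < a) :
    (Measure.pi fun _ : Fin n => μ).real {x | ∃ s ∈ S,
      a ≤ (θ : ℤ) * ∑ i, (threshold s (x i) - ∫ y, threshold s y ∂μ)} ≤
      5 / 2 * Real.exp (-(a ^ 2 / (32 * n * T ^ 2))) := by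
  rcases S.eq_empty_or_nonempty with rfl | hS
  · simp; positivity
  have hn' : (0 : ℝ) < n := by positivity
  -- The minimizer of the Chernoff exponent `-c a + 8 n c² T²`.
  set c := a / (16 * n * T ^ 2) with hc
  have hc0 : 0 < c := by positivity
  obtain ⟨h1, h2⟩ := integral_exp_sup_threshold_le (n := n) hv hT hT0 hμ hS hS0 θ hc0.le
  have h3 := mul_meas_ge_le_integral_of_nonneg
    (.of_forall fun x => (Real.exp_pos _).le) h1 (Real.exp (c * a))
  set Q := (Measure.pi fun _ : Fin n => μ) with hQ
  have hsub : {x : Fin n → EuclideanSpace ℝ (Fin D) | ∃ s ∈ S,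
      a ≤ (θ : ℤ) * ∑ i, (threshold s (x i) - ∫ y, threshold s y ∂μ)} ⊆
      {x | Real.exp (c * a) ≤ Real.exp (S.sup' hS fun s =>
      ∑ i, ((θ : ℤ) * c * threshold s (x i) - ∫ y, (θ : ℤ) * c * threshold s y ∂μ))} := by
    rintro x ⟨s, hs, hx⟩
    refine Real.exp_le_exp.2 (le_trans ?_ (Finset.le_sup' (fun s =>
      ∑ i, ((θ : ℤ) * c * threshold s (x i) - ∫ y, (θ : ℤ) * c * threshold s y ∂μ)) hs))
    have e : ∑ i, ((θ : ℤ) * c * threshold s (x i) - ∫ y, (θ : ℤ) * c * threshold s y ∂μ) =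
        c * ((θ : ℤ) * ∑ i, (threshold s (x i) - ∫ y, threshold s y ∂μ)) := by
      rw [integral_const_mul, Finset.mul_sum, Finset.mul_sum]
      exact Finset.sum_congr rfl fun i _ => by ring
    rw [e]
    exact mul_le_mul_of_nonneg_left hx hc0.le
  have h4 : Q.real {x | ∃ s ∈ S, a ≤ (θ : ℤ) * ∑ i, (threshold s (x i) -
      ∫ y, threshold s y ∂μ)} ≤ Real.exp (-(c * a)) * (5 / 2 * Real.exp (8 * n * c ^ 2 * T ^ 2)) := by
    refine (measureReal_mono hsub).trans ?_
    rw [Real.exp_neg, inv_mul_eq_div, le_div_iff₀ (Real.exp_pos _), mul_comm]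
    exact h3.trans h2
  refine h4.trans (le_of_eq ?_)
  rw [mul_left_comm, ← Real.exp_add]
  congr 2
  rw [hc]
  field_simp
  ring

lemma measureReal_norm_sum_le (hv : ∀ j, 0 ≤ v j) (hT : ∑ j, v j = T ^ 2) (hT0 : 0 < T)
    (hμ : ∀ j (t : ℝ), ∫ x, Real.exp (t * x j) ∂μ = Real.exp (v j * t ^ 2 / 2))
    (hn : 0 < n) {a : ℝ} (ha : 0 < a) :
    (Measure.pi fun _ : Fin n => μ).real {x | a ≤ ‖∑ i, x i‖} ≤
      2 * Real.exp (-(a ^ 2 / (2 * n * T ^ 2))) := by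
  have hn' : (0 : ℝ) < n := by positivity
  -- The minimizer of `-c a + n c² T² / 2`.
  set c := a / (n * T ^ 2) with hc
  have hc0 : 0 < c := by positivity
  obtain ⟨h1, h2⟩ := integral_cosh_norm_sum_le (n := n) hv hT hT0 hμ 1 c
  have h3 := mul_meas_ge_le_integral_of_nonneg
    (.of_forall fun x => (Real.cosh_pos _).le) h1 (Real.exp (c * a) / 2)
  set Q := (Measure.pi fun _ : Fin n => μ) with hQ
  have hsub : {x : Fin n → EuclideanSpace ℝ (Fin D) | a ≤ ‖∑ i, x i‖} ⊆
      {x | Real.exp (c * a) / 2 ≤ Real.cosh (c * ‖∑ i, bit (1 : Fin n → ℤˣ) i • x i‖)} := by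
    intro x hx
    have hx' : a ≤ ‖∑ i, x i‖ := hx
    have e : ∑ i, bit (1 : Fin n → ℤˣ) i • x i = ∑ i, x i := by simp [bit]
    show Real.exp (c * a) / 2 ≤ Real.cosh (c * ‖∑ i, bit (1 : Fin n → ℤˣ) i • x i‖)
    rw [e, Real.cosh_eq]
    have h5 : Real.exp (c * a) ≤ Real.exp (c * ‖∑ i, x i‖) :=
      Real.exp_le_exp.2 (mul_le_mul_of_nonneg_left hx' hc0.le)
    linarith [Real.exp_pos (-(c * ‖∑ i, x i‖))]
  have h4 : Q.real {x | a ≤ ‖∑ i, x i‖} ≤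
      Real.exp (-(c * a)) * (2 * Real.exp (n * c ^ 2 * T ^ 2 / 2)) := by
    refine (measureReal_mono hsub).trans ?_
    rw [Real.exp_neg, inv_mul_eq_div, le_div_iff₀ (Real.exp_pos _)]
    have := h3.trans h2
    linarith
  refine h4.trans (le_of_eq ?_)
  rw [mul_left_comm, ← Real.exp_add]
  congr 2
  rw [hc]
  field_simp
  ring

/-- With the asserted probability, the empirical process over all thresholded half-spaces and
the norm of the sum of the sample are bounded. -/
lemma le_measure_forall_threshold_le (hv : ∀ j, 0 ≤ v j) (hT : ∑ j, v j = T ^ 2) (hT0 : 0 < T)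
    (hμ : ∀ j (t : ℝ), ∫ x, Real.exp (t * x j) ∂μ = Real.exp (v j * t ^ 2 / 2))
    (hn : 0 < n) {a a' δ : ℝ} (ha : 0 < a) (ha' : 0 < a')
    (hδ : 5 * Real.exp (-(a ^ 2 / (32 * n * T ^ 2))) +
      2 * Real.exp (-(a' ^ 2 / (2 * n * T ^ 2))) ≤ δ) :
    ENNReal.ofReal (1 - δ) ≤ (Measure.pi fun _ : Fin n => μ)
      {x | (∀ s : ℝ × EuclideanSpace ℝ (Fin D), 0 ≤ s.1 ∧ ‖s.2‖ ≤ 1 →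
        |∑ i, (threshold s (x i) - ∫ y, threshold s y ∂μ)| ≤ a) ∧ ‖∑ i, x i‖ ≤ a'} := by
  set Q := (Measure.pi fun _ : Fin n => μ) with hQ
  let A : Set (ℝ × EuclideanSpace ℝ (Fin D)) := {s | 0 ≤ s.1 ∧ ‖s.2‖ ≤ 1}
  have : Nonempty A := ⟨⟨0, le_rfl, by simp⟩⟩
  -- The empirical process is continuous in the parameter, so finite initial pieces of a dense
  -- sequence suffice: their bad events increase, with a bound independent of the piece.
  let e : ℕ → A := TopologicalSpace.denseSeq A
  have he : DenseRange e := TopologicalSpace.denseRange_denseSeq A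
  let g : (Fin n → EuclideanSpace ℝ (Fin D)) → A → ℝ := fun x s =>
    ∑ i, (threshold s.1 (x i) - ∫ y, threshold s.1 y ∂μ)
  have hnorm : Integrable (fun x : EuclideanSpace ℝ (Fin D) => ‖x‖) μ := by
    refine (integrable_exp_norm_of_mgf hv hT hT0 hμ 1).mono' (by fun_prop) (.of_forall fun x => ?_)
    simp only [norm_norm, one_mul]
    linarith [Real.add_one_le_exp ‖x‖]
  have hEc : Continuous fun s : A => ∫ y, threshold s.1 y ∂μ := by
    refine continuous_of_dominated (bound := fun y => ‖y‖) (fun s : A => ?_)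
      (fun s : A => .of_forall fun y => abs_threshold_le s.2 y) hnorm (.of_forall fun y => ?_)
    · exact (continuous_threshold.comp (by fun_prop : Continuous fun y => (s.1, y))).aestronglyMeasurable
    · exact continuous_threshold.comp (continuous_subtype_val.prodMk continuous_const)
  have hgc (x : Fin n → EuclideanSpace ℝ (Fin D)) : Continuous (g x) := by
    refine continuous_finsetSum _ fun i _ => Continuous.sub ?_ hEc
    exact continuous_threshold.comp (continuous_subtype_val.prodMk continuous_const)
  let Bd : ℕ → Set (Fin n → EuclideanSpace ℝ (Fin D)) := fun N =>
    {x | (∃ k < N, a ≤ |g x (e k)|) ∨ a' ≤ ‖∑ i, x i‖}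
  have hBdmono : Monotone Bd := by
    intro N N' h x hx
    rcases hx with ⟨k, hk, hx⟩ | hx
    · exact Or.inl ⟨k, hk.trans_le h, hx⟩
    · exact Or.inr hx
  have hBd (N : ℕ) : Q (Bd N) ≤ ENNReal.ofReal δ := by
    classical
    set S : Finset (ℝ × EuclideanSpace ℝ (Fin D)) :=
      (Finset.range N).image fun k => (e k).1 with hS
    have hS0 : ∀ s ∈ S, 0 ≤ s.1 ∧ ‖s.2‖ ≤ 1 := by
      intro s hs
      obtain ⟨k, -, rfl⟩ := Finset.mem_image.1 hs
      exact (e k).2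
    have hsub : Bd N ⊆ ({x | ∃ s ∈ S, a ≤ (((1 : ℤˣ) : ℤ) : ℝ) *
        ∑ i, (threshold s (x i) - ∫ y, threshold s y ∂μ)} ∪
        {x | ∃ s ∈ S, a ≤ (((-1 : ℤˣ) : ℤ) : ℝ) *
        ∑ i, (threshold s (x i) - ∫ y, threshold s y ∂μ)}) ∪ {x | a' ≤ ‖∑ i, x i‖} := by
      rintro x (⟨k, hk, hx⟩ | hx)
      · left
        have hkS : (e k).1 ∈ S := Finset.mem_image_of_mem _ (Finset.mem_range.2 hk)
        rcases le_abs.1 hx with h | h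
        · exact Or.inl ⟨_, hkS, by
            rw [Units.val_one, Int.cast_one, one_mul]; exact h⟩
        · exact Or.inr ⟨_, hkS, by
            rw [Units.val_neg, Units.val_one, Int.cast_neg, Int.cast_one, neg_mul, one_mul]
            exact h⟩
      · exact Or.inr hx
    have h1 := measureReal_threshold_le (n := n) hv hT hT0 hμ hS0 1 hn ha
    have h2 := measureReal_threshold_le (n := n) hv hT hT0 hμ hS0 (-1) hn ha
    have h3 := measureReal_norm_sum_le (n := n) hv hT hT0 hμ hn ha'
    have h4 : Q.real (Bd N) ≤ δ := by
      refine (measureReal_mono hsub).trans ((measureReal_union_le _ _).trans ?_)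
      refine (add_le_add (measureReal_union_le _ _) le_rfl).trans ?_
      linarith
    rw [← ENNReal.ofReal_toReal (measure_ne_top Q (Bd N))]
    exact ENNReal.ofReal_le_ofReal h4
  have hBdU : Q (⋃ N, Bd N) ≤ ENNReal.ofReal δ := by
    rw [hBdmono.measure_iUnion]
    exact iSup_le hBd
  set G := {x : Fin n → EuclideanSpace ℝ (Fin D) |
    (∀ s : ℝ × EuclideanSpace ℝ (Fin D), 0 ≤ s.1 ∧ ‖s.2‖ ≤ 1 →
        |∑ i, (threshold s (x i) - ∫ y, threshold s y ∂μ)| ≤ a) ∧ ‖∑ i, x i‖ ≤ a'} with hG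
  -- Covering the whole space and using subadditivity avoids any measurability of `G`.
  have hcover : (univ : Set (Fin n → EuclideanSpace ℝ (Fin D))) ⊆ (⋃ N, Bd N) ∪ G := by
    intro x _
    by_cases hx : x ∈ ⋃ N, Bd N
    · exact Or.inl hx
    · right
      have hx' (N : ℕ) : x ∉ Bd N := fun h => hx (mem_iUnion.2 ⟨N, h⟩)
      refine ⟨fun s hs => ?_, ?_⟩
      · have hclosed : IsClosed {s : A | |g x s| ≤ a} :=
          isClosed_le (hgc x).abs continuous_const
        have hall : ∀ s : A, |g x s| ≤ a := by
          refine fun s => he.induction_on (p := fun s => |g x s| ≤ a) s hclosed fun k => ?_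
          by_contra h
          exact hx' (k + 1) (Or.inl ⟨k, Nat.lt_succ_self k, (not_le.1 h).le⟩)
        exact hall ⟨s, hs⟩
      · by_contra h
        exact hx' 0 (Or.inr (not_le.1 h).le)
  have h5 : 1 ≤ ENNReal.ofReal δ + Q G := by
    calc (1 : ENNReal) = Q univ := measure_univ.symm
      _ ≤ Q ((⋃ N, Bd N) ∪ G) := measure_mono hcover
      _ ≤ Q (⋃ N, Bd N) + Q G := measure_union_le _ _
      _ ≤ _ := add_le_add hBdU le_rfl
  have hδ0 : 0 ≤ δ := le_trans (by positivity) hδ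
  rw [ENNReal.ofReal_sub 1 hδ0, ENNReal.ofReal_one]
  exact tsub_le_iff_left.2 h5

end

/-! ### The logistic loss as a mixture of hinges -/

section
open Filter Topology

lemma logit_eq (t : ℝ) : logit t = Real.exp (-t) * (1 + Real.exp (-t))⁻¹ := by
  unfold logit
  rw [Real.exp_neg]
  have := Real.exp_pos t
  field_simp
  ring

lemma tendsto_exp_neg_atTop : Tendsto (fun t : ℝ => Real.exp (-t)) atTop (𝓝 0) :=
  Real.tendsto_exp_atBot.comp tendsto_neg_atTop_atBot

lemma tendsto_sub_mul_logit (y : ℝ) :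
    Tendsto (fun t => (t - y) * logit t) atTop (𝓝 0) := by
  have h1 := Real.tendsto_pow_mul_exp_neg_atTop_nhds_zero 1
  have h2 := (h1.sub (tendsto_exp_neg_atTop.const_mul y)).mul
    ((tendsto_exp_neg_atTop.const_add 1).inv₀ (by norm_num))
  simp only [mul_zero, sub_zero, zero_mul] at h2
  refine h2.congr fun t => ?_
  rw [logit_eq]; ring

lemma tendsto_logit : Tendsto logit atTop (𝓝 0) := by
  have h2 := tendsto_exp_neg_atTop.mul ((tendsto_exp_neg_atTop.const_add 1).inv₀ (by norm_num))
  simp only [zero_mul] at h2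
  exact h2.congr fun t => (logit_eq t).symm

lemma tendsto_logistic : Tendsto logistic atTop (𝓝 0) := by
  have h := (tendsto_exp_neg_atTop.const_add 1).log (by norm_num)
  rw [add_zero, Real.log_one] at h
  exact h

lemma logitVar_neg (t : ℝ) : logitVar (-t) = logitVar t := by
  unfold logitVar logit
  rw [Real.exp_neg]
  have := Real.exp_pos t
  field_simp
  ring

lemma integral_logitVar : ∫ t, logitVar t = 1 := by
  have e (t : ℝ) : logitVar t = logitVar |t| := by
    rcases abs_choice t with h | h <;> rw [h]
    rw [logitVar_neg]
  calc ∫ t, logitVar t = ∫ t, logitVar |t| := integral_congr_ae (.of_forall e)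
    _ = 2 * ∫ t in Ioi (0 : ℝ), logitVar t := integral_comp_abs
    _ = 1 := by
      rw [integral_Ioi_of_hasDerivAt_of_nonneg' (g := fun t => -logit t) (l := 0)
        (fun t _ => (hasDerivAt_logit t).neg.congr_deriv (by unfold logitVar; ring))
        (fun t _ => (logitVar_pos t).le) (by simpa using tendsto_logit.neg)]
      simp [logit]; norm_num

lemma integrable_logitVar : Integrable logitVar :=
  Integrable.of_integral_ne_zero (by rw [integral_logitVar]; norm_num)

/-- Integration by parts twice, `logitVar` being the second derivative of the logistic loss, which
tends to `0` at `+∞`. -/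
lemma integral_max_mul_logitVar (y : ℝ) :
    Integrable (fun s => max (s - y) 0 * logitVar s) ∧
      ∫ s, max (s - y) 0 * logitVar s = logistic y := by
  have hderiv (t : ℝ) : HasDerivAt (fun t => -((t - y) * logit t) - logistic t)
      ((t - y) * logitVar t) t := by
    refine ((((hasDerivAt_id t).sub_const y).mul (hasDerivAt_logit t)).neg.sub
      (hasDerivAt_logistic t)).congr_deriv ?_
    simp only [logitVar, id]; ring
  have hlim : Tendsto (fun t => -((t - y) * logit t) - logistic t) atTop (𝓝 0) := by
    simpa using (tendsto_sub_mul_logit y).neg.sub tendsto_logistic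
  have hnn (t : ℝ) (ht : t ∈ Ioi y) : 0 ≤ (t - y) * logitVar t :=
    mul_nonneg (sub_nonneg.2 (le_of_lt ht)) (logitVar_pos t).le
  have hI := integrableOn_Ioi_deriv_of_nonneg' (fun t _ => hderiv t) hnn hlim
  have hval := integral_Ioi_of_hasDerivAt_of_nonneg' (fun t _ => hderiv t) hnn hlim
  have hcongr : EqOn (fun s => max (s - y) 0 * logitVar s) (fun s => (s - y) * logitVar s)
      (Ioi y) := fun s hs => by
    simp only [max_eq_left (sub_nonneg.2 (le_of_lt (mem_Ioi.1 hs)))]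
  have hzero (s : ℝ) (hs : s ∉ Ioi y) : max (s - y) 0 * logitVar s = 0 := by
    rw [max_eq_right (sub_nonpos.2 (not_lt.1 hs)), zero_mul]
  refine ⟨?_, ?_⟩
  · rw [← integrableOn_iff_integrable_of_support_subset (s := Ioi y)
      (fun s hs => by_contra fun h => hs (hzero s h))]
    exact hI.congr_fun hcongr.symm measurableSet_Ioi
  · rw [← setIntegral_eq_integral_of_forall_compl_eq_zero hzero,
      setIntegral_congr_fun measurableSet_Ioi hcongr, hval]
    simp

end

/-! ### Moment generating functions of an image -/

section
variable {D d : ℕ} (B : Matrix (Fin D) (Fin d) ℝ) {SZ : Matrix (Fin d) (Fin d) ℝ} {σ : ℝ}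

lemma integral_exp_mul_gaussianReal (s t : ℝ) :
    ∫ z, Real.exp (t * (s * z)) ∂gaussianReal 0 1 = Real.exp (s ^ 2 * t ^ 2 / 2) := by
  have h := mgf_gaussianReal (p := gaussianReal 0 1) (X := id) (μ := 0) (v := 1)
    (by simp) (t * s)
  simp only [mgf, id, zero_mul, zero_add, NNReal.coe_one, one_mul] at h
  simp only [← mul_assoc, h]
  congr 1; ring

lemma integral_exp_mul_inner_imageLaw (hSZ : SZ.PosSemidef) (hσ : 0 ≤ σ)
    (u : EuclideanSpace ℝ (Fin D)) (t : ℝ) :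
    ∫ x, Real.exp (t * ⟪u, x⟫) ∂imageLaw B SZ σ =
      Real.exp ((signalStd B SZ u ^ 2 + (σ * ‖u‖) ^ 2) * t ^ 2 / 2) := by
  rw [integral_comp_inner_imageLaw B SZ σ (F := fun y => Real.exp (t * y)) (by fun_prop)]
  simp only [mul_add, Real.exp_add]
  rw [integral_prod_mul (f := fun z => Real.exp (t *
      ⟪LinearMap.adjoint (Matrix.toEuclideanLin B) u, z⟫)) (g := fun e => Real.exp (t * ⟪u, e⟫)),
    ← integral_map (φ := fun z => ⟪LinearMap.adjoint (Matrix.toEuclideanLin B) u, z⟫)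
      (f := fun y => Real.exp (t * y)) (by fun_prop) (by fun_prop),
    ← integral_map (φ := fun z => ⟪u, z⟫)
      (f := fun y => Real.exp (t * y)) (by fun_prop) (by fun_prop),
    map_inner_multivariateGaussian hSZ, map_inner_multivariateGaussian (posSemidef_noise σ),
    integral_map (by fun_prop) (by fun_prop), integral_map (by fun_prop) (by fun_prop),
    sqrt_noise σ hσ, integral_exp_mul_gaussianReal, integral_exp_mul_gaussianReal,
    ← Real.exp_add, signalStd]
  congr 1; ring

lemma integral_inner_imageLaw (hSZ : SZ.PosSemidef) (u : EuclideanSpace ℝ (Fin D)) : ∫ x, ⟪u, x⟫ ∂imageLaw B SZ σ = 0 := by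
  have hz {m : ℕ} {S : Matrix (Fin m) (Fin m) ℝ} (hS : S.PosSemidef)
      (v : EuclideanSpace ℝ (Fin m)) : ∫ z, ⟪v, z⟫ ∂multivariateGaussian 0 S = 0 := by
    rw [← integral_map (φ := fun z => ⟪v, z⟫) (f := fun y : ℝ => y) (by fun_prop) (by fun_prop),
      map_inner_multivariateGaussian hS, integral_map (by fun_prop) (by fun_prop),
      integral_const_mul, integral_id_gaussianReal, mul_zero]
  rw [integral_comp_inner_imageLaw B SZ σ (F := fun y => y) (by fun_prop)]
  have hi1 : Integrable (fun z : EuclideanSpace ℝ (Fin d) =>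
      ⟪LinearMap.adjoint (Matrix.toEuclideanLin B) u, z⟫) (multivariateGaussian 0 SZ) :=
    (innerSL ℝ (LinearMap.adjoint (Matrix.toEuclideanLin B) u)).integrable_comp
      IsGaussian.integrable_id
  have hi2 : Integrable (fun z : EuclideanSpace ℝ (Fin D) => ⟪u, z⟫)
      (multivariateGaussian 0 (σ ^ 2 • (1 : Matrix (Fin D) (Fin D) ℝ))) :=
    (innerSL ℝ u).integrable_comp IsGaussian.integrable_id
  rw [integral_add (hi1.comp_fst _) (hi2.comp_snd _), integral_fun_fst, integral_fun_snd, hz hSZ,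
    hz (posSemidef_noise σ)]
  simp

open Matrix in
lemma adjoint_toEuclideanLin_single (j : Fin D) :
    (LinearMap.adjoint (Matrix.toEuclideanLin B) (EuclideanSpace.single j 1) : Fin d → ℝ) =
      B j := by
  ext i
  have h := LinearMap.adjoint_inner_right (Matrix.toEuclideanLin B) (EuclideanSpace.single i 1)
    (EuclideanSpace.single j (1 : ℝ))
  simp only [EuclideanSpace.inner_single_left, EuclideanSpace.inner_single_right] at h
  simpa [Matrix.toLpLin_apply] using h

open Matrix in
lemma imageCov_apply_self (j : Fin D) : imageCov B SZ σ j j = B j ⬝ᵥ SZ *ᵥ B j + σ ^ 2 := by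
  simp only [imageCov, Matrix.add_apply, Matrix.smul_apply, Matrix.one_apply_eq, smul_eq_mul,
    mul_one, Matrix.mul_assoc]
  rfl

lemma integral_exp_mul_apply_imageLaw (hSZ : SZ.PosSemidef) (hσ : 0 ≤ σ) (j : Fin D) (t : ℝ) :
    ∫ x, Real.exp (t * x j) ∂imageLaw B SZ σ = Real.exp (imageCov B SZ σ j j * t ^ 2 / 2) := by
  have h := integral_exp_mul_inner_imageLaw B hSZ hσ (EuclideanSpace.single j 1) t
  rw [signalStd, adjoint_toEuclideanLin_single, Real.sq_sqrt] at h
  · simpa [EuclideanSpace.inner_single_left, imageCov_apply_self] using h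
  · simpa using hSZ.dotProduct_mulVec_nonneg (B j)

lemma imageCov_apply_self_nonneg (hSZ : SZ.PosSemidef) (j : Fin D) :
    0 ≤ imageCov B SZ σ j j := by
  rw [imageCov_apply_self]
  have := hSZ.dotProduct_mulVec_nonneg (B j)
  simp only [star_trivial] at this
  positivity

lemma trace_imageCov_pos (hSZ : SZ.PosDef) (hB : B ≠ 0) : 0 < (imageCov B SZ σ).trace := by
  obtain ⟨j, hj⟩ : ∃ j, B j ≠ 0 := Function.ne_iff.1 hB
  refine Finset.sum_pos' (fun j _ => imageCov_apply_self_nonneg B hSZ.posSemidef j)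
    ⟨j, Finset.mem_univ j, ?_⟩
  rw [Matrix.diag_apply, imageCov_apply_self]
  have := hSZ.dotProduct_mulVec_pos hj
  simp only [star_trivial] at this
  positivity

end

/-! ### Deviation of the two losses -/

section
variable {D n : ℕ} {μ : Measure (EuclideanSpace ℝ (Fin D))} [IsProbabilityMeasure μ]
  {x : Fin n → EuclideanSpace ℝ (Fin D)} {a a' : ℝ}

/-- For `b < 0` this is already a threshold function, for `-u` at level `-b`. For `b ≥ 0` it is a
threshold function at level `b` plus an affine function, whose deviation is that of `⟪u, ∑ i, x i⟫`.
-/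
lemma abs_sum_max_sub_inner_le_of_norm_le_one
    (hint : ∀ u, Integrable (fun y => ⟪u, y⟫) μ) (hmean : ∀ u, ∫ y, ⟪u, y⟫ ∂μ = 0)
    (hx : ∀ s : ℝ × EuclideanSpace ℝ (Fin D), 0 ≤ s.1 ∧ ‖s.2‖ ≤ 1 →
      |∑ i, (threshold s (x i) - ∫ y, threshold s y ∂μ)| ≤ a) (hx' : ‖∑ i, x i‖ ≤ a')
    {u : EuclideanSpace ℝ (Fin D)} (hu : ‖u‖ ≤ 1) (b : ℝ) :
    |∑ i, (max (b - ⟪u, x i⟫) 0 - ∫ y, max (b - ⟪u, y⟫) 0 ∂μ)| ≤ a + a' := by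
  have ha' : 0 ≤ a' := (norm_nonneg _).trans hx'
  rcases lt_or_ge b 0 with hb | hb
  · have e (y : EuclideanSpace ℝ (Fin D)) : max (b - ⟪u, y⟫) 0 = threshold (-b, -u) y := by
      simp only [threshold, inner_neg_left]
      congr 1; ring
    simp only [e]
    have := hx (-b, -u) ⟨by simpa using hb.le, by simpa using hu⟩
    linarith
  · have e (y : EuclideanSpace ℝ (Fin D)) :
        max (b - ⟪u, y⟫) 0 = (b - ⟪u, y⟫) + threshold (b, u) y := by
      simp only [threshold]
      rcases le_total (⟪u, y⟫) b with h | h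
      · rw [max_eq_left (by linarith), max_eq_right (by linarith)]; ring
      · rw [max_eq_right (by linarith), max_eq_left (by linarith)]; ring
    have hi1 : Integrable (fun y => b - ⟪u, y⟫) μ := (integrable_const b).sub (hint u)
    have hi2 : Integrable (fun y => threshold (b, u) y) μ :=
      ((hint u).sub (integrable_const b)).pos_part
    simp only [e]
    rw [integral_add hi1 hi2, integral_sub (integrable_const b) (hint u), hmean]
    have e2 : ∑ i, (b - ⟪u, x i⟫ + threshold (b, u) (x i) -
        (∫ _ : EuclideanSpace ℝ (Fin D), b ∂μ - 0 + ∫ y, threshold (b, u) y ∂μ)) =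
        -⟪u, ∑ i, x i⟫ + ∑ i, (threshold (b, u) (x i) - ∫ y, threshold (b, u) y ∂μ) := by
      rw [inner_sum, ← Finset.sum_neg_distrib, ← Finset.sum_add_distrib]
      refine Finset.sum_congr rfl fun i _ => ?_
      simp only [integral_const, probReal_univ, one_smul]
      ring
    rw [e2]
    have h1 := hx (b, u) ⟨hb, hu⟩
    have h2 : |⟪u, ∑ i, x i⟫| ≤ a' := (abs_real_inner_le_norm _ _).trans <|
      (mul_le_of_le_one_left (norm_nonneg _) hu).trans hx'
    refine (abs_add_le _ _).trans ?_
    rw [abs_neg]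
    linarith

lemma abs_sum_max_sub_inner_le
    (hint : ∀ u, Integrable (fun y => ⟪u, y⟫) μ) (hmean : ∀ u, ∫ y, ⟪u, y⟫ ∂μ = 0)
    (hx : ∀ s : ℝ × EuclideanSpace ℝ (Fin D), 0 ≤ s.1 ∧ ‖s.2‖ ≤ 1 →
      |∑ i, (threshold s (x i) - ∫ y, threshold s y ∂μ)| ≤ a) (hx' : ‖∑ i, x i‖ ≤ a')
    (u : EuclideanSpace ℝ (Fin D)) (b : ℝ) :
    |∑ i, (max (b - ⟪u, x i⟫) 0 - ∫ y, max (b - ⟪u, y⟫) 0 ∂μ)| ≤ ‖u‖ * (a + a') := by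
  rcases eq_or_ne u 0 with rfl | hu
  · simp
  have hu' : 0 < ‖u‖ := norm_pos_iff.2 hu
  have e (y : EuclideanSpace ℝ (Fin D)) :
      max (b - ⟪u, y⟫) 0 = ‖u‖ * max (b / ‖u‖ - ⟪‖u‖⁻¹ • u, y⟫) 0 := by
    rw [mul_max_of_nonneg _ _ hu'.le, mul_zero, real_inner_smul_left]
    congr 1
    field_simp
  simp only [e]
  rw [integral_const_mul]
  simp only [← mul_sub]
  rw [← Finset.mul_sum, abs_mul, abs_of_pos hu']
  exact mul_le_mul_of_nonneg_left (abs_sum_max_sub_inner_le_of_norm_le_one hint hmean hx hx'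
    (by rw [norm_smul, norm_inv, norm_norm, inv_mul_cancel₀ hu'.ne']) _) hu'.le

/-- By Fubini the deviation is the average, with density `logitVar`, of hinge deviations bounded
uniformly in the level; the density has mass one. -/
lemma abs_sum_logistic_le
    (hint : ∀ u, Integrable (fun y => ⟪u, y⟫) μ) (hmean : ∀ u, ∫ y, ⟪u, y⟫ ∂μ = 0)
    (hx : ∀ s : ℝ × EuclideanSpace ℝ (Fin D), 0 ≤ s.1 ∧ ‖s.2‖ ≤ 1 →
      |∑ i, (threshold s (x i) - ∫ y, threshold s y ∂μ)| ≤ a) (hx' : ‖∑ i, x i‖ ≤ a')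
    (u : EuclideanSpace ℝ (Fin D)) (c : ℝ) :
    |∑ i, (logistic (c + ⟪u, x i⟫) - ∫ y, logistic (c + ⟪u, y⟫) ∂μ)| ≤ ‖u‖ * (a + a') := by
  have hlog : IsLoss logistic := ⟨logistic_nonneg, convexOn_logistic, logistic_abs_sub_le⟩
  have hc := continuous_logitVar
  let F : EuclideanSpace ℝ (Fin D) → ℝ → ℝ := fun y s =>
    max (s - (c + ⟪u, y⟫)) 0 * logitVar s
  have hF (y : EuclideanSpace ℝ (Fin D)) := integral_max_mul_logitVar (c + ⟪u, y⟫)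
  have hprod : Integrable (Function.uncurry F) (μ.prod volume) := by
    rw [integrable_prod_iff (Continuous.aestronglyMeasurable (by
      simp only [F, Function.uncurry_def]; fun_prop))]
    refine ⟨.of_forall fun y => (hF y).1, ?_⟩
    have e (y : EuclideanSpace ℝ (Fin D)) : ∫ s, ‖Function.uncurry F (y, s)‖ =
        logistic (c + ⟪u, y⟫) := by
      rw [← (hF y).2]
      refine integral_congr_ae (.of_forall fun s => ?_)
      exact Real.norm_of_nonneg (mul_nonneg (le_max_right _ _) (logitVar_pos s).le)
    simp only [e]
    exact hlog.integrable_comp ((integrable_const c).add (hint u))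
  have hswap : ∫ y, logistic (c + ⟪u, y⟫) ∂μ =
      ∫ s, (∫ y, max (s - c - ⟪u, y⟫) 0 ∂μ) * logitVar s := by
    calc ∫ y, logistic (c + ⟪u, y⟫) ∂μ = ∫ y, (∫ s, F y s) ∂μ :=
          integral_congr_ae (.of_forall fun y => (hF y).2.symm)
      _ = ∫ s, ∫ y, F y s ∂μ := integral_integral_swap hprod
      _ = _ := by
        refine integral_congr_ae (.of_forall fun s => ?_)
        simp only [F, ← sub_sub]
        exact integral_mul_const _ _
  have hswapint : Integrable fun s => (∫ y, max (s - c - ⟪u, y⟫) 0 ∂μ) * logitVar s := by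
    refine hprod.integral_prod_right.congr (.of_forall fun s => ?_)
    simp only [F, Function.uncurry_def, ← sub_sub]
    exact integral_mul_const _ _
  have hterm (i : Fin n) : Integrable fun s => max (s - c - ⟪u, x i⟫) 0 * logitVar s := by
    simpa only [sub_sub] using (hF (x i)).1
  have hrepr : ∑ i, (logistic (c + ⟪u, x i⟫) - ∫ y, logistic (c + ⟪u, y⟫) ∂μ) =
      ∫ s, (∑ i, (max (s - c - ⟪u, x i⟫) 0 - ∫ y, max (s - c - ⟪u, y⟫) 0 ∂μ)) * logitVar s := by
    simp only [Finset.sum_mul, sub_mul]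
    rw [integral_finsetSum Finset.univ (f := fun i s => max (s - c - ⟪u, x i⟫) 0 * logitVar s -
      (∫ y, max (s - c - ⟪u, y⟫) 0 ∂μ) * logitVar s) fun i _ => (hterm i).sub hswapint]
    refine Finset.sum_congr rfl fun i _ => ?_
    rw [integral_sub (hterm i) hswapint, ← hswap, ← (hF (x i)).2]
    simp only [sub_sub]
  rw [hrepr, ← Real.norm_eq_abs]
  refine (norm_integral_le_of_norm_le (integrable_logitVar.const_mul (‖u‖ * (a + a')))
    (.of_forall fun s => ?_)).trans (le_of_eq ?_)
  · rw [norm_mul, Real.norm_eq_abs, Real.norm_of_nonneg (logitVar_pos s).le]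
    exact mul_le_mul_of_nonneg_right (abs_sum_max_sub_inner_le hint hmean hx hx' u _)
      (logitVar_pos s).le
  · rw [integral_const_mul, integral_logitVar, mul_one]

lemma LossCondition.abs_sum_le {V : ℝ → ℝ} {σ β : ℝ} (hV : LossCondition V σ β)
    (hint : ∀ u, Integrable (fun y => ⟪u, y⟫) μ) (hmean : ∀ u, ∫ y, ⟪u, y⟫ ∂μ = 0)
    (hx : ∀ s : ℝ × EuclideanSpace ℝ (Fin D), 0 ≤ s.1 ∧ ‖s.2‖ ≤ 1 →
      |∑ i, (threshold s (x i) - ∫ y, threshold s y ∂μ)| ≤ a) (hx' : ‖∑ i, x i‖ ≤ a')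
    (u : EuclideanSpace ℝ (Fin D)) (c : ℝ) :
    |∑ i, (V (c + ⟪u, x i⟫) - ∫ y, V (c + ⟪u, y⟫) ∂μ)| ≤ ‖u‖ * (a + a') := by
  rcases hV with ⟨rfl, -⟩ | ⟨rfl, -⟩
  · simpa only [hinge, sub_sub] using abs_sum_max_sub_inner_le hint hmean hx hx' u (1 - c)
  · exact abs_sum_logistic_le hint hmean hx hx' u c

end

lemma logistic_neg (t : ℝ) : logistic (-t) = t + logistic t := by
  unfold logistic
  rw [neg_neg, ← Real.log_exp t, ← Real.log_mul (by positivity) (by positivity), Real.log_exp,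
    mul_add, mul_one, ← Real.exp_add, add_neg_cancel, Real.exp_zero, add_comm]

/-- Both losses have slope `-1` at or near `-∞`. The deviation bound is proved with constant `1`, so
this admits any Lipschitz constant `L`. -/
lemma LossCondition.one_le_of_abs_sub_le {V : ℝ → ℝ} {σ β L : ℝ} (hV : LossCondition V σ β)
    (hL : ∀ a b : ℝ, |V a - V b| ≤ L * |a - b|) : 1 ≤ L := by
  rcases hV with ⟨rfl, -⟩ | ⟨rfl, -⟩
  · have := hL 0 1
    norm_num [hinge] at this
    exact this
  · by_contra! hlt
    set t := (logistic 0 + 1) / (1 - L) with ht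
    have ht0 : 0 < t := div_pos (by linarith [logistic_nonneg 0]) (by linarith)
    have h1 := (le_abs_self _).trans (hL (-t) 0)
    rw [logistic_neg, sub_zero, abs_neg, abs_of_pos ht0] at h1
    have h2 : t * (1 - L) = logistic 0 + 1 := div_mul_cancel₀ _ (by linarith)
    linarith [logistic_nonneg t]

/-! ### From half-space functions to the objective -/

section
variable {D d K n : ℕ} {B : Matrix (Fin D) (Fin d) ℝ} {SZ : Matrix (Fin d) (Fin d) ℝ}
  {V : ℝ → ℝ} {σ β a a' : ℝ} {x : Fin n → EuclideanSpace ℝ (Fin D)}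

lemma norm_bit_smul (m : Fin K → ℤˣ) (k : Fin K) (u : EuclideanSpace ℝ (Fin D)) :
    ‖bit m k • u‖ = ‖u‖ := by
  rcases Int.units_eq_one_or (m k) with h | h <;> simp [bit, h]

/-- For each message and bit the deviation is at most `‖w k‖ (a + a')`, and Cauchy–Schwarz sums the
norms. -/
lemma LossCondition.uniformlyClose (hV : LossCondition V σ β) (hSZ : SZ.PosSemidef) (hn : 0 < n)
    (hx : ∀ s : ℝ × EuclideanSpace ℝ (Fin D), 0 ≤ s.1 ∧ ‖s.2‖ ≤ 1 →
      |∑ i, (threshold s (x i) - ∫ y, threshold s y ∂imageLaw B SZ σ)| ≤ a)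
    (hx' : ‖∑ i, x i‖ ≤ a') :
    UniformlyClose (K := K) V β B SZ σ x (√K * √(radiusSq V β K) * (a + a') / n) := by
  intro w hw
  have hn' : (0 : ℝ) < n := by positivity
  have ha : 0 ≤ a := (abs_nonneg _).trans (hx 0 (by simp))
  have ha' : 0 ≤ a' := (norm_nonneg _).trans hx'
  have hL := hV.isLoss
  set b : (Fin K → ℤˣ) → Fin K → ℝ := fun m k => ∑ j, bit m k * bit m j * ⟪w k, w j⟫ with hb
  have hdev (m : Fin K → ℤˣ) (k : Fin K) := hV.abs_sum_le (integrable_inner_imageLaw B)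
    (integral_inner_imageLaw B hSZ) hx hx' (bit m k • w k) (b m k)
  have hint : ∫ y, decodingLoss V w y ∂imageLaw B SZ σ = 𝔼 m : Fin K → ℤˣ, ∑ k,
      ∫ y, V (b m k + ⟪bit m k • w k, y⟫) ∂imageLaw B SZ σ := by
    simp only [decodingLoss_eq, Fintype.expect_eq_sum_div_card]
    rw [integral_div, integral_finsetSum _ fun m _ => integrable_finsetSum _ fun k _ =>
      hL.integrable_imageLaw B _ _]
    congr 1
    exact Finset.sum_congr rfl fun m _ => integral_finsetSum _ fun k _ =>
      hL.integrable_imageLaw B _ _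
  have hsum : ∑ i, (decodingLoss V w (x i) - ∫ y, decodingLoss V w y ∂imageLaw B SZ σ) =
      𝔼 m : Fin K → ℤˣ, ∑ k, ∑ i, (V (b m k + ⟪bit m k • w k, x i⟫) -
        ∫ y, V (b m k + ⟪bit m k • w k, y⟫) ∂imageLaw B SZ σ) := by
    simp only [hint]
    simp only [decodingLoss_eq, ← Finset.expect_sub_distrib, ← Finset.sum_sub_distrib]
    rw [← Finset.expect_sum_comm]
    exact Finset.expect_congr rfl fun m _ => Finset.sum_comm
  have hnorm : ∑ k, ‖w k‖ ≤ √K * √(radiusSq V β K) := by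
    rw [← Real.sqrt_mul (by positivity)]
    refine Real.le_sqrt_of_sq_le ?_
    have h := sq_sum_le_card_mul_sum_sq (s := (Finset.univ : Finset (Fin K))) (f := fun k => ‖w k‖)
    rw [Finset.card_univ, Fintype.card_fin] at h
    exact h.trans (mul_le_mul_of_nonneg_left hw (by positivity))
  have hmain : |∑ i, (decodingLoss V w (x i) - ∫ y, decodingLoss V w y ∂imageLaw B SZ σ)| ≤
      √K * √(radiusSq V β K) * (a + a') := by
    rw [hsum]
    refine (Finset.abs_expect_le _ _).trans ?_
    calc _ ≤ 𝔼 _m : Fin K → ℤˣ, ∑ k, ‖w k‖ * (a + a') := by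
          refine Finset.expect_le_expect fun m _ => (Finset.abs_sum_le_sum_abs _ _).trans ?_
          refine Finset.sum_le_sum fun k _ => ?_
          simpa only [norm_bit_smul] using hdev m k
      _ = (∑ k, ‖w k‖) * (a + a') := by rw [Fintype.expect_const, Finset.sum_mul]
      _ ≤ _ := mul_le_mul_of_nonneg_right hnorm (by positivity)
  have e : empLoss V β x w - popLoss V β B SZ σ w =
      (∑ i, (decodingLoss V w (x i) - ∫ y, decodingLoss V w y ∂imageLaw B SZ σ)) / n := by
    simp only [empLoss, popLoss, Finset.sum_sub_distrib, Finset.sum_const, Finset.card_univ,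
      Fintype.card_fin, nsmul_eq_mul]
    field_simp
    ring
  rw [e, abs_div, abs_of_pos hn']
  exact div_le_div_of_nonneg_right hmain hn'.le

lemma exp_tail_le {y δ : ℝ} (hy : 1 ≤ y) (hδ : δ = 4 * Real.exp (-y)) :
    5 * Real.exp (-((17 / 3 * √y + 4) ^ 2 / 32)) + 2 * Real.exp (-((8 / 3 * √y) ^ 2 / 2)) ≤ δ := by
  have hs : √y ^ 2 = y := Real.sq_sqrt (by linarith)
  have hs1 : 1 ≤ √y := Real.one_le_sqrt.2 hy
  have h1 : Real.exp (-((17 / 3 * √y + 4) ^ 2 / 32)) ≤ Real.exp (-y) * Real.exp (-1) := by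
    rw [← Real.exp_add]
    exact Real.exp_le_exp.2 (by nlinarith)
  have h2 : Real.exp (-((8 / 3 * √y) ^ 2 / 2)) ≤ Real.exp (-y) :=
    Real.exp_le_exp.2 (by nlinarith)
  have h3 : Real.exp (-1) ≤ 2 / 5 := by
    rw [Real.exp_neg, inv_le_comm₀ (Real.exp_pos _) (by norm_num)]
    have := Real.exp_one_gt_d9
    norm_num; linarith
  have h4 := Real.exp_pos (-y)
  nlinarith

theorem LossCondition.le_measure_uniformlyClose (hV : LossCondition V σ β) (hσ : 0 ≤ σ)
    (hSZ : SZ.PosDef) (hB : B ≠ 0) {L : ℝ}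
    (hL : ∀ a b : ℝ, |V a - V b| ≤ L * |a - b|) (hn : 0 < n) {δ : ℝ} (hδ : δ ∈ Ioo (0 : ℝ) 1) :
    ENNReal.ofReal (1 - δ) ≤ Measure.pi (fun _ : Fin n => imageLaw B SZ σ)
      {x | UniformlyClose (K := K) V β B SZ σ x (deviation V β K B SZ σ L n δ)} := by
  have hn' : (1 : ℝ) ≤ n := by exact_mod_cast hn
  have hn0 : (0 : ℝ) < n := by linarith
  set y := Real.log (4 / δ) with hy
  have h4δ : 4 ≤ 4 / δ := by rw [le_div_iff₀ hδ.1]; linarith [hδ.2]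
  have hy1 : 1 ≤ y := by
    rw [hy, Real.le_log_iff_exp_le (by linarith)]
    have := Real.exp_one_lt_d9
    linarith
  have hδy : δ = 4 * Real.exp (-y) := by
    rw [Real.exp_neg, hy, Real.exp_log (by linarith)]
    have := hδ.1
    field_simp
  have htr := trace_imageCov_pos (σ := σ) B hSZ hB
  set T := √(imageCov B SZ σ).trace with hT
  have hT0 : 0 < T := Real.sqrt_pos.2 htr
  have hs1 : 1 ≤ √y := Real.one_le_sqrt.2 hy1
  have hsn : 0 < √(n : ℝ) := Real.sqrt_pos.2 hn0
  have hsn2 : √(n : ℝ) ^ 2 = n := Real.sq_sqrt hn0.le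
  have htail := exp_tail_le hy1 hδy
  -- The two levels add up to `√n T (4 + 25 / 3 * √y)`. With `δ = 4 exp (-y)`, the empirical process
  -- costs at most `5 exp (-1) exp (-y) ≤ 2 exp (-y)` and the linear part `2 exp (-y)`.
  have hprob := le_measure_forall_threshold_le (n := n) (μ := imageLaw B SZ σ)
    (v := fun j => imageCov B SZ σ j j) (T := T) (a := √n * T * (17 / 3 * √y + 4))
    (a' := √n * T * (8 / 3 * √y)) (δ := δ)
    (imageCov_apply_self_nonneg B hSZ.posSemidef) (Real.sq_sqrt htr.le).symm hT0
    (integral_exp_mul_apply_imageLaw B hSZ.posSemidef hσ) hn (by positivity) (by positivity) (by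
      have e1 : (√n * T * (17 / 3 * √y + 4)) ^ 2 / (32 * n * T ^ 2) =
          (17 / 3 * √y + 4) ^ 2 / 32 := by
        rw [mul_pow, mul_pow, hsn2]; field_simp
      have e2 : (√n * T * (8 / 3 * √y)) ^ 2 / (2 * n * T ^ 2) = (8 / 3 * √y) ^ 2 / 2 := by
        rw [mul_pow, mul_pow, hsn2]; field_simp
      rw [e1, e2]; exact htail)
  refine hprob.trans (measure_mono ?_)
  rintro x ⟨hx, hx'⟩
  show UniformlyClose (K := K) V β B SZ σ x (deviation V β K B SZ σ L n δ)
  intro w hw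
  refine (hV.uniformlyClose hSZ.posSemidef hn hx hx' w hw).trans ?_
  have hL1 := hV.one_le_of_abs_sub_le hL
  -- The term of order `1 / n` in the deviation level only needs to be nonnegative.
  have hlog : 0 ≤ 75 * Real.log (2 * Real.exp 1) / (2 * Real.log 2) *
      (Real.log (4 * n / δ) * y / n) := by
    have h1 : 0 ≤ Real.log (2 * Real.exp 1) :=
      Real.log_nonneg (by linarith [Real.add_one_le_exp 1])
    have h2 : 0 ≤ Real.log (4 * n / δ) := Real.log_nonneg (by
      rw [le_div_iff₀ hδ.1]; linarith [hδ.2])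
    have h3 : 0 ≤ Real.log 2 := Real.log_nonneg (by norm_num)
    positivity
  rw [deviation, Real.sqrt_mul (by positivity : (0 : ℝ) ≤ K), ← hT, ← hy]
  have e3 : √K * √(radiusSq V β K) *
      (√n * T * (17 / 3 * √y + 4) + √n * T * (8 / 3 * √y)) / n =
      1 * (√(radiusSq V β K) * (√K * T) * ((4 + 25 / 3 * √y) / √n)) := by
    rw [div_eq_iff hn0.ne']
    have : (4 + 25 / 3 * √y) / √n * n = (4 + 25 / 3 * √y) * √n := by
      rw [div_mul_eq_mul_div, div_eq_iff hsn.ne', mul_assoc, ← sq, hsn2]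
    linear_combination (-(√(radiusSq V β K) * (√K * T))) * this
  rw [e3, mul_assoc L, mul_assoc L]
  refine mul_le_mul hL1 (mul_le_mul_of_nonneg_left ?_ (by positivity)) (by positivity)
    (by linarith)
  linarith

end

end Watermark

theorem theorem3 {D d K : ℕ} (hd : 0 < d) (hK : 0 < K) (hdD : d + K < D)
    (B : Matrix (Fin D) (Fin d) ℝ) (hB : B.rank = d)
    (SZ : Matrix (Fin d) (Fin d) ℝ) (hSZ : SZ.PosDef)
    (σ β : ℝ) (hσ : 0 ≤ σ) (hβ : 0 < β)
    (V : ℝ → ℝ) (hV : Watermark.LossCondition V σ β) :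
    -- existence of minimizers, all of them in the ball
    (∀ n : ℕ, 0 < n → ∀ x : Fin n → EuclideanSpace ℝ (Fin D),
      (∃ w : Fin K → EuclideanSpace ℝ (Fin D), IsMinOn (Watermark.empLoss V β x) univ w) ∧
      ∀ w : Fin K → EuclideanSpace ℝ (Fin D), IsMinOn (Watermark.empLoss V β x) univ w →
        w ∈ Watermark.ball V β D K) ∧
    -- the unique minimizer of the one-dimensional population loss on the half-line
    ∃ rstar : ℝ, 0 < rstar ∧ IsMinOn (Watermark.hpop V σ β) (Ici 0) rstar ∧
      (∀ r ∈ Ici (0 : ℝ), IsMinOn (Watermark.hpop V σ β) (Ici 0) r → r = rstar) ∧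
    -- constants that do not depend on the sample size, the sample, `ε` or `δ`
    ∃ τ : ℝ, 0 < τ ∧ ∃ C : ℝ, 0 < C ∧
      -- the geometry of the minimizers under a uniform deviation of at most `ε`
      (∀ n : ℕ, 0 < n → ∀ (x : Fin n → EuclideanSpace ℝ (Fin D)) (ε : ℝ), ε ≤ τ →
        Watermark.UniformlyClose (K := K) V β B SZ σ x ε →
        ∀ w : Fin K → EuclideanSpace ℝ (Fin D), IsMinOn (Watermark.empLoss V β x) univ w →
          Watermark.GeometricBounds V σ B rstar C ε w) ∧
      -- the explicit uniform deviation bound for an i.i.d. sample, and its consequence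
      (∀ L : ℝ, 0 < L → (∀ a b : ℝ, |V a - V b| ≤ L * |a - b|) →
        ∀ n : ℕ, 0 < n → ∀ δ ∈ Ioo (0 : ℝ) 1,
          ENNReal.ofReal (1 - δ) ≤
            Measure.pi (fun _ : Fin n => Watermark.imageLaw B SZ σ)
              {x | Watermark.UniformlyClose (K := K) V β B SZ σ x
                (Watermark.deviation V β K B SZ σ L n δ)} ∧
          (Watermark.deviation V β K B SZ σ L n δ ≤ τ →
            ENNReal.ofReal (1 - δ) ≤
              Measure.pi (fun _ : Fin n => Watermark.imageLaw B SZ σ)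
                {x | ∀ w : Fin K → EuclideanSpace ℝ (Fin D),
                  IsMinOn (Watermark.empLoss V β x) univ w →
                    Watermark.GeometricBounds V σ B rstar C
                      (Watermark.deviation V β K B SZ σ L n δ) w})) := by
  have hL := hV.isLoss
  have hB0 : B ≠ 0 := by
    rintro rfl
    rw [Matrix.rank_zero] at hB
    exact hd.ne hB
  obtain ⟨rstar, hr₀, hmin, hgrowth⟩ := hV.exists_quadraticGrowth hσ hβ
  obtain ⟨τ, hτ, C, hC, hgeom⟩ := Watermark.exists_geometricBounds (D := D) (K := K) (B := B)
    hV hσ hβ hSZ hr₀ hmin hgrowth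
  have hbounds (n : ℕ) (hn : 0 < n) (x : Fin n → EuclideanSpace ℝ (Fin D)) (ε : ℝ) (hε : ε ≤ τ)
      (hx : Watermark.UniformlyClose (K := K) V β B SZ σ x ε)
      (w : Fin K → EuclideanSpace ℝ (Fin D)) (hw : IsMinOn (Watermark.empLoss V β x) univ w) :
      Watermark.GeometricBounds V σ B rstar C ε w := by
    obtain ⟨hwb, hε0, hpop⟩ := hL.popLoss_le_of_uniformlyClose hβ hσ hSZ.posSemidef hdD hr₀ hmin
      hn hx hw
    exact hgeom w hwb ε hε0 hε hpop
  refine ⟨fun n hn x => hL.exists_isMinOn_empLoss hβ hn x, rstar, hr₀, hmin,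
    fun r hr hr' => hgrowth.eq_of_isMinOn hr₀.le hr hr', τ, hτ, C, hC, hbounds,
    fun L _ hLip n hn δ hδ => ?_⟩
  have hprob := hV.le_measure_uniformlyClose (K := K) hσ hSZ hB0 hLip hn hδ
  exact ⟨hprob, fun hdev => hprob.trans (measure_mono fun x hx w hw =>
    hbounds n hn x _ hdev hx w hw)⟩
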